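/- Setup. Let $G=(V,E)$ be an acyclic directed graph, multiple edges allowed, on $V=\{0,1,\dots,n\}$, such that every edge $e$ goes from a smaller vertex $\mathrm{tail}(e)$ to a larger vertex $\mathrm{head}(e)$ and $n$ is the only sink. Let $a=(a_0,\dots,a_n)\in\mathbb Z^{n+1}$ with $\sum_v a_v=0$ and $a_v\ge 0$ for $v<n$. The flow polytope $\mathcal F_G(a)$ is the set of $\varphi\in\mathbb R_{\ge0}^E$ with $a_v+\sum_{\mathrm{head}(e)=v}\varphi(e)=\sum_{\mathrm{tail}(e)=v}\varphi(e)$ for all $v\in V$. An $a$-augmented graph $\hat G$ of $G$ arises from $G$ by adding a set $X$ of $|a_n|$ inflow half-edges (with a head and no tail), $a_v$ of them with head $v$ for each $v<n$, and one outflow half-edge $y$ (with tail $n$ and no head). A framing of a graph (with or without half-edges) is a choice, for each vertex, of a total order on its incoming and a total order on its outgoing (half-)edges. Let $F$ be a framing of $G$, and let $\hat F$ be a framing of $\hat G$ that orders the edges of $G$ in the same way as $F$ does. A path is a sequence of (half-)edges, each one ending where the next begins. For a path $P$ through $v$ let $Pv$ and $vP$ be its parts before and after $v$. Two different paths ending at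 $v$, neither a subpath of the other, are compared by going backwards from $v$ to the first vertex where they diverge and comparing the incoming edges there; paths starting at $v$ are compared likewise, going forwards and using outgoing edges. Paths $P,Q$ are in conflict at a common vertex $v$ if $Pv,Qv$ and $vP,vQ$ are in strictly opposite orders; they are coherent if they have no conflict; a set of paths is coherent if its elements are pairwise coherent. A route of $\hat G$ is a path that starts with an inflow half-edge and ends with $y$; for routes $P,Q$ starting with the same $x\in X$ write $P\prec_x Q$ if, after deletion of $x$, $P$ is below $Q$ in the order of paths starting at the head of $x$. A route matching is a coherent set $\mathcal P=\{P_x\mid x\in X\}$ with $P_x$ a route starting with $x$; its indicator flow is $z(\mathcal P)=\sum_{x\in X}z(P_x)\in\mathbb Z^E$, where $z(P)\in\{0,1\}^E$ is the indicator function of $P$. Route matchings $\mathcal P,\mathcal Q$ are coherent if the set of routes $\mathcal P\cup\mathcal Q$ is coherent and there are no $x\ne x'$ in $X$ with $P_x\prec_x Q_x$ and $Q_{x'}\prec_{x'}P_{x'}$. A clique is a set of pairwise coherent route matchings; it is saturated if it is maximal under inclusion. Put $\Delta_{\mathcal C}=\mathrm{conv}\{z(\mathcal P)\mid\mathcal P\in\mathcal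 C\}$. Theorem. The sets $\Delta_{\mathcal C}$, for $\mathcal C$ a saturated clique, are the maximal simplices of a unimodular triangulation of $\mathcal F_G(a)$. That is: they are the facets of a finite geometric simplicial complex whose union is $\mathcal F_G(a)$, and for each of them the vertices lie in $\mathbb Z^E$ and the differences of the vertices from any one vertex form a $\mathbb Z$-basis of the lattice of integer vectors in the linear space parallel to the affine hull of $\mathcal F_G(a)$. For each saturated clique $\mathcal C$ the points $z(\mathcal P)$, $\mathcal P\in\mathcal C$, are distinct and affinely independent, and different saturated cliques have different simplices $\Delta_{\mathcal C}$. This generalizes the Danilov–Karzanov–Koshevoy triangulation: if $n\ge1$, $0$ is the only source of $G$ and $a=e_0-e_n$, then $\{\Delta_{\mathcal C}\}$ is the set of all $\mathrm{conv}\{z(P)\mid P\in C\}$, where $C$ runs over the inclusion-maximal sets of pairwise coherent routes of $(G,F)$, a route of $G$ being a path that cannot be extended by an edge at either end. -/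

import Mathlib

namespace FlowTri

/-! ### Directed graphs with half-edges, framings, coherence of paths -/

/-- A directed multigraph on the vertex set `V` with edge set `D`, in which half-edges are allowed:
an edge without tail is an inflow half-edge, an edge without head is an outflow half-edge. -/
structure HalfEdgeGraph (V D : Type*) where
  tail : D → Option V
  head : D → Option V

namespace HalfEdgeGraph

variable {V D : Type*} (H : HalfEdgeGraph V D)

/-- Edges and half-edges coming into `v`. -/
abbrev In (v : V) : Type _ := {e : D // H.head e = some v}

/-- Edges and half-edges going out of `v`. -/
abbrev Out (v : V) : Type _ := {e : D // H.tail e = some v}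

/-- A framing: a total order on the incoming and on the outgoing incidences of every vertex. -/
structure Framing where
  inOrder : ∀ v : V, LinearOrder (H.In v)
  outOrder : ∀ v : V, LinearOrder (H.Out v)

/-- A path: a nonempty list of edges, the head of each one being the tail of the next one. -/
def IsPath (P : List D) : Prop :=
  P ≠ [] ∧ P.IsChain fun e f => ∃ v, H.head e = some v ∧ H.tail f = some v

/-- The path `P` visits the vertex `v`, with `Pv = p` and `vP = q`
(one of the two is empty if `v` is the first or the last vertex of `P`). -/
def SplitsAt (v : V) (P p q : List D) : Prop :=
  P ≠ [] ∧ P = p ++ q ∧ (∀ e ∈ p.getLast?, H.head e = some v) ∧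
    (∀ e ∈ q.head?, H.tail e = some v)

namespace Framing

variable {H} (F : H.Framing)

/-- `e` and `f` both come into `v` and `e` is strictly below `f` there. -/
def InLt (v : V) (e f : D) : Prop :=
  ∃ (he : H.head e = some v) (hf : H.head f = some v), (F.inOrder v).lt ⟨e, he⟩ ⟨f, hf⟩

/-- `e` and `f` both go out of `v` and `e` is strictly below `f` there. -/
def OutLt (v : V) (e f : D) : Prop :=
  ∃ (he : H.tail e = some v) (hf : H.tail f = some v), (F.outOrder v).lt ⟨e, he⟩ ⟨f, hf⟩

/-- The strict order on paths ending at a common vertex: walk backwards along the common part `c`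
to the vertex `w` where the two paths first diverge and compare the incoming edges there. -/
def InPathLt (p q : List D) : Prop :=
  ∃ (w : V) (c p' q' : List D) (e f : D),
    p = p' ++ e :: c ∧ q = q' ++ f :: c ∧ F.InLt w e f

/-- The strict order on paths starting at a common vertex: walk forwards along the common part `c`
to the vertex `w` where the two paths first diverge and compare the outgoing edges there. -/
def OutPathLt (p q : List D) : Prop :=
  ∃ (w : V) (c p' q' : List D) (e f : D),
    p = c ++ e :: p' ∧ q = c ++ f :: q' ∧ F.OutLt w e f

/-- Two paths are in conflict at `v`: both visit `v`, and the parts before `v` and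
the parts after `v` are in opposite relative order. -/
def ConflictAt (v : V) (P Q : List D) : Prop :=
  ∃ p p' q q' : List D, H.SplitsAt v P p p' ∧ H.SplitsAt v Q q q' ∧
    ((F.InPathLt p q ∧ F.OutPathLt q' p') ∨ (F.InPathLt q p ∧ F.OutPathLt p' q'))

/-- Two paths are coherent if they have no conflict at any vertex. -/
def Coherent (P Q : List D) : Prop := ∀ v, ¬ F.ConflictAt v P Q

/-- A set of paths is coherent if its elements are pairwise coherent. -/
def CoherentSet (S : Set (List D)) : Prop := ∀ P ∈ S, ∀ Q ∈ S, F.Coherent P Q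

end Framing

end HalfEdgeGraph

/-! ### Graphs and flow polytopes -/

/-- An acyclic directed multigraph on the vertices `0, …, n` with edge set `E`, labelled so that
edges go from smaller to larger vertices, with unique sink `n`. -/
structure FlowGraph (n : ℕ) (E : Type*) where
  tail : E → Fin (n + 1)
  head : E → Fin (n + 1)
  tail_lt_head : ∀ e, tail e < head e
  exists_out : ∀ v, v ≠ Fin.last n → ∃ e, tail e = v

/-- The indicator function in `ℝ^E` of a set of edges. -/
noncomputable def edgeIndicator {E : Type*} (S : Set E) : E → ℝ := S.indicator 1

namespace FlowGraph

variable {n : ℕ} {E : Type*} (G : FlowGraph n E)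

/-- A graph, seen as a graph with half-edges that has no half-edges. -/
def toHalf : HalfEdgeGraph (Fin (n + 1)) E where
  tail e := some (G.tail e)
  head e := some (G.head e)

/-- The flow polytope of `G` with netflow `a`. -/
def flowPolytope [Fintype E] (a : Fin (n + 1) → ℤ) : Set (E → ℝ) :=
  {φ | (∀ e, 0 ≤ φ e) ∧
    ∀ v, (a v : ℝ) + ∑ e with G.head e = v, φ e = ∑ e with G.tail e = v, φ e}

/-- A route of `G`: a path that cannot be extended by an initial or by a final edge. -/
def IsRoute (P : List E) : Prop :=
  G.toHalf.IsPath P ∧ (∀ e, ¬ G.toHalf.IsPath (e :: P)) ∧ (∀ e, ¬ G.toHalf.IsPath (P ++ [e]))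

/-- A clique of routes of the framed graph `(G, F)`. -/
def IsRouteClique (F : G.toHalf.Framing) (C : Set (List E)) : Prop :=
  (∀ P ∈ C, G.IsRoute P) ∧ F.CoherentSet C

/-- The convex hull of the indicator functions of a set of routes of `G`. -/
noncomputable def routeSimplex (C : Set (List E)) : Set (E → ℝ) :=
  convexHull ℝ ((fun P : List E => edgeIndicator {e | e ∈ P}) '' C)

/-- The Danilov–Karzanov–Koshevoy triangulation of the framed graph `(G, F)`: the simplices
of the inclusion-maximal cliques of routes. -/
noncomputable def DKK (F : G.toHalf.Framing) : Set (Set (E → ℝ)) :=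
  routeSimplex '' {C | Maximal (G.IsRouteClique F) C}

end FlowGraph

/-! ### Augmented graphs -/

/-- The edges of an augmented graph: the edges of the graph, the inflow half-edges `x ∈ X`, and
one outflow half-edge `y`. -/
inductive HatEdge (E X : Type*) where
  | edge (e : E) : HatEdge E X
  | inflow (x : X) : HatEdge E X
  | outflow : HatEdge E X

/-- An `a`-augmented graph of `G`, with set `X` of inflow half-edges: `foot x` is the
vertex of `x`. There are `|a_n|` inflow half-edges, `a_v` of them at `v` for each `v < n`. -/
structure AugmentedGraph {n : ℕ} {E : Type*} (G : FlowGraph n E) (a : Fin (n + 1) → ℤ)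
    (X : Type*) [Fintype X] where
  foot : X → Fin (n + 1)
  card_inflow : (Fintype.card X : ℤ) = |a (Fin.last n)|
  card_foot : ∀ v, v ≠ Fin.last n → (Nat.card {x // foot x = v} : ℤ) = a v

namespace AugmentedGraph

variable {n : ℕ} {E : Type*} {G : FlowGraph n E} {a : Fin (n + 1) → ℤ} {X : Type*} [Fintype X]
  (Ghat : AugmentedGraph G a X)

/-- The underlying graph with half-edges of an augmented graph; the outflow half-edge is at `n`. -/
def toHalf : HalfEdgeGraph (Fin (n + 1)) (HatEdge E X) where
  tail
    | .edge e => some (G.tail e)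
    | .inflow _ => none
    | .outflow => some (Fin.last n)
  head
    | .edge e => some (G.head e)
    | .inflow x => some (Ghat.foot x)
    | .outflow => none

variable {Ghat} (Fhat : Ghat.toHalf.Framing)

/-- The framing of the augmented graph orders the edges of `G` as the framing `F` of `G` does. -/
def ConsistentWith (F : G.toHalf.Framing) : Prop :=
  ∀ (v : Fin (n + 1)) (e f : E),
    (Fhat.InLt v (.edge e) (.edge f) ↔ F.InLt v e f) ∧
    (Fhat.OutLt v (.edge e) (.edge f) ↔ F.OutLt v e f)

/-- A route matching: a coherent set of routes, with one route `P_x` for each inflow half-edge `x`,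
which starts with `x` and ends with the outflow half-edge. -/
structure RouteMatching where
  route : X → List (HatEdge E X)
  isPath : ∀ x, Ghat.toHalf.IsPath (route x)
  head_route : ∀ x, (route x).head? = some (.inflow x)
  last_route : ∀ x, (route x).getLast? = some .outflow
  coherent : Fhat.CoherentSet (Set.range route)

namespace RouteMatching

variable {Fhat} (P Q : RouteMatching Fhat)

/-- The strict order on the routes that start with `x`, at `x`: forget `x` and compare
the remaining paths, which start at a common vertex. -/
def RouteLt (x : X) : Prop := Fhat.OutPathLt (P.route x).tail (Q.route x).tail

/-- Local coherence: the set of all routes of the two route matchings is coherent. -/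
def LocallyCoherent : Prop := Fhat.CoherentSet (Set.range P.route ∪ Set.range Q.route)

/-- A global conflict between `x` and `x'`. -/
def GlobalConflict (x x' : X) : Prop := x ≠ x' ∧ P.RouteLt Q x ∧ Q.RouteLt P x'

/-- Coherence of route matchings: both local and global. -/
def Coherent : Prop := P.LocallyCoherent Q ∧ ∀ x x', ¬ P.GlobalConflict Q x x'

/-- The indicator flow of a route matching: the sum of the indicators of its routes. -/
noncomputable def flow : E → ℝ :=
  ∑ x, edgeIndicator {e : E | HatEdge.edge e ∈ P.route x}

end RouteMatching

/-- A clique: a set of pairwise coherent route matchings. -/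
def IsClique (C : Set (RouteMatching Fhat)) : Prop :=
  ∀ P ∈ C, ∀ Q ∈ C, P.Coherent Q

/-- The saturated cliques: those that are maximal with respect to inclusion. -/
def satCliques : Set (Set (RouteMatching Fhat)) := {C | Maximal (IsClique Fhat) C}

variable {Fhat} in
/-- The convex hull of the indicator flows of a set of route matchings. -/
noncomputable def simplex (C : Set (RouteMatching Fhat)) : Set (E → ℝ) :=
  convexHull ℝ (RouteMatching.flow '' C)

end AugmentedGraph

/-! ### Unimodular triangulations -/

/-- The simplex with vertex set `s` is unimodular in the polytope `P`: its vertices are lattice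
points, and its edge vectors at any vertex generate the lattice of all integer
vectors parallel to the affine hull of `P`. -/
def IsUnimodularIn {E : Type*} (P : Set (E → ℝ)) (s : Finset (E → ℝ)) : Prop :=
  (∀ v ∈ s, ∀ e, ∃ k : ℤ, v e = k) ∧
  ∀ v₀ ∈ s, (Submodule.span ℤ ((fun v => v - v₀) '' (s : Set (E → ℝ))) : Set (E → ℝ)) =
    {u | u ∈ vectorSpan ℝ P ∧ ∀ e, ∃ k : ℤ, u e = k}

/-- The set `T` is (the set of maximal simplices of) a unimodular triangulation of `P`: there is
a finite geometric simplicial complex with underlying space `P` whose facets are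
the simplices in `T`, all of them unimodular. -/
def IsUnimodularTriangulation {E : Type*} (P : Set (E → ℝ)) (T : Set (Set (E → ℝ))) : Prop :=
  ∃ K : Geometry.SimplicialComplex ℝ (E → ℝ),
    K.faces.Finite ∧ K.space = P ∧
    (fun s : Finset (E → ℝ) => convexHull ℝ (s : Set (E → ℝ))) '' K.facets = T ∧
    ∀ s ∈ K.facets, IsUnimodularIn P s

end FlowTri

namespace FlowTri

/-! ### Acyclic networks with numbered vertices and ranked incidences -/

/-! The heart of the matter is a bijection, for every k, between the integer points of the k-fold
dilation of the flow polytope and the multisets of k pairwise coherent route matchings, given by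
adding up indicator flows.

To decompose an integral flow ψ, divide each edge e into ψ(e) parallel lanes. At every inner vertex
line up the incoming lanes in framing order, do the same with the outgoing lanes, and join the i-th
incoming lane to the i-th outgoing one; conservation makes the numbers match. Each lane then lies on
exactly one trajectory. Trajectories keep their order along common segments, so they never cross,
and the k trajectories from one source are ordered by their starting lanes (`exists_orderedFamily`).
The i-th trajectories from all sources form a route matching, and the resulting sequence of
matchings increases weakly at every source, which rules out global conflicts. Conversely, pairwise
coherent matchings with multiplicities can be sorted into such a sequence by a potential
(`exists_isOrdered`).

For uniqueness, reconstruct the routes vertex by vertex. The tokens present at a vertex are totally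
ordered by their pasts, and those leaving through the edges of rank at most c form an initial
segment whose size is prescribed by the flow (`outSets_eq`, `IsOrderedFamily.unique`).

The rest is convex geometry. Applying ℚ-linear maps from ℝ to ℚ that approximate the identity
carries existence and uniqueness from integral to real points (`CliqueCoordinates.of_integral`).
Existence makes the simplices cover the polytope, uniqueness makes them simplices that meet in
common faces, and integrality of the coefficients makes them unimodular; a perturbation argument
shows that maximal cliques span the affine hull (`vectorSpan_le`). For netflow `e_0 - e_n` there is
one inflow half-edge, so a route matching is a single route and both notions of coherence agree
(`image_simplex_eq_DKK`). -/

/-- An acyclic directed multigraph with sources `X`: vertices are natural numbers, `0` stands for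
the missing tails of the sources and `top` for the missing heads of the outgoing half-edges. The
edges at each vertex are ordered by their ranks. -/
structure RankedNet (D X : Type*) where
  tl : D → ℕ
  hd : D → ℕ
  inRank : D → ℕ
  outRank : D → ℕ
  top : ℕ
  src : X → D
  tl_lt_hd : ∀ e, tl e < hd e
  hd_le_top : ∀ e, hd e ≤ top
  tl_src : ∀ x, tl (src x) = 0
  src_injective : Function.Injective src
  exists_src : ∀ e, tl e = 0 → ∃ x, src x = e
  inRank_inj : ∀ e f, hd e = hd f → inRank e = inRank f → e = f
  -- The sources all leave the fictitious vertex 0, where no order is given, so positivity of the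
  -- tail is needed here.
  outRank_inj : ∀ e f, tl e = tl f → 0 < tl e → outRank e = outRank f → e = f

namespace RankedNet

variable {D X : Type*} (N : RankedNet D X)

/-- Consecutive edges of the list are adjacent. -/
def IsWalk (P : List D) : Prop := P.IsChain fun e f => N.hd e = N.tl f

/-- A route from the source `x` to the top. -/
structure IsRoute (x : X) (P : List D) : Prop where
  head : P.head? = some (N.src x)
  walk : N.IsWalk P
  last : ∃ p e, P = p ++ [e] ∧ N.hd e = N.top

/-- `P` enters a common segment below `Q` and leaves it above `Q`. -/
def Crossing (P Q : List D) : Prop :=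
  ∃ (c p p' q q' : List D) (e f g h : D), P = p ++ e :: (c ++ g :: p') ∧
    Q = q ++ f :: (c ++ h :: q') ∧ N.hd e = N.hd f ∧ N.inRank e < N.inRank f ∧
    N.tl g = N.tl h ∧ N.outRank h < N.outRank g

/-- `P` is below `Q` at the first vertex where they diverge. -/
def Below (P Q : List D) : Prop :=
  ∃ (c p q : List D) (e f : D), P = c ++ e :: p ∧ Q = c ++ f :: q ∧
    N.tl e = N.tl f ∧ N.outRank e < N.outRank f

/-- `k` routes from each source, pairwise without crossings, those from one source increasing. -/
structure IsOrderedFamily {k : ℕ} (R : X → Fin k → List D) : Prop where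
  route : ∀ x i, N.IsRoute x (R x i)
  not_crossing : ∀ x i y j, ¬ N.Crossing (R x i) (R y j)
  not_below : ∀ x i j, i < j → ¬ N.Below (R x j) (R x i)

variable {N} {P Q : List D} {x y : X}

/-- Acyclicity in its usable form: tails increase strictly, so a walk leaves no vertex twice and
repeats no edge. -/
lemma IsWalk.pairwise_tl (h : N.IsWalk P) : P.Pairwise fun e f => N.tl e < N.tl f := by
  have hP : P.IsChain fun e f => N.tl e < N.tl f :=
    List.IsChain.imp (fun e f (hef : N.hd e = N.tl f) => hef ▸ N.tl_lt_hd e) h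
  have : IsTrans D fun e f => N.tl e < N.tl f := ⟨fun _ _ _ => lt_trans⟩
  exact List.isChain_iff_pairwise.1 hP

lemma IsWalk.nodup (h : N.IsWalk P) : P.Nodup :=
  h.pairwise_tl.imp fun hef => by rintro rfl; exact lt_irrefl _ hef

/-- Since tails increase strictly, the vertex that an edge leaves determines both the edge and its
place in the walk. -/
lemma IsWalk.eq_of_tl_eq (h : N.IsWalk P) {p p' q q' : List D} {e f : D}
    (hp : P = p ++ e :: q) (hq : P = p' ++ f :: q') (hef : N.tl e = N.tl f) :
    p = p' ∧ e = f ∧ q = q' := by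
  have hpw := h.pairwise_tl
  have key : ∀ {p p' q q' : List D} {e f : D}, (p ++ e :: q).Pairwise (fun e f => N.tl e < N.tl f) →
      p ++ e :: q = p' ++ f :: q' → N.tl e = N.tl f → p = p' ∧ e = f ∧ q = q' := by
    intro p
    induction p with
    | nil =>
      intro p' q q' e f hpw heq hef
      cases p' with
      | nil => simpa using heq
      | cons a p' =>
        simp only [List.nil_append, List.cons_append, List.cons.injEq] at heq
        obtain ⟨rfl, rfl⟩ := heq
        have := (List.pairwise_cons.1 hpw).1 f (by simp)
        omega
    | cons a p ih =>
      intro p' q q' e f hpw heq hef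
      cases p' with
      | nil =>
        simp only [List.nil_append, List.cons_append, List.cons.injEq] at heq
        obtain ⟨rfl, rfl⟩ := heq
        have := (List.pairwise_cons.1 hpw).1 e (by simp)
        omega
      | cons b p' =>
        simp only [List.cons_append, List.cons.injEq] at heq
        obtain ⟨rfl, heq⟩ := heq
        obtain ⟨rfl, rfl, rfl⟩ := ih (List.pairwise_cons.1 hpw).2 heq hef
        exact ⟨rfl, rfl, rfl⟩
  subst hp
  exact key hpw hq hef

lemma IsWalk.eq_of_mem (h : N.IsWalk P) {e f : D} (he : e ∈ P) (hf : f ∈ P)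
    (hef : N.tl e = N.tl f) : e = f := by
  obtain ⟨p, q, hp⟩ := List.append_of_mem he
  obtain ⟨p', q', hp'⟩ := List.append_of_mem hf
  exact (h.eq_of_tl_eq hp hp' hef).2.1

lemma IsWalk.adj (h : N.IsWalk P) {p q : List D} {e f : D} (hP : P = p ++ e :: f :: q) :
    N.hd e = N.tl f := by
  subst hP
  exact (List.isChain_append_cons_cons.1 h).2.1

lemma IsRoute.exists_next (h : N.IsRoute x P) {p q : List D} {d : D} (hP : P = p ++ d :: q)
    (hd : N.hd d ≠ N.top) : ∃ e q', q = e :: q' ∧ N.tl e = N.hd d := by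
  cases q with
  | nil =>
    obtain ⟨p', e, hp', he⟩ := h.last
    rw [hP] at hp'
    obtain ⟨-, h2⟩ := List.append_inj' hp' rfl
    simp only [List.cons.injEq, and_true] at h2
    exact absurd (h2 ▸ he) hd
  | cons e q' => exact ⟨e, q', rfl, (h.walk.adj hP).symm⟩

lemma IsWalk.exists_prev (h : N.IsWalk P) {p q : List D} {e : D} (hP : P = p ++ e :: q)
    (hp : p ≠ []) : ∃ p' d, p = p' ++ [d] ∧ N.hd d = N.tl e := by
  refine ⟨p.dropLast, p.getLast hp, (List.dropLast_append_getLast hp).symm, ?_⟩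
  apply h.adj (p := p.dropLast) (q := q)
  rw [hP]
  conv_lhs => rw [← List.dropLast_append_getLast hp]
  simp

lemma IsRoute.ne_nil_of_tl_ne_zero (h : N.IsRoute x P) {p q : List D} {e : D}
    (hP : P = p ++ e :: q) (he : N.tl e ≠ 0) : p ≠ [] := by
  rintro rfl
  have := h.head
  rw [hP] at this
  simp only [List.nil_append, List.head?_cons, Option.some.injEq] at this
  exact he (this ▸ N.tl_src x)

lemma IsRoute.exists_prev (h : N.IsRoute x P) {p q : List D} {e : D} (hP : P = p ++ e :: q)
    (he : N.tl e ≠ 0) : ∃ p' d, p = p' ++ [d] ∧ N.hd d = N.tl e :=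
  h.walk.exists_prev hP (h.ne_nil_of_tl_ne_zero hP he)

lemma IsWalk.eq_nil_of_tl_eq_zero (h : N.IsWalk P) {p q : List D} {e : D} (hP : P = p ++ e :: q)
    (he : N.tl e = 0) : p = [] := by
  by_contra hp
  obtain ⟨p', d, -, hd⟩ := h.exists_prev hP hp
  have := N.tl_lt_hd d
  omega

lemma IsRoute.eq_src (h : N.IsRoute x P) {e : D} (he : e ∈ P) (h0 : N.tl e = 0) :
    e = N.src x := by
  obtain ⟨p, q, hP⟩ := List.append_of_mem he
  obtain rfl := h.walk.eq_nil_of_tl_eq_zero hP h0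
  have := h.head
  rw [hP] at this
  simpa using this

lemma IsRoute.exists_eq_cons (h : N.IsRoute x P) : ∃ q, P = N.src x :: q := by
  have := h.head
  cases P with
  | nil => simp at this
  | cons a P => simp at this; exact ⟨P, by rw [this]⟩

lemma IsRoute.source_eq (hP : N.IsRoute x P) (hQ : N.IsRoute y Q) {p : List D} {d : D}
    (hp : (p ++ [d]) <+: P) (hq : (p ++ [d]) <+: Q) : x = y := by
  obtain ⟨p', rfl⟩ := hp
  obtain ⟨q', rfl⟩ := hq
  have h1 := hP.head
  have h2 := hQ.head
  apply N.src_injective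
  cases p <;> simp_all

/-- Two different initial segments of routes that end at the same vertex diverge somewhere. -/
lemma IsRoute.eq_or_diverge (hP : N.IsRoute x P) (hQ : N.IsRoute y Q) {p p' q q' : List D} {d d' : D}
    (hPp : P = (p ++ [d]) ++ p') (hQq : Q = (q ++ [d']) ++ q') (hd : N.hd d = N.hd d') :
    p ++ [d] = q ++ [d'] ∨ ∃ c r r' e f, p ++ [d] = r ++ e :: c ∧ q ++ [d'] = r' ++ f :: c ∧
      N.hd e = N.hd f ∧ e ≠ f := by
  -- Walk backwards: as long as the last edges agree, so do their tails, and the preceding edges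
  -- again end at a common vertex. Reaching a source means that the segments coincide.
  induction p using List.reverseRecOn generalizing q p' q' d d' with
  | nil =>
    by_cases hdd : d = d'
    · subst hdd
      left
      have h0 : N.tl d = 0 := by
        have := hP.head
        rw [hPp] at this
        simp only [List.nil_append, List.cons_append, List.head?_cons, Option.some.injEq] at this
        exact this ▸ N.tl_src x
      rw [hQ.walk.eq_nil_of_tl_eq_zero (p := q) (e := d) (q := q') (by simpa using hQq) h0]
    · exact .inr ⟨[], [], q, d, d', by simp, by simp, hd, hdd⟩
  | append_singleton p b ih =>
    by_cases hdd : d = d'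
    · subst hdd
      have hb : N.hd b = N.tl d := hP.walk.adj (p := p) (q := p') (by simpa using hPp)
      have h0 : N.tl d ≠ 0 := by have := N.tl_lt_hd b; omega
      obtain ⟨q1, b', rfl, hb'⟩ := hQ.exists_prev (p := q) (e := d) (q := q') (by simpa using hQq) h0
      rcases ih (p' := d :: p') (q' := d :: q') (by simpa using hPp) (by simpa using hQq)
        (hb.trans hb'.symm) with h | ⟨c, r, r', e, f, h1, h2, h3, h4⟩
      · left; rw [h]
      · exact .inr ⟨c ++ [d], r, r', e, f, by rw [h1]; simp, by rw [h2]; simp, h3, h4⟩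
    · exact .inr ⟨[], p ++ [b], q, d, d', by simp, by simp, hd, hdd⟩

/-! ### Uniqueness of ordered families with given edge counts -/

/-- Token `s` is before token `t` at the vertex `v`. -/
def Before {k : ℕ} (R R' : X → Fin k → List D) (v : ℕ) (s t : X × Fin k) : Prop :=
  -- The pasts of both tokens must be shared by the two families, so that the relation can be used
  -- for either of them.
  ∃ p q d d', N.hd d = v ∧ N.hd d' = v ∧
    (p ++ [d]) <+: R s.1 s.2 ∧ (p ++ [d]) <+: R' s.1 s.2 ∧
    (q ++ [d']) <+: R t.1 t.2 ∧ (q ++ [d']) <+: R' t.1 t.2 ∧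
    -- Tokens with the same past are ordered by their indices, all others by the incoming edges
    -- where their pasts diverge.
    ((p ++ [d] = q ++ [d'] ∧ s.2 < t.2) ∨ ∃ c r r' e f, p ++ [d] = r ++ e :: c ∧
      q ++ [d'] = r' ++ f :: c ∧ N.hd e = N.hd f ∧ N.inRank e < N.inRank f)

/-- Leaving `v` in the wrong order would violate `not_below` if the pasts coincide and
`not_crossing` if they diverge. Hence the order of the pasts is inherited by the outgoing edges. -/
lemma IsOrderedFamily.outRank_le {k : ℕ} {R R' : X → Fin k → List D} (hR : N.IsOrderedFamily R)
    {v : ℕ} {s t : X × Fin k} (hst : Before (N := N) R R' v s t) {f : D}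
    (hf : f ∈ R t.1 t.2) (hfv : N.tl f = v) :
    ∃ e ∈ R s.1 s.2, N.tl e = v ∧ N.outRank e ≤ N.outRank f := by
  obtain ⟨p, q, d, d', hd, hd', ⟨p', hp'⟩, -, ⟨q', hq'⟩, -, h⟩ := hst
  have hs := hR.route s.1 s.2
  have ht := hR.route t.1 t.2
  have hvtop : v ≠ N.top := by
    have := N.tl_lt_hd f; have := N.hd_le_top f; omega
  have hpos : 0 < v := by have := N.tl_lt_hd d; omega
  obtain ⟨g, p1, rfl, hg⟩ := hs.exists_next (p := p) (d := d) (q := p') (by simpa using hp'.symm)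
    (hd ▸ hvtop)
  obtain ⟨g', q1, rfl, hg'⟩ := ht.exists_next (p := q) (d := d') (q := q') (by simpa using hq'.symm)
    (hd' ▸ hvtop)
  have hgf : g' = f := ht.walk.eq_of_mem (by rw [← hq']; simp) hf (by omega)
  subst hgf
  refine ⟨g, by rw [← hp']; simp, by omega, ?_⟩
  by_contra! hlt
  rcases h with ⟨h1, h2⟩ | ⟨c, r, r', e, f, h1, h2, h3, h4⟩
  · have hx : s.1 = t.1 := by
      exact hs.source_eq ht ⟨_, hp'⟩ ⟨_, h1 ▸ hq'⟩
    apply hR.not_below s.1 s.2 t.2 h2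
    refine ⟨q ++ [d'], q1, p1, g', g, ?_, ?_, by omega, hlt⟩
    · rw [hx, ← hq']
    · rw [← hp', h1]
  · apply hR.not_crossing s.1 s.2 t.1 t.2
    refine ⟨c, r, p1, r', q1, e, f, g, g', ?_, ?_, h3, h4, by omega, hlt⟩
    · rw [← hp', h1]; simp
    · rw [← hq', h2]; simp

-- A route leaves `v` by at most one edge, so the sets of tokens on different edges are disjoint.
-- Thus the number of tokens leaving through low edges depends on the edge counts only.
open Classical in
lemma IsOrderedFamily.card_outRank_le [Fintype D] [Fintype X] {k : ℕ} {R : X → Fin k → List D}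
    (hR : N.IsOrderedFamily R) (v c : ℕ) :
    (Finset.univ.filter fun t : X × Fin k =>
      ∃ e ∈ R t.1 t.2, N.tl e = v ∧ N.outRank e ≤ c).card =
    ∑ e with N.tl e = v ∧ N.outRank e ≤ c,
      (Finset.univ.filter fun t : X × Fin k => e ∈ R t.1 t.2).card := by
  rw [← Finset.card_biUnion]
  · congr 1
    ext t
    simp only [Finset.mem_filter, Finset.mem_univ, true_and, Finset.mem_biUnion]
    constructor
    · rintro ⟨e, he, h⟩; exact ⟨e, h, he⟩
    · rintro ⟨e, h, he⟩; exact ⟨e, he, h⟩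
  · intro e he f hf hef
    simp only [Finset.coe_filter, Finset.mem_univ, true_and, Set.mem_ofPred_eq] at he hf
    rw [Function.onFun, Finset.disjoint_left]
    intro t ht ht'
    simp only [Finset.mem_filter, Finset.mem_univ, true_and] at ht ht'
    exact hef ((hR.route t.1 t.2).walk.eq_of_mem ht ht' (by omega))

/-- Up to the vertex `v`, the routes of `R` are followed by those of `R'`. -/
def Follows {k : ℕ} (N : RankedNet D X) (R R' : X → Fin k → List D) (v : ℕ) : Prop :=
  ∀ x i p e q, R x i = p ++ e :: q → N.tl e < v → (p ++ [e]) <+: R' x i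

/-- Pasts that diverge do so at distinct edges with a common head, whose in-ranks differ; equal
pasts have the same source, and there the indices decide. -/
lemma before_trichotomy {k : ℕ} {R R' : X → Fin k → List D} (hR : N.IsOrderedFamily R)
    {v : ℕ} (hv : 0 < v) (h : N.Follows R R' v) {s t : X × Fin k} {e f : D}
    (he : e ∈ R s.1 s.2) (hf : f ∈ R t.1 t.2) (hev : N.tl e = v) (hfv : N.tl f = v) :
    s = t ∨ Before (N := N) R R' v s t ∨ Before (N := N) R R' v t s := by
  have hs := hR.route s.1 s.2
  have ht := hR.route t.1 t.2
  obtain ⟨p, p', hp⟩ := List.append_of_mem he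
  obtain ⟨q, q', hq⟩ := List.append_of_mem hf
  obtain ⟨p, d, rfl, hd⟩ := hs.exists_prev hp (by omega)
  obtain ⟨q, d', rfl, hd'⟩ := ht.exists_prev hq (by omega)
  have a1 : (p ++ [d]) <+: R s.1 s.2 := ⟨_, hp.symm⟩
  have a2 : (p ++ [d]) <+: R' s.1 s.2 :=
    h s.1 s.2 p d (e :: p') (by simpa using hp) (by have := N.tl_lt_hd d; omega)
  have b1 : (q ++ [d']) <+: R t.1 t.2 := ⟨_, hq.symm⟩
  have b2 : (q ++ [d']) <+: R' t.1 t.2 :=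
    h t.1 t.2 q d' (f :: q') (by simpa using hq) (by have := N.tl_lt_hd d'; omega)
  rcases hs.eq_or_diverge ht hp hq (by omega) with h1 | ⟨c, r, r', a, b, h1, h2, h3, h4⟩
  · rcases lt_trichotomy s.2 t.2 with h2 | h2 | h2
    · exact .inr (.inl ⟨p, q, d, d', by omega, by omega, a1, a2, b1, b2, .inl ⟨h1, h2⟩⟩)
    · left
      refine Prod.ext ?_ h2
      exact hs.source_eq ht ⟨_, hp.symm⟩ ⟨_, h1 ▸ hq.symm⟩
    · exact .inr (.inr ⟨q, p, d', d, by omega, by omega, b1, b2, a1, a2, .inl ⟨h1.symm, h2⟩⟩)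
  · rcases lt_trichotomy (N.inRank a) (N.inRank b) with h5 | h5 | h5
    · exact .inr (.inl ⟨p, q, d, d', by omega, by omega, a1, a2, b1, b2,
        .inr ⟨c, r, r', a, b, h1, h2, h3, h5⟩⟩)
    · exact absurd (N.inRank_inj a b h3 h5) h4
    · exact .inr (.inr ⟨q, p, d', d, by omega, by omega, b1, b2, a1, a2,
        .inr ⟨c, r', r, b, a, h2, h1, h3.symm, h5⟩⟩)

lemma Before.symm_families {k : ℕ} {R R' : X → Fin k → List D} {v : ℕ} {s t : X × Fin k}
    (h : Before (N := N) R R' v s t) : Before (N := N) R' R v s t := by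
  obtain ⟨p, q, d, d', hd, hd', h1, h2, h3, h4, h⟩ := h
  exact ⟨p, q, d, d', hd, hd', h2, h1, h4, h3, h⟩

lemma exists_mem_of_follows {k : ℕ} {R R' : X → Fin k → List D} (hR : N.IsOrderedFamily R)
    (hR' : N.IsOrderedFamily R') {v : ℕ} (hv : 0 < v) (h : N.Follows R R' v) {t : X × Fin k}
    {e : D} (he : e ∈ R t.1 t.2) (hev : N.tl e = v) : ∃ f ∈ R' t.1 t.2, N.tl f = v := by
  obtain ⟨p, p', hp⟩ := List.append_of_mem he
  obtain ⟨p, d, rfl, hd⟩ := (hR.route t.1 t.2).exists_prev hp (by omega)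
  obtain ⟨q, hq⟩ := h t.1 t.2 p d (e :: p') (by simpa using hp) (by have := N.tl_lt_hd d; omega)
  obtain ⟨f, q', rfl, hf⟩ := (hR'.route t.1 t.2).exists_next (p := p) (d := d) (q := q)
    (by simpa using hq.symm) (by have := N.tl_lt_hd e; have := N.hd_le_top e; omega)
  exact ⟨f, by rw [← hq]; simp, by omega⟩

-- Both sets are initial segments of the same total order on the tokens at `v`, so one contains the
-- other; having the same cardinality, they coincide.
open Classical in
lemma outSets_eq [Fintype D] [Fintype X] {k : ℕ} {R R' : X → Fin k → List D}
    (hR : N.IsOrderedFamily R) (hR' : N.IsOrderedFamily R')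
    (hcard : ∀ e, (Finset.univ.filter fun t : X × Fin k => e ∈ R t.1 t.2).card =
      (Finset.univ.filter fun t : X × Fin k => e ∈ R' t.1 t.2).card)
    {v : ℕ} (hv : 0 < v) (h : N.Follows R R' v) (h' : N.Follows R' R v) (c : ℕ) :
    (Finset.univ.filter fun t : X × Fin k => ∃ e ∈ R t.1 t.2, N.tl e = v ∧ N.outRank e ≤ c) =
    (Finset.univ.filter fun t : X × Fin k => ∃ e ∈ R' t.1 t.2, N.tl e = v ∧ N.outRank e ≤ c) := by
  set A := Finset.univ.filter fun t : X × Fin k => ∃ e ∈ R t.1 t.2, N.tl e = v ∧ N.outRank e ≤ c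
    with hA
  set A' := Finset.univ.filter fun t : X × Fin k => ∃ e ∈ R' t.1 t.2, N.tl e = v ∧ N.outRank e ≤ c
    with hA'
  have hAA : A.card = A'.card := by
    rw [hA, hA', hR.card_outRank_le, hR'.card_outRank_le]
    exact Finset.sum_congr rfl fun e _ => hcard e
  have lowA : ∀ s t, Before (N := N) R R' v s t → t ∈ A → s ∈ A := by
    intro s t hst ht
    simp only [hA, Finset.mem_filter, Finset.mem_univ, true_and] at ht ⊢
    obtain ⟨f, hf, hfv, hfc⟩ := ht
    obtain ⟨e, he, hev, hef⟩ := hR.outRank_le hst hf hfv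
    exact ⟨e, he, hev, hef.trans hfc⟩
  have lowA' : ∀ s t, Before (N := N) R R' v s t → t ∈ A' → s ∈ A' := by
    intro s t hst ht
    simp only [hA', Finset.mem_filter, Finset.mem_univ, true_and] at ht ⊢
    obtain ⟨f, hf, hfv, hfc⟩ := ht
    obtain ⟨e, he, hev, hef⟩ := hR'.outRank_le hst.symm_families hf hfv
    exact ⟨e, he, hev, hef.trans hfc⟩
  have hsub : A ⊆ A' ∨ A' ⊆ A := by
    by_contra! hcon
    obtain ⟨hn1, hn2⟩ := hcon
    obtain ⟨s, hs, hs'⟩ := Finset.not_subset.1 hn1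
    obtain ⟨t, ht, ht'⟩ := Finset.not_subset.1 hn2
    have hs0 := hs
    have ht0 := ht
    simp only [hA, Finset.mem_filter, Finset.mem_univ, true_and] at hs0
    simp only [hA', Finset.mem_filter, Finset.mem_univ, true_and] at ht0
    obtain ⟨e, he, hev, -⟩ := hs0
    obtain ⟨f', hf', hfv', -⟩ := ht0
    obtain ⟨f, hf, hfv⟩ := exists_mem_of_follows hR' hR hv h' hf' hfv'
    rcases before_trichotomy hR hv h he hf hev hfv with rfl | h1 | h1
    · exact hs' ht
    · exact hs' (lowA' _ _ h1 ht)
    · exact ht' (lowA _ _ h1 hs)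
  rcases hsub with h1 | h1
  · exact Finset.eq_of_subset_of_card_le h1 hAA.ge
  · exact (Finset.eq_of_subset_of_card_le h1 hAA.le).symm

-- Induction over the vertices in topological order. At each vertex the tokens leaving by rank at
-- most c agree for all c, which pins down the outgoing edge of every token.
open Classical in
lemma follows_of_card_eq [Fintype D] [Fintype X] {k : ℕ} {R R' : X → Fin k → List D}
    (hR : N.IsOrderedFamily R) (hR' : N.IsOrderedFamily R')
    (hcard : ∀ e, (Finset.univ.filter fun t : X × Fin k => e ∈ R t.1 t.2).card =
      (Finset.univ.filter fun t : X × Fin k => e ∈ R' t.1 t.2).card) (v : ℕ) :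
    N.Follows R R' v ∧ N.Follows R' R v := by
  induction v with
  | zero => constructor <;> intro x i p e q _ h <;> omega
  | succ v ih =>
    have key : ∀ {R R' : X → Fin k → List D}, N.IsOrderedFamily R → N.IsOrderedFamily R' →
        (∀ e, (Finset.univ.filter fun t : X × Fin k => e ∈ R t.1 t.2).card =
          (Finset.univ.filter fun t : X × Fin k => e ∈ R' t.1 t.2).card) →
        N.Follows R R' v → N.Follows R' R v → N.Follows R R' (v + 1) := by
      intro R R' hR hR' hcard h h' x i p e q hpq hev
      rcases Nat.lt_succ_iff_lt_or_eq.1 hev with hev | hev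
      · exact h x i p e q hpq hev
      rcases Nat.eq_zero_or_pos v with hv | hv
      · obtain rfl := (hR.route x i).walk.eq_nil_of_tl_eq_zero hpq (by omega)
        have := (hR.route x i).eq_src (e := e) (by rw [hpq]; simp) (by omega)
        obtain ⟨q', hq'⟩ := (hR'.route x i).exists_eq_cons
        exact ⟨q', by rw [hq', this]; simp⟩
      · have heR : e ∈ R x i := by rw [hpq]; simp
        have m1 : ∀ {e}, e ∈ R x i → N.tl e = v →
            ∃ f ∈ R' x i, N.tl f = v ∧ N.outRank f ≤ N.outRank e := by
          intro e he hev
          have := (Finset.ext_iff.1 (outSets_eq hR hR' hcard hv h h' (N.outRank e)) (x, i)).1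
            (by simpa using ⟨e, he, hev, le_rfl⟩)
          simpa using this
        have m2 : ∀ {e}, e ∈ R' x i → N.tl e = v →
            ∃ f ∈ R x i, N.tl f = v ∧ N.outRank f ≤ N.outRank e := by
          intro e he hev
          have := (Finset.ext_iff.1 (outSets_eq hR hR' hcard hv h h' (N.outRank e)) (x, i)).2
            (by simpa using ⟨e, he, hev, le_rfl⟩)
          simpa using this
        -- Going to `R'` and back to `R` lowers the rank weakly both times but returns to `e`, so
        -- the ranks are equal.
        obtain ⟨f, hf, hfv, hfe⟩ := m1 heR hev
        obtain ⟨g, hg, hgv, hgf⟩ := m2 hf hfv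
        have hge : g = e := (hR.route x i).walk.eq_of_mem hg heR (by omega)
        subst hge
        have hfg : f = g := N.outRank_inj f g (by omega) (by omega) (by omega)
        subst hfg
        obtain ⟨p0, d, rfl, hd⟩ := (hR.route x i).exists_prev hpq (by omega)
        obtain ⟨r, hr⟩ := h x i p0 d (f :: q) (by simpa using hpq) (by have := N.tl_lt_hd d; omega)
        obtain ⟨b, r', rfl, hb⟩ := (hR'.route x i).exists_next (p := p0) (d := d) (q := r)
          (by simpa using hr.symm) (by have := N.tl_lt_hd f; have := N.hd_le_top f; omega)
        have : b = f := (hR'.route x i).walk.eq_of_mem (by rw [← hr]; simp) hf (by omega)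
        subst this
        exact ⟨r', by rw [← hr]; simp⟩
    exact ⟨key hR hR' hcard ih.1 ih.2, key hR' hR (fun e => (hcard e).symm) ih.2 ih.1⟩

open Classical in
/-- An ordered family of routes is determined by its edge counts. -/
theorem IsOrderedFamily.unique [Fintype D] [Fintype X] {k : ℕ} {R R' : X → Fin k → List D}
    (hR : N.IsOrderedFamily R) (hR' : N.IsOrderedFamily R')
    (hcard : ∀ e, (Finset.univ.filter fun t : X × Fin k => e ∈ R t.1 t.2).card =
      (Finset.univ.filter fun t : X × Fin k => e ∈ R' t.1 t.2).card) : R = R' := by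
  funext x i
  obtain ⟨p, e, hp, he⟩ := (hR.route x i).last
  obtain ⟨q, hq⟩ := (follows_of_card_eq hR hR' hcard N.top).1 x i p e [] hp
    (he ▸ N.tl_lt_hd e)
  cases q with
  | nil => rw [hp, ← hq]; simp
  | cons b q =>
    have h1 := (hR'.route x i).walk.adj (p := p) (e := e) (f := b) (q := q) (by simpa using hq.symm)
    have h2 := N.tl_lt_hd b
    have h3 := N.hd_le_top b
    omega

end RankedNet

end FlowTri

namespace FlowTri

/-! ### Positions in a ranked finite set of intervals -/

section Positions

variable {D : Type*} (S : Finset D) (r : D → ℕ) (ψ : D → ℕ)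

/-- The position of the `i`-th point of the interval `e`, when the intervals of lengths `ψ d`,
`d ∈ S`, are placed one after the other in the order of the ranks. -/
def position (e : D) (i : ℕ) : ℕ := ∑ d ∈ S with r d < r e, ψ d + i

variable {S r ψ}

lemma position_lt_position {e f : D} {i j : ℕ} (he : e ∈ S) (hi : i < ψ e) (h : r e < r f) :
    position S r ψ e i < position S r ψ f j := by
  classical
  unfold position
  have hsub : insert e (S.filter fun d => r d < r e) ⊆ S.filter fun d => r d < r f := by
    intro d hd
    simp only [Finset.mem_insert, Finset.mem_filter] at hd ⊢
    rcases hd with rfl | hd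
    · exact ⟨he, h⟩
    · exact ⟨hd.1, hd.2.trans h⟩
  have := Finset.sum_le_sum_of_subset (f := ψ) hsub
  rw [Finset.sum_insert (by simp)] at this
  omega

lemma position_lt_sum {e : D} {i : ℕ} (he : e ∈ S) (hi : i < ψ e) :
    position S r ψ e i < ∑ d ∈ S, ψ d := by
  classical
  unfold position
  have hsub : insert e (S.filter fun d => r d < r e) ⊆ S := by
    intro d hd
    simp only [Finset.mem_insert, Finset.mem_filter] at hd
    rcases hd with rfl | hd
    · exact he
    · exact hd.1
  have := Finset.sum_le_sum_of_subset (f := ψ) hsub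
  rw [Finset.sum_insert (by simp)] at this
  omega

lemma position_injective (hr : Set.InjOn r S) {e f : D} {i j : ℕ} (he : e ∈ S) (hf : f ∈ S)
    (hi : i < ψ e) (hj : j < ψ f) (h : position S r ψ e i = position S r ψ f j) :
    e = f ∧ i = j := by
  have hef : e = f := by
    rcases lt_trichotomy (r e) (r f) with h1 | h1 | h1
    · exact absurd h (position_lt_position he hi h1).ne
    · exact hr he hf h1
    · exact absurd h (position_lt_position hf hj h1).ne'
  subst hef
  exact ⟨rfl, by unfold position at h; omega⟩

/-- Induction on the set, adding the interval of highest rank last: `m` lies either within the total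
length of the lower intervals or in the new one. -/
lemma exists_position_eq (hr : Set.InjOn r S) {m : ℕ} (hm : m < ∑ d ∈ S, ψ d) :
    ∃ e ∈ S, ∃ i < ψ e, position S r ψ e i = m := by
  classical
  induction S using Finset.induction_on_max_value r with
  | empty => simp at hm
  | insert a s ha hmax ih =>
    have hlt : ∀ x ∈ s, r x < r a := fun x hx => lt_of_le_of_ne (hmax x hx) fun h =>
      ha (hr (by simp [hx]) (by simp) h ▸ hx)
    by_cases hms : m < ∑ d ∈ s, ψ d
    · obtain ⟨e, he, i, hi, h⟩ := ih (hr.mono (by simp)) hms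
      refine ⟨e, by simp [he], i, hi, ?_⟩
      rw [← h]
      unfold position
      rw [Finset.filter_insert, if_neg (by have := hlt e he; omega)]
    · rw [Finset.sum_insert ha] at hm
      refine ⟨a, by simp, m - ∑ d ∈ s, ψ d, by omega, ?_⟩
      unfold position
      rw [Finset.filter_insert, if_neg (lt_irrefl _), Finset.filter_true_of_mem hlt]
      omega

end Positions

namespace RankedNet

/-! ### Existence of ordered families with given edge counts -/

variable {D X : Type*} [Fintype D] (N : RankedNet D X) (ψ : D → ℕ)

/-- The position of a slot among those arriving at the head of its edge. -/
def inPos (s : D × ℕ) : ℕ :=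
  position (Finset.univ.filter fun d => N.hd d = N.hd s.1) N.inRank ψ s.1 s.2

/-- The position of a slot among those leaving the tail of its edge. -/
def outPos (s : D × ℕ) : ℕ :=
  position (Finset.univ.filter fun d => N.tl d = N.tl s.1) N.outRank ψ s.1 s.2

/-- The slot `t` continues the slot `s`. -/
structure NextSlot (s t : D × ℕ) : Prop where
  adj : N.hd s.1 = N.tl t.1
  left : s.2 < ψ s.1
  right : t.2 < ψ t.1
  pos : N.inPos ψ s = N.outPos ψ t

/-- Conservation of the flow `ψ` at the inner vertices. -/
def Conserved : Prop := ∀ v, 0 < v → v < N.top →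
  ∑ e with N.hd e = v, ψ e = ∑ e with N.tl e = v, ψ e

variable {N ψ}

lemma inPos_lt {s t : D × ℕ} (h : N.hd s.1 = N.hd t.1) (hs : s.2 < ψ s.1)
    (hr : N.inRank s.1 < N.inRank t.1) : N.inPos ψ s < N.inPos ψ t := by
  unfold inPos
  rw [← h]
  exact position_lt_position (by simp) hs hr

lemma outPos_lt {s t : D × ℕ} (h : N.tl s.1 = N.tl t.1) (hs : s.2 < ψ s.1)
    (hr : N.outRank s.1 < N.outRank t.1) : N.outPos ψ s < N.outPos ψ t := by
  unfold outPos
  rw [← h]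
  exact position_lt_position (by simp) hs hr

/-- On a fixed edge both positions are the slot number plus a constant, so slots keep their order
from tail to head. -/
lemma inPos_lt_iff_outPos_lt {s t : D × ℕ} (h : s.1 = t.1) :
    N.inPos ψ s < N.inPos ψ t ↔ N.outPos ψ s < N.outPos ψ t := by
  unfold inPos outPos position
  rw [h]
  omega

lemma inPos_injective {s t : D × ℕ} (h : N.hd s.1 = N.hd t.1) (hs : s.2 < ψ s.1)
    (ht : t.2 < ψ t.1) (hst : N.inPos ψ s = N.inPos ψ t) : s = t := by
  unfold inPos at hst
  rw [← h] at hst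
  have := position_injective (S := Finset.univ.filter fun d => N.hd d = N.hd s.1) (r := N.inRank)
    (fun e he f hf hef => N.inRank_inj e f (by simp at he hf; omega) hef)
    (by simp) (by simp [h]) hs ht hst
  exact Prod.ext this.1 this.2

lemma outPos_injective {s t : D × ℕ} (h : N.tl s.1 = N.tl t.1) (h0 : 0 < N.tl s.1)
    (hs : s.2 < ψ s.1) (ht : t.2 < ψ t.1) (hst : N.outPos ψ s = N.outPos ψ t) : s = t := by
  unfold outPos at hst
  rw [← h] at hst
  have := position_injective (S := Finset.univ.filter fun d => N.tl d = N.tl s.1) (r := N.outRank)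
    (fun e he f hf hef => N.outRank_inj e f (by simp at he hf; omega) (by simp at he; omega) hef)
    (by simp) (by simp [h]) hs ht hst
  exact Prod.ext this.1 this.2

/-- By conservation the outgoing slots at an inner vertex fill exactly as many positions as the
incoming ones. -/
lemma exists_nextSlot (hψ : N.Conserved ψ) {s : D × ℕ} (hs : s.2 < ψ s.1) (htop : N.hd s.1 < N.top) :
    ∃ t, N.NextSlot ψ s t := by
  have hpos : 0 < N.hd s.1 := (Nat.zero_le _).trans_lt (N.tl_lt_hd s.1)
  have h1 : N.inPos ψ s < ∑ e with N.hd e = N.hd s.1, ψ e := position_lt_sum (by simp) hs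
  rw [hψ _ hpos htop] at h1
  obtain ⟨e, he, i, hi, h⟩ := exists_position_eq (r := N.outRank)
    (fun e he f hf hef => N.outRank_inj e f (by simp at he hf; omega) (by simp at he; omega) hef) h1
  simp only [Finset.mem_filter, Finset.mem_univ, true_and] at he
  refine ⟨(e, i), he.symm, hs, hi, ?_⟩
  rw [← h]
  unfold outPos
  rw [he]

lemma exists_prevSlot (hψ : N.Conserved ψ) {t : D × ℕ} (ht : t.2 < ψ t.1) (h0 : 0 < N.tl t.1) :
    ∃ s, N.NextSlot ψ s t := by
  have htop : N.tl t.1 < N.top := (N.tl_lt_hd t.1).trans_le (N.hd_le_top t.1)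
  have h1 : N.outPos ψ t < ∑ e with N.tl e = N.tl t.1, ψ e := position_lt_sum (by simp) ht
  rw [← hψ _ h0 htop] at h1
  obtain ⟨e, he, i, hi, h⟩ := exists_position_eq (r := N.inRank)
    (fun e he f hf hef => N.inRank_inj e f (by simp at he hf; omega) hef) h1
  simp only [Finset.mem_filter, Finset.mem_univ, true_and] at he
  refine ⟨(e, i), he, hi, ht, ?_⟩
  rw [← h]
  unfold inPos
  rw [he]

lemma NextSlot.right_unique {s t t' : D × ℕ} (h : N.NextSlot ψ s t) (h' : N.NextSlot ψ s t') :
    t = t' := by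
  refine outPos_injective (h.adj.symm.trans h'.adj) ?_ h.right h'.right (h.pos.symm.trans h'.pos)
  rw [← h.adj]
  exact (Nat.zero_le _).trans_lt (N.tl_lt_hd s.1)

lemma NextSlot.left_unique {s s' t : D × ℕ} (h : N.NextSlot ψ s t) (h' : N.NextSlot ψ s' t) :
    s = s' :=
  inPos_injective (h.adj.trans h'.adj.symm) h.left h'.left (h.pos.trans h'.pos.symm)

variable (N ψ) in
/-- The slots passed by one unit of flow on its way from the slot `s` to the top. -/
structure IsTrajectory (s : D × ℕ) (L : List (D × ℕ)) : Prop where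
  head : L.head? = some s
  chain : L.IsChain (N.NextSlot ψ)
  valid : ∀ t ∈ L, t.2 < ψ t.1
  last : ∃ p t, L = p ++ [t] ∧ N.hd t.1 = N.top

lemma exists_trajectory (hψ : N.Conserved ψ) {s : D × ℕ} (hs : s.2 < ψ s.1) :
    ∃ L, N.IsTrajectory ψ s L := by
  -- Heads increase along a trajectory, so the distance to the top decreases.
  induction hm : N.top - N.hd s.1 using Nat.strong_induction_on generalizing s with
  | _ m ih =>
    subst hm
    rcases (N.hd_le_top s.1).lt_or_eq with h | h
    · obtain ⟨t, ht⟩ := exists_nextSlot hψ hs h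
      have h1 := N.tl_lt_hd t.1
      have h2 := ht.adj
      obtain ⟨L, hL⟩ := ih (N.top - N.hd t.1) (by omega) ht.right rfl
      refine ⟨s :: L, rfl, ?_, ?_, ?_⟩
      · refine List.isChain_cons.2 ⟨fun y hy => ?_, hL.chain⟩
        rw [hL.head] at hy
        simp only [Option.mem_def, Option.some.injEq] at hy
        exact hy ▸ ht
      · intro u hu
        rcases List.mem_cons.1 hu with rfl | hu
        · exact hs
        · exact hL.valid u hu
      · obtain ⟨p, u, rfl, hu⟩ := hL.last
        exact ⟨s :: p, u, rfl, hu⟩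
    · exact ⟨[s], rfl, by simp, by simpa using hs, [], s, rfl, h⟩

lemma IsTrajectory.isRoute {x : X} {i : ℕ} {L : List (D × ℕ)} (h : N.IsTrajectory ψ (N.src x, i) L) :
    N.IsRoute x (L.map Prod.fst) where
  head := by simp [h.head]
  walk := by
    unfold IsWalk
    rw [List.isChain_map]
    exact h.chain.imp fun _ _ hst => hst.adj
  last := by
    obtain ⟨p, t, rfl, ht⟩ := h.last
    exact ⟨p.map Prod.fst, t.1, by simp, ht⟩

/-- Trajectories that run along a common segment keep their order. -/
lemma outPos_lt_of_segment {l l' r r' : List (D × ℕ)} {s s' t t' : D × ℕ}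
    (h : (s :: (l ++ s' :: r)).IsChain (N.NextSlot ψ))
    (h' : (t :: (l' ++ t' :: r')).IsChain (N.NextSlot ψ))
    (hl : l.map Prod.fst = l'.map Prod.fst) (hst : N.inPos ψ s < N.inPos ψ t) :
    N.outPos ψ s' < N.outPos ψ t' := by
  induction l generalizing s t l' with
  | nil =>
    obtain rfl : l' = [] := by simpa using hl.symm
    have h1 := (List.isChain_cons_cons.1 h).1
    have h2 := (List.isChain_cons_cons.1 h').1
    rw [← h1.pos, ← h2.pos]
    exact hst
  | cons a l ih =>
    cases l' with
    | nil => simp at hl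
    | cons b l' =>
      simp only [List.map_cons, List.cons.injEq] at hl
      have h1 := List.isChain_cons_cons.1 h
      have h2 := List.isChain_cons_cons.1 h'
      refine ih h1.2 h2.2 hl.2 ?_
      rw [inPos_lt_iff_outPos_lt hl.1, ← h1.1.pos, ← h2.1.pos]
      exact hst

/-- Entering a common segment on a lower edge means a smaller position, and this order persists to
the end of the segment, where it contradicts leaving on a higher edge. -/
lemma IsTrajectory.not_crossing {s t : D × ℕ} {L L' : List (D × ℕ)}
    (h : N.IsTrajectory ψ s L) (h' : N.IsTrajectory ψ t L') :
    ¬ N.Crossing (L.map Prod.fst) (L'.map Prod.fst) := by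
  rintro ⟨c, p, p', q, q', e, f, a, b, hP, hQ, h1, h2, h3, h4⟩
  obtain ⟨u, L1, rfl, rfl, hP1⟩ := List.map_eq_append_iff.1 hP
  obtain ⟨s, L1, rfl, rfl, hP2⟩ := List.map_eq_cons_iff.1 hP1
  obtain ⟨l, L1, rfl, rfl, hP3⟩ := List.map_eq_append_iff.1 hP2
  obtain ⟨s', r, rfl, rfl, rfl⟩ := List.map_eq_cons_iff.1 hP3
  obtain ⟨u', L1, rfl, rfl, hQ1⟩ := List.map_eq_append_iff.1 hQ
  obtain ⟨t, L1, rfl, rfl, hQ2⟩ := List.map_eq_cons_iff.1 hQ1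
  obtain ⟨l', L1, rfl, hl, hQ3⟩ := List.map_eq_append_iff.1 hQ2
  obtain ⟨t', r', rfl, rfl, rfl⟩ := List.map_eq_cons_iff.1 hQ3
  have k1 := inPos_lt h1 (h.valid s (by simp)) h2
  have k2 := outPos_lt_of_segment (List.isChain_append.1 h.chain).2.1
    (List.isChain_append.1 h'.chain).2.1 hl.symm k1
  have k3 := outPos_lt h3.symm (h'.valid t' (by simp)) h4
  omega

lemma IsTrajectory.exists_eq_cons {s : D × ℕ} {L : List (D × ℕ)} (h : N.IsTrajectory ψ s L) :
    ∃ l, L = s :: l := by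
  have := h.head
  cases L with
  | nil => simp at this
  | cons a P => simp at this; exact ⟨P, by rw [this]⟩

/-- Both trajectories begin on the same source edge, so they cannot diverge there; beyond it, the
order of the starting slots persists along the common part. -/
lemma IsTrajectory.not_below {x : X} {i j : ℕ} {L L' : List (D × ℕ)}
    (h : N.IsTrajectory ψ (N.src x, i) L) (h' : N.IsTrajectory ψ (N.src x, j) L') (hij : i < j) :
    ¬ N.Below (L'.map Prod.fst) (L.map Prod.fst) := by
  rintro ⟨c, q, p, f, e, hQ, hP, h3, h4⟩
  obtain ⟨l, rfl⟩ := h.exists_eq_cons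
  obtain ⟨l', rfl⟩ := h'.exists_eq_cons
  cases c with
  | nil =>
    simp only [List.map_cons, List.nil_append, List.cons.injEq] at hP hQ
    rw [← hP.1, ← hQ.1] at h4
    exact lt_irrefl _ h4
  | cons a c =>
    simp only [List.map_cons, List.cons_append, List.cons.injEq] at hP hQ
    obtain ⟨-, hP⟩ := hP
    obtain ⟨-, hQ⟩ := hQ
    obtain ⟨l, L1, rfl, rfl, hP1⟩ := List.map_eq_append_iff.1 hP
    obtain ⟨s', r, rfl, rfl, rfl⟩ := List.map_eq_cons_iff.1 hP1
    obtain ⟨l', L1, rfl, hl, hQ1⟩ := List.map_eq_append_iff.1 hQ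
    obtain ⟨t', r', rfl, rfl, rfl⟩ := List.map_eq_cons_iff.1 hQ1
    have k2 := outPos_lt_of_segment h.chain h'.chain hl.symm (by simp [inPos, position, hij])
    have k3 := outPos_lt h3 (h'.valid t' (by simp)) h4
    omega

/-- Every slot with positive tail has a unique predecessor. Tracing back ends at a slot of a source
edge, which starts exactly one trajectory. This is what makes the trajectories use each edge exactly
ψ times. -/
lemma existsUnique_trajectory {k : ℕ} (hψ : N.Conserved ψ) (hsrc : ∀ x, ψ (N.src x) = k)
    {L : X → Fin k → List (D × ℕ)} (hL : ∀ x i, N.IsTrajectory ψ (N.src x, i.1) (L x i))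
    {s : D × ℕ} (hs : s.2 < ψ s.1) : ∃! t : X × Fin k, s ∈ L t.1 t.2 := by
  have prev : ∀ {t : X × Fin k} {s}, s ∈ L t.1 t.2 → s ≠ (N.src t.1, t.2.1) →
      ∃ u ∈ L t.1 t.2, N.NextSlot ψ u s := by
    intro t s hs hne
    obtain ⟨p, q, hpq⟩ := List.append_of_mem hs
    have hp : p ≠ [] := by
      rintro rfl
      have := (hL t.1 t.2).head
      rw [hpq] at this
      simp at this
      exact hne this
    have h1 := (hL t.1 t.2).chain
    rw [hpq] at h1 ⊢
    rw [← List.dropLast_append_getLast hp] at h1 ⊢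
    rw [List.append_assoc] at h1
    refine ⟨p.getLast hp, by simp, (List.isChain_append_cons_cons.1 h1).2.1⟩
  induction hm : N.tl s.1 using Nat.strong_induction_on generalizing s with
  | _ m ih =>
    subst hm
    rcases Nat.eq_zero_or_pos (N.tl s.1) with h0 | h0
    · obtain ⟨x, hx⟩ := N.exists_src s.1 h0
      refine ⟨(x, ⟨s.2, by rw [← hsrc x, hx]; exact hs⟩), ?_, ?_⟩
      · obtain ⟨l, hl⟩ := (hL x ⟨s.2, by rw [← hsrc x, hx]; exact hs⟩).exists_eq_cons
        simp [hl, hx]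
      · intro t ht
        by_cases hst : s = (N.src t.1, t.2.1)
        · have h1 : N.src x = N.src t.1 := hx.trans (congrArg Prod.fst hst)
          have h2 := congrArg Prod.snd hst
          exact Prod.ext (N.src_injective h1.symm) (Fin.ext h2.symm)
        · obtain ⟨u, -, hu⟩ := prev ht hst
          have := hu.adj
          have := N.tl_lt_hd u.1
          omega
    · obtain ⟨u, hu⟩ := exists_prevSlot hψ hs h0
      obtain ⟨t, ht, huniq⟩ := ih (N.tl u.1) (by rw [← hu.adj]; exact N.tl_lt_hd u.1) hu.left rfl
      refine ⟨t, ?_, ?_⟩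
      · obtain ⟨p, q, hpq⟩ := List.append_of_mem ht
        cases q with
        | nil =>
          obtain ⟨p', w, hp', hw⟩ := (hL t.1 t.2).last
          rw [hpq] at hp'
          obtain ⟨-, h2⟩ := List.append_inj' hp' rfl
          simp only [List.cons.injEq, and_true] at h2
          have := hu.adj
          have := N.tl_lt_hd s.1
          have := N.hd_le_top s.1
          rw [← h2] at hw
          omega
        | cons w q =>
          have h1 := (hL t.1 t.2).chain
          rw [hpq] at h1
          have := (List.isChain_append_cons_cons.1 h1).2.1
          rw [hu.right_unique this, hpq]
          simp
      · intro t' ht'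
        apply huniq
        have hne : s ≠ (N.src t'.1, t'.2.1) := by
          rintro rfl
          rw [N.tl_src] at h0
          exact lt_irrefl _ h0
        obtain ⟨u', hu', h'⟩ := prev ht' hne
        rwa [hu.left_unique h']

open Classical in
/-- Every conserved integral flow is the edge count of an ordered family of routes. -/
theorem exists_orderedFamily [Fintype X] {k : ℕ} (hψ : N.Conserved ψ)
    (hsrc : ∀ x, ψ (N.src x) = k) : ∃ R : X → Fin k → List D, N.IsOrderedFamily R ∧
      ∀ e, (Finset.univ.filter fun t : X × Fin k => e ∈ R t.1 t.2).card = ψ e := by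
  have : ∀ (x : X) (i : Fin k), ∃ L, N.IsTrajectory ψ (N.src x, i.1) L := fun x i =>
    exists_trajectory hψ (by simp [hsrc])
  choose L hL using this
  refine ⟨fun x i => (L x i).map Prod.fst, ⟨fun x i => (hL x i).isRoute,
    fun x i y j => (hL x i).not_crossing (hL y j),
    fun x i j hij => (hL x i).not_below (hL x j) hij⟩, fun e => ?_⟩
  rw [← Finset.card_range (ψ e)]
  have hex : ∀ t : X × Fin k, e ∈ (L t.1 t.2).map Prod.fst → ∃ j, (e, j) ∈ L t.1 t.2 := by
    intro t ht
    obtain ⟨⟨a, j⟩, h, rfl⟩ := List.mem_map.1 ht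
    exact ⟨j, h⟩
  -- The bijection sends a trajectory through `e` to the number of the slot it occupies on `e`.
  refine Finset.card_bij (fun t ht => (hex t (by simpa using ht)).choose) ?_ ?_ ?_
  · intro t ht
    rw [Finset.mem_range]
    exact (hL t.1 t.2).valid _ (hex t (by simpa using ht)).choose_spec
  · intro t ht t' ht' h
    have h1 := (hex t (by simpa using ht)).choose_spec
    have h2 := (hex t' (by simpa using ht')).choose_spec
    rw [← h] at h2
    exact (existsUnique_trajectory hψ hsrc hL ((hL t.1 t.2).valid _ h1)).unique h1 h2
  · intro j hj
    obtain ⟨t, ht, -⟩ := existsUnique_trajectory hψ hsrc hL (s := (e, j)) (by simpa using hj)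
    have ht' : e ∈ (L t.1 t.2).map Prod.fst := List.mem_map.2 ⟨_, ht, rfl⟩
    refine ⟨t, by simpa using ht', ?_⟩
    have h1 := (hex t ht').choose_spec
    have := (hL t.1 t.2).isRoute.walk.pairwise_tl
    rw [List.pairwise_map] at this
    -- The chosen slot can only be `j`: two slots of `e` on one trajectory would contradict strictly
    -- increasing tails.
    by_contra hne
    obtain ⟨p, q, hpq⟩ := List.append_of_mem ht
    generalize (hex t ht').choose = j' at h1 hne
    rw [hpq] at this h1
    rw [List.pairwise_append] at this
    simp only [List.mem_append, List.mem_cons, Prod.mk.injEq, true_and] at h1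
    rcases h1 with h1 | h1 | h1
    · exact lt_irrefl _ (this.2.2 _ h1 (e, j) (by simp))
    · exact hne h1
    · exact absurd ((List.pairwise_cons.1 this.2.1).1 (e, j') h1) (lt_irrefl _)

end RankedNet

end FlowTri

namespace FlowTri

/-! ### Triangulations from unique representations -/

/-- All pairs of elements of `C` are related by `Coh`. -/
def PairwiseCoherent {M : Type*} (Coh : M → M → Prop) (C : Set M) : Prop :=
  ∀ p ∈ C, ∀ q ∈ C, Coh p q

lemma PairwiseCoherent.mono {M : Type*} {Coh : M → M → Prop} {C D : Set M}
    (h : PairwiseCoherent Coh D) (hCD : C ⊆ D) : PairwiseCoherent Coh C :=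
  fun p hp q hq => h p (hCD hp) q (hCD hq)

/-- Each point of the convex set `P` is in a unique way a convex combination of points `z m`
whose indices are pairwise coherent, and the coefficients have no larger denominators than
the point. -/
structure CliqueCoordinates {M E : Type*} [Fintype M] (z : M → E → ℝ) (Coh : M → M → Prop)
    (P : Set (E → ℝ)) : Prop where
  refl : ∀ m, Coh m m
  mem : ∀ m, z m ∈ P
  convex : Convex ℝ P
  nonempty : P.Nonempty
  integral : ∀ m e, ∃ k : ℤ, z m e = k
  exists_rep : ∀ φ ∈ P, ∃ c : M → ℝ, (∀ m, 0 ≤ c m) ∧ PairwiseCoherent Coh (Function.support c) ∧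
    ∑ m, c m = 1 ∧ ∑ m, c m • z m = φ
  unique : ∀ c d : M → ℝ, (∀ m, 0 ≤ c m) → (∀ m, 0 ≤ d m) →
    PairwiseCoherent Coh (Function.support c) → PairwiseCoherent Coh (Function.support d) →
    ∑ m, c m = ∑ m, d m → ∑ m, c m • z m = ∑ m, d m • z m → c = d
  coeff : ∀ (c : M → ℝ) (K : ℕ), 0 < K → (∀ m, 0 ≤ c m) →
    PairwiseCoherent Coh (Function.support c) → ∑ m, c m = 1 →
    (∀ e, ∃ k : ℤ, K * (∑ m, c m • z m) e = k) → ∀ m, ∃ k : ℤ, K * c m = k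

lemma mem_convexHull_image_iff {M V : Type*} [Fintype M] [AddCommGroup V] [Module ℝ V]
    {z : M → V} {C : Set M} {x : V} :
    x ∈ convexHull ℝ (z '' C) ↔ ∃ c : M → ℝ, (∀ m, 0 ≤ c m) ∧ Function.support c ⊆ C ∧
      ∑ m, c m = 1 ∧ ∑ m, c m • z m = x := by
  classical
  constructor
  · intro hx
    have hsub : convexHull ℝ (z '' C) ⊆ {x | ∃ c : M → ℝ, (∀ m, 0 ≤ c m) ∧ Function.support c ⊆ C ∧
        ∑ m, c m = 1 ∧ ∑ m, c m • z m = x} := by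
      refine convexHull_min ?_ ?_
      · rintro _ ⟨m, hm, rfl⟩
        refine ⟨Pi.single m 1, fun i => ?_, ?_, by simp, ?_⟩
        · by_cases h : i = m
          · subst h; simp
          · simp [h]
        · intro i hi
          by_cases h : i = m
          · exact h ▸ hm
          · simp [h] at hi
        · rw [Finset.sum_eq_single m] <;> simp +contextual
      · rintro x ⟨c, hc, hcC, hc1, rfl⟩ y ⟨d, hd, hdC, hd1, rfl⟩ a b ha hb hab
        refine ⟨fun m => a * c m + b * d m, fun m => ?_, ?_, ?_, ?_⟩
        · have := hc m; have := hd m; positivity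
        · intro m hm
          by_contra hmC
          have h1 : c m = 0 := by by_contra h; exact hmC (hcC h)
          have h2 : d m = 0 := by by_contra h; exact hmC (hdC h)
          simp [h1, h2] at hm
        · rw [Finset.sum_add_distrib, ← Finset.mul_sum, ← Finset.mul_sum, hc1, hd1]; linarith
        · simp only [add_smul, mul_smul, Finset.sum_add_distrib, Finset.smul_sum]
    exact hsub hx
  · rintro ⟨c, hc, hcC, hc1, rfl⟩
    have := (convex_convexHull ℝ (z '' C)).finsum_mem (w := c) (z := z) hc
      (by rw [finsum_eq_sum_of_fintype]; exact hc1)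
      (fun m hm => subset_convexHull ℝ _ ⟨m, hcC hm, rfl⟩)
    rwa [finsum_eq_sum_of_fintype] at this

lemma exists_of_mem_vectorSpan_image {M V : Type*} [Fintype M] [AddCommGroup V] [Module ℝ V]
    {z : M → V} {C : Set M} {u : V} (hu : u ∈ vectorSpan ℝ (z '' C)) :
    ∃ c : M → ℝ, Function.support c ⊆ C ∧ ∑ m, c m = 0 ∧ ∑ m, c m • z m = u := by
  classical
  unfold vectorSpan at hu
  induction hu using Submodule.span_induction with
  | mem x hx =>
    obtain ⟨_, ⟨a, ha, rfl⟩, _, ⟨b, hb, rfl⟩, rfl⟩ := hx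
    refine ⟨Pi.single a 1 - Pi.single b 1, ?_, by simp, ?_⟩
    · intro i hi
      by_cases h : i = a
      · exact h ▸ ha
      by_cases h' : i = b
      · exact h' ▸ hb
      simp [h, h'] at hi
    · simp only [Pi.sub_apply, sub_smul, Finset.sum_sub_distrib]
      rw [Finset.sum_eq_single a, Finset.sum_eq_single b] <;> simp +contextual
  | zero => exact ⟨0, by simp, by simp, by simp⟩
  | add x y _ _ hx hy =>
    obtain ⟨c, hc, hc0, rfl⟩ := hx
    obtain ⟨d, hd, hd0, rfl⟩ := hy
    refine ⟨c + d, (Function.support_add c d).trans (Set.union_subset hc hd), ?_, ?_⟩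
    · simp [Finset.sum_add_distrib, hc0, hd0]
    · simp [add_smul, Finset.sum_add_distrib]
  | smul a x _ hx =>
    obtain ⟨c, hc, hc0, rfl⟩ := hx
    refine ⟨a • c, (Function.support_const_smul_subset a c).trans hc, ?_, ?_⟩
    · simp [← Finset.mul_sum, hc0]
    · simp [Finset.smul_sum, mul_smul]

namespace CliqueCoordinates

variable {M E : Type*} [Fintype M] {z : M → E → ℝ} {Coh : M → M → Prop} {P : Set (E → ℝ)}
  {C D : Set M}

/-- The positive and the negative part of `w` are both supported on the clique and represent the
same point with the same total weight, so uniqueness makes them equal. -/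
lemma eq_zero (h : CliqueCoordinates z Coh P) {w : M → ℝ}
    (hw : PairwiseCoherent Coh (Function.support w)) (h0 : ∑ m, w m = 0)
    (hz : ∑ m, w m • z m = 0) : w = 0 := by
  have hsub : ∀ m, max (w m) 0 - max (-w m) 0 = w m := fun m => by
    rcases le_total 0 (w m) with h | h
    · rw [max_eq_left h, max_eq_right (by linarith)]; ring
    · rw [max_eq_right h, max_eq_left (by linarith)]; ring
  have key := h.unique (fun m => max (w m) 0) (fun m => max (-w m) 0)
    (fun m => le_max_right _ _) (fun m => le_max_right _ _)
    (hw.mono fun m hm h0 => hm (by simp [h0])) (hw.mono fun m hm h0 => hm (by simp [h0]))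
    (by rw [← sub_eq_zero, ← Finset.sum_sub_distrib]; simpa only [hsub] using h0)
    (by rw [← sub_eq_zero, ← Finset.sum_sub_distrib]; simpa only [← sub_smul, hsub] using hz)
  funext m
  rw [← hsub m, congrFun key m, sub_self, Pi.zero_apply]

lemma affineIndependent (h : CliqueCoordinates z Coh P) (hC : PairwiseCoherent Coh C) :
    AffineIndependent ℝ (fun m : C => z m) := by
  classical
  rw [affineIndependent_iff]
  intro s w hw0 hwz i hi
  have hext : ∀ j : C, (Function.extend Subtype.val (fun j => if j ∈ s then w j else 0) 0 : M → ℝ) j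
      = if j ∈ s then w j else 0 := fun j => Subtype.val_injective.extend_apply _ _ j
  have hout : ∀ m, m ∉ Set.range (Subtype.val : C → M) →
      (Function.extend Subtype.val (fun j : C => if j ∈ s then w j else 0) 0 : M → ℝ) m = 0 :=
    fun m hm => Function.extend_apply' _ _ _ (by simpa using hm)
  have := h.eq_zero (w := Function.extend Subtype.val (fun j : C => if j ∈ s then w j else 0) 0)
    (hC.mono fun m hm => by
      by_contra hmC
      exact hm (hout m (by simpa using hmC)))
    (by
      rw [← Fintype.sum_of_injective Subtype.val Subtype.val_injective
        (fun j : C => if j ∈ s then w j else 0) _ hout (fun j => (hext j).symm)]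
      simpa using hw0)
    (by
      rw [← Fintype.sum_of_injective Subtype.val Subtype.val_injective
        (fun j : C => (if j ∈ s then w j else 0) • z j) _ (fun m hm => by rw [hout m hm, zero_smul])
        (fun j => by rw [hext j])]
      simpa [ite_smul] using hwz)
  have h1 := hext i
  rw [this] at h1
  simpa [hi] using h1.symm

/-- Singletons are cliques by reflexivity, so uniqueness applies to unit coefficient vectors. -/
lemma injective (h : CliqueCoordinates z Coh P) : Function.Injective z := by
  classical
  intro p q hpq
  have hcl : ∀ p : M, PairwiseCoherent Coh (Function.support (Pi.single p (1 : ℝ) : M → ℝ)) := by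
    intro p a ha b hb
    have : ∀ a, a ∈ Function.support (Pi.single p (1 : ℝ) : M → ℝ) → a = p := by
      intro a ha
      by_contra hap
      simp [hap] at ha
    rw [this a ha, this b hb]
    exact h.refl p
  have hsum : ∀ p : M, ∑ m, (Pi.single p (1 : ℝ) : M → ℝ) m • z m = z p := fun p => by
    rw [Finset.sum_eq_single p] <;> simp +contextual
  have hnn : ∀ p m : M, 0 ≤ (Pi.single p (1 : ℝ) : M → ℝ) m := fun p m => by
    by_cases hm : m = p
    · subst hm; simp
    · simp [hm]
  have := h.unique (Pi.single p 1) (Pi.single q 1) (hnn p) (hnn q) (hcl p) (hcl q)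
    (by simp) (by rw [hsum, hsum, hpq])
  have h1 := congrFun this p
  by_contra hne
  simp [hne] at h1

/-- A common point has the same coefficients in both simplices, so they are supported on the common
vertices. -/
lemma hull_inter_hull (h : CliqueCoordinates z Coh P) (hC : PairwiseCoherent Coh C)
    (hD : PairwiseCoherent Coh D) :
    convexHull ℝ (z '' C) ∩ convexHull ℝ (z '' D) ⊆ convexHull ℝ (z '' (C ∩ D)) := by
  rintro x ⟨hx, hx'⟩
  obtain ⟨c, hc, hcC, hc1, rfl⟩ := mem_convexHull_image_iff.1 hx
  obtain ⟨d, hd, hdD, hd1, hdx⟩ := mem_convexHull_image_iff.1 hx'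
  obtain rfl := h.unique c d hc hd (hC.mono hcC) (hD.mono hdD) (hc1.trans hd1.symm) hdx.symm
  exact mem_convexHull_image_iff.2 ⟨c, hc, Set.subset_inter hcC hdD, hc1, rfl⟩

/-- A vertex `z m` in the hull of `D` lies in the hull of `{m} ∩ D`, which therefore cannot be
empty. -/
lemma subset_of_hull_subset (h : CliqueCoordinates z Coh P) (hC : PairwiseCoherent Coh C)
    (hD : PairwiseCoherent Coh D) (hCD : convexHull ℝ (z '' C) ⊆ convexHull ℝ (z '' D)) :
    C ⊆ D := by
  intro m hm
  have h1 : z m ∈ convexHull ℝ (z '' {m}) := by simp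
  have h2 : z m ∈ convexHull ℝ (z '' D) := hCD (subset_convexHull ℝ _ ⟨m, hm, rfl⟩)
  have h3 := h.hull_inter_hull (C := {m}) (hC.mono (by simpa using hm)) hD ⟨h1, h2⟩
  by_contra hmD
  rw [Set.singleton_inter_eq_empty.2 hmD] at h3
  simp at h3

lemma injOn (h : CliqueCoordinates z Coh P) :
    Set.InjOn (fun C => convexHull ℝ (z '' C)) {C | PairwiseCoherent Coh C} :=
  fun _ hC _ hD hCD => (h.subset_of_hull_subset hC hD hCD.subset).antisymm
    (h.subset_of_hull_subset hD hC hCD.superset)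

lemma nonempty_of_maximal (h : CliqueCoordinates z Coh P) (hC : Maximal (PairwiseCoherent Coh) C) :
    C.Nonempty := by
  by_contra! hne
  obtain ⟨φ, hφ⟩ := h.nonempty
  obtain ⟨c, -, hcl, hc1, -⟩ := h.exists_rep φ hφ
  have : C = Function.support c := hC.eq_of_subset hcl (by simp [hne])
  rw [hne] at this
  have h0 : c = 0 := Function.support_eq_empty_iff.1 this.symm
  simp [h0] at hc1

/-- A maximal clique spans the affine hull of the polytope. -/
lemma vectorSpan_le [Fintype E] (h : CliqueCoordinates z Coh P)
    (hC : Maximal (PairwiseCoherent Coh) C) : vectorSpan ℝ P ≤ vectorSpan ℝ (z '' C) := by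
  classical
  have hne := h.nonempty_of_maximal hC
  set S : Finset M := Finset.univ.filter (· ∈ C) with hS
  have hScard : 0 < S.card := Finset.card_pos.2 (by obtain ⟨m, hm⟩ := hne; exact ⟨m, by simp [hS, hm]⟩)
  -- The barycentre `p` of the simplex: all vertices of `C` have positive weight, so by uniqueness
  -- and maximality no other clique simplex contains `p`.
  set b : M → ℝ := fun m => if m ∈ C then (S.card : ℝ)⁻¹ else 0 with hb
  have hb0 : ∀ m, 0 ≤ b m := fun m => by simp only [hb]; split_ifs <;> positivity
  have hb1 : ∑ m, b m = 1 := by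
    simp only [hb]
    rw [← Finset.sum_filter, Finset.sum_const, nsmul_eq_mul, ← hS,
      mul_inv_cancel₀ (by positivity)]
  have hbC : Function.support b = C := by
    ext m
    have : (S.card : ℝ) ≠ 0 := by positivity
    simp only [hb, Function.mem_support]
    split_ifs with hm <;> simp [hm, this]
  set p : E → ℝ := ∑ m, b m • z m with hp
  have hpP : p ∈ P := by
    have := h.convex.sum_mem (t := Finset.univ) (w := b) (z := z) (fun m _ => hb0 m) hb1
      (fun m _ => h.mem m)
    exact this
  have hsuppD : ∀ D, PairwiseCoherent Coh D → p ∈ convexHull ℝ (z '' D) → D = C := by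
    intro D hD hpD
    obtain ⟨d, hd, hdD, hd1, hdp⟩ := mem_convexHull_image_iff.1 hpD
    have : b = d := h.unique b d hb0 hd (hbC ▸ hC.prop) (hD.mono hdD) (hb1.trans hd1.symm) hdp.symm
    exact (hC.eq_of_subset hD (by rw [← hbC, this]; exact hdD)).symm
  -- The union of all other clique simplices is closed and misses `p`. Hence points of `P` close
  -- enough to `p` lie in the simplex of `C`.
  set U : Set (E → ℝ) := ⋃ D ∈ {D : Set M | PairwiseCoherent Coh D ∧ D ≠ C},
    convexHull ℝ (z '' D) with hU
  have hUclosed : IsClosed U := by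
    refine Set.Finite.isClosed_biUnion (Set.toFinite _) fun D _ => ?_
    exact ((Set.toFinite D).image z).isClosed_convexHull ℝ
  have hpU : p ∉ U := by
    simp only [hU, Set.mem_iUnion, not_exists]
    rintro D ⟨hD, hDC⟩ hpD
    exact hDC (hsuppD D hD hpD)
  have hPspan : P ⊆ affineSpan ℝ (z '' C) := by
    intro q hq
    have hcont : Filter.Tendsto (fun t : ℝ => (1 - t) • p + t • q) (nhdsWithin 0 (Set.Ioi 0))
        (nhds p) := by
      have : Continuous fun t : ℝ => (1 - t) • p + t • q := by fun_prop
      have := this.tendsto 0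
      simp only [sub_zero, one_smul, zero_smul, add_zero] at this
      exact this.mono_left nhdsWithin_le_nhds
    have hev := hcont.eventually (hUclosed.isOpen_compl.mem_nhds hpU)
    have hev2 : ∀ᶠ t : ℝ in nhdsWithin 0 (Set.Ioi 0), t ∈ Set.Ioo (0 : ℝ) 1 :=
      Ioo_mem_nhdsGT one_pos
    obtain ⟨t, ht, ht0, ht1⟩ := (hev.and hev2).exists
    have htP : (1 - t) • p + t • q ∈ P := h.convex hpP hq (by linarith) ht0.le (by ring)
    obtain ⟨c, hc, hccl, hc1, hct⟩ := h.exists_rep _ htP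
    have htc : (1 - t) • p + t • q ∈ convexHull ℝ (z '' Function.support c) :=
      mem_convexHull_image_iff.2 ⟨c, hc, subset_rfl, hc1, hct⟩
    have hcC : Function.support c = C := by
      by_contra hne
      apply ht
      simp only [hU, Set.mem_iUnion]
      exact ⟨_, ⟨hccl, hne⟩, htc⟩
    rw [hcC] at htc
    have h1 := convexHull_subset_affineSpan _ htc
    have h2 : p ∈ affineSpan ℝ (z '' C) := convexHull_subset_affineSpan _
      (mem_convexHull_image_iff.2 ⟨b, hb0, hbC.subset, hb1, rfl⟩)
    -- The point at parameter `t` on the segment from `p` to `q` lies in the simplex of `C`;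
    -- stretching by `t⁻¹` from `p` recovers `q`.
    have h3 : AffineMap.lineMap p ((1 - t) • p + t • q) t⁻¹ ∈ affineSpan ℝ (z '' C) :=
      AffineMap.lineMap_mem _ h2 h1
    have ht0' : t ≠ 0 := ht0.ne'
    suffices q = AffineMap.lineMap p ((1 - t) • p + t • q) t⁻¹ by rw [this]; exact h3
    rw [AffineMap.lineMap_apply_module]
    ext e
    simp only [Pi.add_apply, Pi.smul_apply, smul_eq_mul]
    field_simp
    ring
  calc vectorSpan ℝ P ≤ vectorSpan ℝ (affineSpan ℝ (z '' C) : Set (E → ℝ)) := vectorSpan_mono ℝ hPspan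
    _ = vectorSpan ℝ (z '' C) := by
      rw [← direction_affineSpan ℝ (affineSpan ℝ (z '' C) : Set (E → ℝ)),
        AffineSubspace.affineSpan_coe, direction_affineSpan]

/-- Integral vectors parallel to a maximal simplex have integral barycentric coordinates. -/
lemma int_coordinates (h : CliqueCoordinates z Coh P) (hC : PairwiseCoherent Coh C)
    (hne : C.Nonempty) {c : M → ℝ} (hcC : Function.support c ⊆ C) (hc0 : ∑ m, c m = 0)
    (hint : ∀ e, ∃ k : ℤ, (∑ m, c m • z m) e = k) : ∀ m, ∃ k : ℤ, c m = k := by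
  classical
  set S : Finset M := Finset.univ.filter (· ∈ C) with hS
  have hScard : 0 < S.card := Finset.card_pos.2 (by obtain ⟨m, hm⟩ := hne; exact ⟨m, by simp [hS, hm]⟩)
  -- Shifting all coefficients on `C` by the integer `N + 1` makes them nonnegative. As `c` has sum
  -- zero, the new total is `K = |C| (N + 1)`, and dividing by `K` gives a convex combination to
  -- which `coeff` applies with denominator `K`.
  obtain ⟨N, hN⟩ := exists_nat_ge (∑ m, |c m|)
  have hNc : ∀ m, 0 ≤ (N + 1 : ℝ) + c m := fun m => by
    have h1 := Finset.single_le_sum (f := fun m => |c m|) (fun i _ => abs_nonneg _)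
      (Finset.mem_univ m)
    have h2 := neg_abs_le (c m)
    linarith
  set K : ℕ := S.card * (N + 1) with hK
  have hK0 : (0 : ℝ) < K := by rw [hK]; positivity
  set d : M → ℝ := fun m => if m ∈ C then ((N + 1 : ℝ) + c m) / K else 0 with hd
  have hKd : ∀ m, K * d m = (if m ∈ C then (N + 1 : ℝ) else 0) + c m := by
    intro m
    simp only [hd]
    split_ifs with hm
    · field_simp
    · have : c m = 0 := by by_contra h'; exact hm (hcC h')
      simp [this]
  have hKz : (K : ℝ) • ∑ m, d m • z m = (N + 1 : ℝ) • ∑ m ∈ S, z m + ∑ m, c m • z m := by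
    rw [Finset.smul_sum, hS, Finset.sum_filter, Finset.smul_sum, ← Finset.sum_add_distrib]
    refine Finset.sum_congr rfl fun m _ => ?_
    rw [← mul_smul, hKd, add_smul]
    split_ifs <;> simp
  have := h.coeff d K (by exact_mod_cast hK0)
    (fun m => by simp only [hd]; split_ifs; exacts [div_nonneg (hNc m) hK0.le, le_rfl])
    (hC.mono fun m hm => by by_contra hmC; simp [hd, hmC] at hm)
    (by
      have : (K : ℝ) * ∑ m, d m = K := by
        rw [Finset.mul_sum]
        simp only [hKd]
        rw [Finset.sum_add_distrib, hc0, ← Finset.sum_filter, Finset.sum_const, ← hS, hK, nsmul_eq_mul, add_zero]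
        push_cast
        ring
      exact mul_left_cancel₀ hK0.ne' (this.trans (mul_one _).symm))
    (by
      intro e
      have h1 := congrFun hKz e
      simp only [Pi.smul_apply, smul_eq_mul, Pi.add_apply] at h1
      rw [h1]
      obtain ⟨k, hk⟩ := hint e
      choose j hj using fun m => h.integral m e
      refine ⟨(N + 1) * ∑ m ∈ S, j m + k, ?_⟩
      rw [hk]
      push_cast
      rw [Finset.sum_apply]
      simp only [hj])
  intro m
  obtain ⟨k, hk⟩ := this m
  rw [hKd] at hk
  refine ⟨k - if m ∈ C then (N + 1) else 0, ?_⟩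
  push_cast
  linarith

/-- Because a maximal clique spans every direction of `P`, an integer vector parallel to `P` is a
combination of vertices with coefficient sum zero, and `int_coordinates` makes these coefficients
integers. -/
lemma isUnimodularIn [Fintype E] (h : CliqueCoordinates z Coh P)
    (hC : Maximal (PairwiseCoherent Coh) C) {s : Finset (E → ℝ)} (hs : (s : Set (E → ℝ)) = z '' C) :
    IsUnimodularIn P s := by
  have hsmem : ∀ v ∈ s, ∃ m ∈ C, z m = v := fun v hv => by
    have : v ∈ (s : Set (E → ℝ)) := hv
    rwa [hs] at this
  refine ⟨fun v hv e => ?_, fun v₀ hv₀ => ?_⟩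
  · obtain ⟨m, -, rfl⟩ := hsmem v hv
    exact h.integral m e
  obtain ⟨m₀, hm₀, rfl⟩ := hsmem v₀ hv₀
  apply Set.Subset.antisymm
  · intro u hu
    induction hu using Submodule.span_induction with
    | mem x hx =>
      obtain ⟨v, hv, rfl⟩ := hx
      obtain ⟨m, -, rfl⟩ := hsmem v hv
      refine ⟨vsub_mem_vectorSpan ℝ (h.mem m) (h.mem m₀), fun e => ?_⟩
      obtain ⟨k, hk⟩ := h.integral m e
      obtain ⟨l, hl⟩ := h.integral m₀ e
      exact ⟨k - l, by simp [hk, hl]⟩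
    | zero => exact ⟨zero_mem _, fun e => ⟨0, by simp⟩⟩
    | add x y _ _ hx hy =>
      refine ⟨add_mem hx.1 hy.1, fun e => ?_⟩
      obtain ⟨k, hk⟩ := hx.2 e
      obtain ⟨l, hl⟩ := hy.2 e
      exact ⟨k + l, by simp [hk, hl]⟩
    | smul a x _ hx =>
      refine ⟨zsmul_mem hx.1 a, fun e => ?_⟩
      obtain ⟨k, hk⟩ := hx.2 e
      exact ⟨a * k, by simp [hk]⟩
  · rintro u ⟨hu, huint⟩
    obtain ⟨c, hcC, hc0, rfl⟩ := exists_of_mem_vectorSpan_image (h.vectorSpan_le hC hu)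
    choose k hk using h.int_coordinates hC.prop (h.nonempty_of_maximal hC) hcC hc0 huint
    -- The coefficients have sum zero, so subtracting the base vertex from every vertex changes
    -- nothing.
    have : ∑ m, c m • z m = ∑ m, k m • (z m - z m₀) := by
      have h1 : ∀ m, k m • (z m - z m₀) = c m • z m - c m • z m₀ := fun m => by
        rw [hk m, Int.cast_smul_eq_zsmul, Int.cast_smul_eq_zsmul, smul_sub]
      simp only [h1]
      rw [Finset.sum_sub_distrib, ← Finset.sum_smul, hc0, zero_smul, sub_zero]
    rw [this]
    refine sum_mem fun m _ => ?_
    by_cases hm : m ∈ C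
    · refine Submodule.smul_mem _ _ (Submodule.subset_span ⟨z m, ?_, rfl⟩)
      rw [hs]
      exact ⟨m, hm, rfl⟩
    · have h0 : c m = 0 := by by_contra h'; exact hm (hcC h')
      have : k m = 0 := by have := hk m; rw [h0] at this; exact_mod_cast this.symm
      rw [this, zero_smul]
      exact zero_mem _

/-- The geometric simplicial complex of the cliques. -/
noncomputable def complex (h : CliqueCoordinates z Coh P) :
    Geometry.SimplicialComplex ℝ (E → ℝ) where
  faces := {s | ∃ C, PairwiseCoherent Coh C ∧ C.Nonempty ∧ (s : Set (E → ℝ)) = z '' C}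
  isRelLowerSet_faces := by
    rintro s ⟨C, hC, hne, hs⟩
    refine ⟨?_, fun t hts htne => ?_⟩
    · rw [← Finset.coe_nonempty, hs]
      exact hne.image z
    · have hts' : (t : Set (E → ℝ)) ⊆ z '' C := hs ▸ Finset.coe_subset.2 hts
      obtain ⟨D, hDC, hD⟩ := Set.subset_image_iff.1 hts'
      refine ⟨D, hC.mono hDC, ?_, hD.symm⟩
      rw [← Set.image_nonempty (f := z), hD]
      exact htne
  indep := by
    rintro s ⟨C, hC, -, hs⟩
    have := (h.affineIndependent hC).range
    rw [Set.range_comp' z Subtype.val, Subtype.range_coe, ← hs] at this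
    exact this
  inter_subset_convexHull := by
    rintro s t ⟨C, hC, -, hs⟩ ⟨D, hD, -, ht⟩
    rw [hs, ht, ← Set.image_inter h.injective]
    exact h.hull_inter_hull hC hD

lemma mem_facets_complex_iff (h : CliqueCoordinates z Coh P) {s : Finset (E → ℝ)} :
    s ∈ h.complex.facets ↔ ∃ C, Maximal (PairwiseCoherent Coh) C ∧ (s : Set (E → ℝ)) = z '' C := by
  constructor
  · rintro ⟨⟨C, hC, hne, hs⟩, hmax⟩
    refine ⟨C, ⟨hC, fun D hD hCD => ?_⟩, hs⟩
    have hfin : (z '' D).Finite := (Set.toFinite D).image z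
    have := hmax (t := hfin.toFinset) ⟨D, hD, hne.mono hCD, by simp⟩
      (by rw [← Finset.coe_subset, hs]; simpa using Set.image_mono hCD)
    have h2 : z '' C = z '' D := by rw [← hs, this]; simp
    exact (h.injective.image_injective h2).superset
  · rintro ⟨C, hC, hs⟩
    refine ⟨⟨C, hC.prop, h.nonempty_of_maximal hC, hs⟩, ?_⟩
    rintro t ⟨D, hD, -, ht⟩ hst
    have h1 : z '' C ⊆ z '' D := by rw [← hs, ← ht]; exact hst
    have h2 : C = D := hC.eq_of_subset hD ((Set.image_subset_image_iff h.injective).1 h1)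
    rw [← Finset.coe_inj, hs, ht, h2]

/-- Existence of coordinates gives the covering of `P`, uniqueness gives the complex, and
integrality of the coefficients gives unimodularity. -/
theorem isUnimodularTriangulation [Fintype E] (h : CliqueCoordinates z Coh P) :
    IsUnimodularTriangulation P
      ((fun C => convexHull ℝ (z '' C)) '' {C | Maximal (PairwiseCoherent Coh) C}) := by
  classical
  refine ⟨h.complex, ?_, ?_, ?_, ?_⟩
  · have hinj : Set.InjOn (fun s : Finset (E → ℝ) => (s : Set (E → ℝ))) h.complex.faces :=
      Finset.coe_injective.injOn
    refine Set.Finite.of_finite_image (f := fun s : Finset (E → ℝ) => (s : Set (E → ℝ))) ?_ hinj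
    refine (Set.finite_range fun C : Set M => z '' C).subset ?_
    rintro _ ⟨s, ⟨C, -, -, hs⟩, rfl⟩
    exact ⟨C, hs.symm⟩
  · ext φ
    rw [Geometry.SimplicialComplex.mem_space_iff]
    constructor
    · rintro ⟨s, ⟨C, -, -, hs⟩, hφ⟩
      rw [hs] at hφ
      refine convexHull_min ?_ h.convex hφ
      rintro _ ⟨m, -, rfl⟩
      exact h.mem m
    · intro hφ
      obtain ⟨c, hc, hccl, hc1, rfl⟩ := h.exists_rep φ hφ
      have hfin : (z '' Function.support c).Finite := (Set.toFinite _).image z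
      refine ⟨hfin.toFinset, ⟨_, hccl, ?_, by simp⟩, ?_⟩
      · by_contra! hne
        rw [Function.support_eq_empty_iff] at hne
        simp [hne] at hc1
      · rw [Set.Finite.coe_toFinset]
        exact mem_convexHull_image_iff.2 ⟨c, hc, subset_rfl, hc1, rfl⟩
  · ext T
    constructor
    · rintro ⟨s, hs, rfl⟩
      obtain ⟨C, hC, hsC⟩ := h.mem_facets_complex_iff.1 hs
      exact ⟨C, hC, by simp only [hsC]⟩
    · rintro ⟨C, hC, rfl⟩
      have hfin : (z '' C).Finite := (Set.toFinite _).image z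
      exact ⟨hfin.toFinset, h.mem_facets_complex_iff.2 ⟨C, hC, by simp⟩, by simp⟩
  · intro s hs
    obtain ⟨C, hC, hsC⟩ := h.mem_facets_complex_iff.1 hs
    exact h.isUnimodularIn hC hsC

end CliqueCoordinates

end FlowTri

namespace FlowTri

/-! ### From integral to real coordinates -/

/-- Finitely many real numbers are limits of their images under `ℚ`-linear maps `ℝ → ℚ`. -/
lemma exists_ratLinear_tendsto {ι : Type*} [Finite ι] (y : ι → ℝ) :
    ∃ g : ℕ → (ℝ →ₗ[ℚ] ℚ), ∀ i,
      Filter.Tendsto (fun j => (g j (y i) : ℝ)) Filter.atTop (nhds (y i)) := by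
  -- The given numbers span a finite-dimensional ℚ-space. Sending its basis vectors to nearby
  -- rationals defines a linear map on it, which is then extended to all of ℝ; linearity preserves
  -- every rational relation between the numbers.
  set W : Submodule ℚ ℝ := Submodule.span ℚ (Set.range y) with hW
  have : FiniteDimensional ℚ W := FiniteDimensional.span_of_finite ℚ (Set.finite_range y)
  let b := Module.finBasis ℚ W
  have hq : ∀ l, ∃ q : ℕ → ℚ, Filter.Tendsto (fun j => (q j : ℝ)) Filter.atTop
      (nhds ((b l : W) : ℝ)) := fun l => by
    have := fun j : ℕ => exists_rat_btwn (show ((b l : W) : ℝ) < (b l : W) + 1 / ((j : ℝ) + 1) by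
      have : (0 : ℝ) < 1 / ((j : ℝ) + 1) := by positivity
      linarith)
    choose q hq1 hq2 using this
    refine ⟨q, tendsto_of_tendsto_of_tendsto_of_le_of_le tendsto_const_nhds ?_
      (fun j => (hq1 j).le) (fun j => (hq2 j).le)⟩
    simpa using tendsto_const_nhds.add (tendsto_one_div_add_atTop_nhds_zero_nat (𝕜 := ℝ))
  choose q hq using hq
  have hext : ∀ j, ∃ g : ℝ →ₗ[ℚ] ℚ, g.comp W.subtype = b.constr ℚ (fun l => q l j) :=
    fun j => LinearMap.exists_extend _
  choose g hg using hext
  refine ⟨g, fun i => ?_⟩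
  have hyW : y i ∈ W := Submodule.subset_span ⟨i, rfl⟩
  have h1 : ∀ j, (g j (y i) : ℝ) = ∑ l, (b.repr ⟨y i, hyW⟩ l : ℝ) * (q l j : ℝ) := fun j => by
    have := LinearMap.congr_fun (hg j) ⟨y i, hyW⟩
    rw [Module.Basis.constr_apply_fintype] at this
    simp only [LinearMap.comp_apply, Submodule.subtype_apply, Module.Basis.equivFun_apply,
      smul_eq_mul] at this
    rw [this]
    push_cast
    rfl
  have h2 : y i = ∑ l, (b.repr ⟨y i, hyW⟩ l : ℝ) * ((b l : W) : ℝ) := by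
    have := congrArg (Subtype.val : W → ℝ) (b.sum_repr ⟨y i, hyW⟩)
    rw [Submodule.coe_sum] at this
    conv_lhs => rw [show y i = ((⟨y i, hyW⟩ : W) : ℝ) from rfl, ← this]
    refine Finset.sum_congr rfl fun l _ => ?_
    rw [Submodule.coe_smul, Rat.smul_def]
  simp only [h1]
  conv => rhs; rw [h2]
  exact tendsto_finsetSum _ fun l _ => (hq l).const_mul _

lemma exists_common_denominator {ι : Type*} [Fintype ι] (q : ι → ℚ) (hq : ∀ i, 0 ≤ q i) :
    ∃ (N : ℕ) (n : ι → ℕ), 0 < N ∧ ∀ i, (n i : ℚ) = N * q i := by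
  classical
  refine ⟨∏ i, (q i).den, fun i => (∏ j ∈ Finset.univ.erase i, (q j).den) * (q i).num.toNat,
    Finset.prod_pos fun i _ => (q i).den_pos, fun i => ?_⟩
  rw [← Finset.mul_prod_erase Finset.univ (fun j => (q j).den) (Finset.mem_univ i)]
  have h1 : ((q i).num.toNat : ℚ) = (q i).num := by
    exact_mod_cast Int.toNat_of_nonneg (Rat.num_nonneg.2 (hq i))
  have h2 : ((q i).den : ℚ) * q i = (q i).num := Rat.den_mul_eq_num (q i)
  rw [Nat.cast_mul, h1, ← h2]
  push_cast
  ring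

section Integral

variable {M E V : Type*} [Fintype M] {Coh : M → M → Prop} {w : M → E → ℕ}

/-- A ℚ-linear map close to the identity on all coefficients respects the integral linear relations
and keeps zeros, hence the supports stay in the cliques. Once it is close enough, signs and the
difference at `m₀` survive too; clearing denominators then contradicts uniqueness over ℕ. -/
lemma real_unique_of_nat_unique
    (hu : ∀ c d : M → ℕ, PairwiseCoherent Coh (Function.support c) →
      PairwiseCoherent Coh (Function.support d) → ∑ m, c m = ∑ m, d m →
      (∀ e, ∑ m, c m * w m e = ∑ m, d m * w m e) → c = d)
    {c d : M → ℝ} (hc : ∀ m, 0 ≤ c m) (hd : ∀ m, 0 ≤ d m)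
    (hcC : PairwiseCoherent Coh (Function.support c))
    (hdD : PairwiseCoherent Coh (Function.support d)) (hsum : ∑ m, c m = ∑ m, d m)
    (hw : ∀ e, ∑ m, c m * w m e = ∑ m, d m * w m e) : c = d := by
  by_contra hne
  obtain ⟨m₀, hm₀⟩ := Function.ne_iff.1 hne
  obtain ⟨g, hg⟩ := exists_ratLinear_tendsto (Sum.elim c d)
  have hgc : ∀ m, Filter.Tendsto (fun j => (g j (c m) : ℝ)) Filter.atTop (nhds (c m)) :=
    fun m => hg (.inl m)
  have hgd : ∀ m, Filter.Tendsto (fun j => (g j (d m) : ℝ)) Filter.atTop (nhds (d m)) :=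
    fun m => hg (.inr m)
  have nonneg : ∀ x : ℝ, 0 ≤ x → Filter.Tendsto (fun j => (g j x : ℝ)) Filter.atTop (nhds x) →
      ∀ᶠ j in Filter.atTop, 0 ≤ g j x := by
    intro x hx hgx
    rcases hx.eq_or_lt with rfl | hx
    · simp
    · filter_upwards [hgx.eventually (lt_mem_nhds hx)] with j hj
      exact_mod_cast hj.le
  have e1 : ∀ᶠ j in Filter.atTop, ∀ m, 0 ≤ g j (c m) :=
    Filter.eventually_all.2 fun m => nonneg _ (hc m) (hgc m)
  have e2 : ∀ᶠ j in Filter.atTop, ∀ m, 0 ≤ g j (d m) :=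
    Filter.eventually_all.2 fun m => nonneg _ (hd m) (hgd m)
  have e3 : ∀ᶠ j in Filter.atTop, g j (c m₀) ≠ g j (d m₀) := by
    filter_upwards [((hgc m₀).sub (hgd m₀)).eventually_ne (sub_ne_zero.2 hm₀)] with j hj heq
    exact hj (by rw [heq, sub_self])
  obtain ⟨j, h1, h2, h3⟩ := (e1.and (e2.and e3)).exists
  obtain ⟨N, n, hN, hn⟩ := exists_common_denominator
    (Sum.elim (fun m => g j (c m)) (fun m => g j (d m))) (by rintro (m | m); exacts [h1 m, h2 m])
  have hnc : ∀ m, (n (.inl m) : ℚ) = N * g j (c m) := fun m => hn (.inl m)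
  have hnd : ∀ m, (n (.inr m) : ℚ) = N * g j (d m) := fun m => hn (.inr m)
  have key := hu (fun m => n (.inl m)) (fun m => n (.inr m))
    (hcC.mono fun m hm h0 => hm (by
      have := hnc m
      rw [h0, map_zero, mul_zero] at this
      exact_mod_cast this))
    (hdD.mono fun m hm h0 => hm (by
      have := hnd m
      rw [h0, map_zero, mul_zero] at this
      exact_mod_cast this))
    (by
      have := congrArg (fun x => (N : ℚ) * g j x) hsum
      simp only [map_sum, Finset.mul_sum, ← hnc, ← hnd] at this
      exact_mod_cast this)
    (fun e => by
      have hcm : ∀ (x : ℝ) (i : ℕ), g j (x * i) = i * g j x := fun x i => by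
        rw [mul_comm, ← nsmul_eq_mul, map_nsmul, nsmul_eq_mul]
      have := congrArg (fun x => (N : ℚ) * g j x) (hw e)
      simp only [map_sum, Finset.mul_sum, hcm, mul_left_comm (N : ℚ), ← hnc, ← hnd] at this
      simp only [mul_comm _ (w _ e)]
      exact_mod_cast this)
  have h4 := congrFun key m₀
  apply h3
  have h5 : (N : ℚ) * g j (c m₀) = N * g j (d m₀) := by
    rw [← hnc, ← hnd]
    exact_mod_cast h4
  exact mul_left_cancel₀ (by exact_mod_cast hN.ne') h5

/-- If the integral points of all dilations of a rational polytope have unique coordinates, then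
so have all its points. -/
theorem CliqueCoordinates.of_integral [Fintype E] [Nonempty M] (A : V → E → ℤ) (b : V → ℤ)
    (hrefl : ∀ m, Coh m m) (hmem : ∀ m v, b v + ∑ e, A v e * (w m e : ℤ) = 0)
    (hex : ∀ (k : ℕ) (ψ : E → ℕ), (∀ v, k * b v + ∑ e, A v e * (ψ e : ℤ) = 0) →
      ∃ c : M → ℕ, PairwiseCoherent Coh (Function.support c) ∧ ∑ m, c m = k ∧
        ∀ e, ∑ m, c m * w m e = ψ e)
    (hu : ∀ c d : M → ℕ, PairwiseCoherent Coh (Function.support c) →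
      PairwiseCoherent Coh (Function.support d) → ∑ m, c m = ∑ m, d m →
      (∀ e, ∑ m, c m * w m e = ∑ m, d m * w m e) → c = d) :
    CliqueCoordinates (fun m e => (w m e : ℝ)) Coh
      {φ | (∀ e, 0 ≤ φ e) ∧ ∀ v, (b v : ℝ) + ∑ e, (A v e : ℝ) * φ e = 0} := by
  have hmemP : ∀ m, (fun e => (w m e : ℝ)) ∈
      {φ : E → ℝ | (∀ e, 0 ≤ φ e) ∧ ∀ v, (b v : ℝ) + ∑ e, (A v e : ℝ) * φ e = 0} := fun m =>
    ⟨fun e => by positivity, fun v => by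
      have := hmem m v
      dsimp only
      exact_mod_cast this⟩
  have hunique : ∀ c d : M → ℝ, (∀ m, 0 ≤ c m) → (∀ m, 0 ≤ d m) →
      PairwiseCoherent Coh (Function.support c) → PairwiseCoherent Coh (Function.support d) →
      ∑ m, c m = ∑ m, d m → ∑ m, c m • (fun e => (w m e : ℝ)) = ∑ m, d m • (fun e => (w m e : ℝ)) →
      c = d := fun c d hc hd hcC hdD hsum hz =>
    real_unique_of_nat_unique hu hc hd hcC hdD hsum fun e => by
      have := congrFun hz e
      simpa only [Finset.sum_apply, Pi.smul_apply, smul_eq_mul] using this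
  refine ⟨hrefl, hmemP, ?_, ⟨_, hmemP (Classical.arbitrary M)⟩, fun m e => ⟨w m e, by simp⟩, ?_,
    hunique, ?_⟩
  · rintro x ⟨hx, hx'⟩ y ⟨hy, hy'⟩ s t hs ht hst
    refine ⟨fun e => ?_, fun v => ?_⟩
    · have := hx e; have := hy e
      simp only [Pi.add_apply, Pi.smul_apply, smul_eq_mul]
      positivity
    · simp only [Pi.add_apply, Pi.smul_apply, smul_eq_mul, mul_add, Finset.sum_add_distrib,
        mul_left_comm _ s, mul_left_comm _ t, ← Finset.mul_sum]
      linear_combination s * hx' v + t * hy' v - (b v : ℝ) * hst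
  · rintro φ ⟨hφ, hφ'⟩
    -- The union of the clique simplices is closed, so it suffices to approximate φ by its points.
    set U : Set (E → ℝ) := ⋃ C ∈ {C : Set M | PairwiseCoherent Coh C},
      convexHull ℝ ((fun m e => (w m e : ℝ)) '' C) with hU
    have hUclosed : IsClosed U := by
      refine Set.Finite.isClosed_biUnion (Set.toFinite _) fun D _ => ?_
      exact ((Set.toFinite D).image _).isClosed_convexHull ℝ
    suffices hφU : φ ∈ U by
      simp only [hU, Set.mem_iUnion] at hφU
      obtain ⟨C, hC, hφC⟩ := hφU
      obtain ⟨c, hc, hcC, hc1, hcφ⟩ := mem_convexHull_image_iff.1 hφC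
      exact ⟨c, hc, PairwiseCoherent.mono hC hcC, hc1, hcφ⟩
    -- The number 1 is approximated along with the coordinates: `g j 1` need not be 1, and dividing
    -- by it restores the inhomogeneous equations.
    obtain ⟨g, hg⟩ := exists_ratLinear_tendsto (fun o : Option E => o.elim 1 φ)
    have hg1 : Filter.Tendsto (fun j => (g j 1 : ℝ)) Filter.atTop (nhds 1) := hg none
    have hgφ : ∀ e, Filter.Tendsto (fun j => (g j (φ e) : ℝ)) Filter.atTop (nhds (φ e)) :=
      fun e => hg (some e)
    have hlim : Filter.Tendsto (fun j e => (g j (φ e) : ℝ) / (g j 1 : ℝ)) Filter.atTop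
        (nhds φ) := by
      rw [tendsto_pi_nhds]
      intro e
      have := (hgφ e).div hg1 one_ne_zero
      rw [div_one] at this
      exact this
    refine hUclosed.mem_of_tendsto hlim ?_
    have e1 : ∀ᶠ j in Filter.atTop, 0 < g j 1 := by
      filter_upwards [hg1.eventually (lt_mem_nhds zero_lt_one)] with j hj
      exact_mod_cast hj
    have e2 : ∀ᶠ j in Filter.atTop, ∀ e, 0 ≤ g j (φ e) := by
      refine Filter.eventually_all.2 fun e => ?_
      rcases (hφ e).eq_or_lt with h | h
      · rw [← h]; simp
      · filter_upwards [(hgφ e).eventually (lt_mem_nhds h)] with j hj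
        exact_mod_cast hj.le
    filter_upwards [e1, e2] with j h1 h2
    obtain ⟨N, n, hN, hn⟩ := exists_common_denominator
      (fun o : Option E => o.elim (g j 1) (fun e => g j (φ e))) (by
        rintro (_ | e); exacts [h1.le, h2 e])
    have hn0 : (n none : ℚ) = N * g j 1 := hn none
    have hnφ : ∀ e, (n (some e) : ℚ) = N * g j (φ e) := fun e => hn (some e)
    have hn0pos : 0 < n none := by
      have : (0 : ℚ) < n none := by rw [hn0]; positivity
      exact_mod_cast this
    -- After clearing denominators the approximation is an integral point of the dilation by `n
    -- none`.
    obtain ⟨c, hcC, hc1, hcw⟩ := hex (n none) (fun e => n (some e)) fun v => by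
      have hgA : ∀ (i : ℤ) (x : ℝ), g j (i * x) = i * g j x := fun i x => by
        rw [← zsmul_eq_mul, map_zsmul, zsmul_eq_mul]
      have h3 := congrArg (fun x => (N : ℚ) * g j x) (hφ' v)
      rw [← mul_one (b v : ℝ)] at h3
      simp only [map_add, map_sum, hgA, map_zero, mul_zero, mul_add, Finset.mul_sum,
        mul_left_comm (N : ℚ), ← hn0, ← hnφ] at h3
      have h4 : ((n none * b v + ∑ e, A v e * (n (some e) : ℤ) : ℤ) : ℚ) = 0 := by
        push_cast
        linarith
      exact_mod_cast h4
    simp only [hU, Set.mem_iUnion]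
    refine ⟨Function.support c, hcC, mem_convexHull_image_iff.2
      ⟨fun m => c m / n none, fun m => by positivity, fun m hm => ?_, ?_, ?_⟩⟩
    · intro h0
      exact hm (by simp [h0])
    · rw [← Finset.sum_div, ← Nat.cast_sum, hc1, div_self (by positivity)]
    · funext e
      simp only [Finset.sum_apply, Pi.smul_apply, smul_eq_mul, div_mul_eq_mul_div,
        ← Finset.sum_div]
      have h3 : ∑ m, (c m : ℝ) * (w m e : ℝ) = n (some e) := by exact_mod_cast hcw e
      have h4 : (n (some e) : ℝ) = N * (g j (φ e) : ℝ) := by exact_mod_cast hnφ e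
      have h5 : (n none : ℝ) = N * (g j 1 : ℝ) := by exact_mod_cast hn0
      rw [h3, h4, h5, mul_div_mul_left _ _ (by exact_mod_cast hN.ne')]
  · intro c K hK hc hcC hc1 hint
    have hK0 : (0 : ℝ) < K := by exact_mod_cast hK
    choose k hk using hint
    have hk0 : ∀ e, 0 ≤ k e := fun e => by
      have : (0 : ℝ) ≤ k e := by
        rw [← hk e]
        simp only [Finset.sum_apply, Pi.smul_apply, smul_eq_mul]
        exact mul_nonneg hK0.le (Finset.sum_nonneg fun m _ => mul_nonneg (hc m) (by positivity))
      exact_mod_cast this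
    have hkt : ∀ e, (((k e).toNat : ℤ) : ℝ) = ∑ m, K * c m * w m e := fun e => by
      rw [Int.toNat_of_nonneg (hk0 e), ← hk e]
      simp only [Finset.sum_apply, Pi.smul_apply, smul_eq_mul, Finset.mul_sum, mul_assoc]
    -- The K-fold multiple of the point is an integral point of the K-fold dilation, so it has
    -- natural multiplicities `d`; uniqueness identifies them with `K * c`.
    obtain ⟨d, hdD, hd1, hdw⟩ := hex K (fun e => (k e).toNat) fun v => by
      have h1 : ((K * b v + ∑ e, A v e * ((k e).toNat : ℤ) : ℤ) : ℝ) = 0 := by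
        rw [Int.cast_add, Int.cast_sum]
        simp only [Int.cast_mul, hkt, Finset.mul_sum]
        rw [Finset.sum_comm]
        have h2 : ∀ m, ∑ e, (A v e : ℝ) * (K * c m * w m e) = K * c m * -(b v : ℝ) := fun m => by
          have := (hmemP m).2 v
          rw [← eq_neg_iff_add_eq_zero.2 (by rw [add_comm]; exact this), Finset.mul_sum]
          exact Finset.sum_congr rfl fun e _ => by ring
        simp only [h2]
        rw [← Finset.sum_mul, ← Finset.mul_sum, hc1]
        push_cast
        ring
      exact_mod_cast h1
    have := hunique (fun m => K * c m) (fun m => d m) (fun m => mul_nonneg hK0.le (hc m))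
      (fun m => by positivity) (hcC.mono fun m hm h0 => hm (by simp [h0]))
      (hdD.mono fun m hm h0 => hm (by simp [h0]))
      (by
        rw [← Finset.mul_sum, hc1, mul_one, ← Nat.cast_sum, hd1])
      (by
        funext e
        simp only [Finset.sum_apply, Pi.smul_apply, smul_eq_mul]
        rw [← hkt]
        exact_mod_cast (hdw e).symm)
    intro m
    exact ⟨d m, by simpa using congrFun this m⟩

end Integral

end FlowTri

namespace FlowTri

/-! ### Ranks and crossings in framed graphs -/

namespace HalfEdgeGraph.Framing

variable {V D : Type*} {H : HalfEdgeGraph V D} (F : H.Framing)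

lemma not_inLt_self (v : V) (e : D) : ¬ F.InLt v e e := by
  rintro ⟨h, h', hlt⟩
  let := F.inOrder v
  exact lt_irrefl (⟨e, h⟩ : H.In v) hlt

lemma InLt.trans {F : H.Framing} {v : V} {e f g : D} (h : F.InLt v e f) (h' : F.InLt v f g) :
    F.InLt v e g := by
  obtain ⟨he, hf, h⟩ := h
  obtain ⟨hf', hg, h'⟩ := h'
  let := F.inOrder v
  exact ⟨he, hg, lt_trans (a := (⟨e, he⟩ : H.In v)) h h'⟩

lemma inLt_trichotomy {v : V} {e f : D} (he : H.head e = some v) (hf : H.head f = some v) :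
    F.InLt v e f ∨ e = f ∨ F.InLt v f e := by
  let := F.inOrder v
  rcases lt_trichotomy (⟨e, he⟩ : H.In v) ⟨f, hf⟩ with h | h | h
  · exact .inl ⟨he, hf, h⟩
  · exact .inr (.inl (congrArg Subtype.val h))
  · exact .inr (.inr ⟨hf, he, h⟩)

lemma not_outLt_self (v : V) (e : D) : ¬ F.OutLt v e e := by
  rintro ⟨h, h', hlt⟩
  let := F.outOrder v
  exact lt_irrefl (⟨e, h⟩ : H.Out v) hlt

lemma OutLt.trans {F : H.Framing} {v : V} {e f g : D} (h : F.OutLt v e f) (h' : F.OutLt v f g) :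
    F.OutLt v e g := by
  obtain ⟨he, hf, h⟩ := h
  obtain ⟨hf', hg, h'⟩ := h'
  let := F.outOrder v
  exact ⟨he, hg, lt_trans (a := (⟨e, he⟩ : H.Out v)) h h'⟩

lemma outLt_trichotomy {v : V} {e f : D} (he : H.tail e = some v) (hf : H.tail f = some v) :
    F.OutLt v e f ∨ e = f ∨ F.OutLt v f e := by
  let := F.outOrder v
  rcases lt_trichotomy (⟨e, he⟩ : H.Out v) ⟨f, hf⟩ with h | h | h
  · exact .inl ⟨he, hf, h⟩
  · exact .inr (.inl (congrArg Subtype.val h))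
  · exact .inr (.inr ⟨hf, he, h⟩)

/-- The number of edges below `e` at its head. -/
noncomputable def inRank (e : D) : ℕ := Set.ncard {f | ∃ v, F.InLt v f e}

/-- The number of edges below `e` at its tail. -/
noncomputable def outRank (e : D) : ℕ := Set.ncard {f | ∃ v, F.OutLt v f e}

/-- `P` enters a common segment below `Q` and leaves it above `Q`. -/
def Crosses (P Q : List D) : Prop :=
  ∃ (c p p' q q' : List D) (e f g h : D) (v w : V), P = p ++ e :: (c ++ g :: p') ∧
    Q = q ++ f :: (c ++ h :: q') ∧ F.InLt v e f ∧ F.OutLt w h g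

lemma splitsAt_of_isPath {P p q : List D} {e : D} {v : V} (hP : H.IsPath P)
    (h : P = p ++ e :: q) (he : H.head e = some v) : H.SplitsAt v P (p ++ [e]) q := by
  refine ⟨hP.1, by simp [h], by simpa using he, fun d hd => ?_⟩
  cases q with
  | nil => simp at hd
  | cons b q =>
    simp only [List.head?_cons, Option.mem_def, Option.some.injEq] at hd
    subst hd
    have := hP.2
    rw [h] at this
    obtain ⟨u, hu, hu'⟩ := (List.isChain_append_cons_cons.1 this).2.1
    rwa [← he, hu]

/-- A conflict at any vertex extends, backwards and forwards, to a maximal common segment with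
opposite orders at its ends; conversely such a segment gives a conflict at its first vertex. This
removes the vertex from the notion. -/
lemma coherent_iff_not_crosses {P Q : List D} (hP : H.IsPath P) (hQ : H.IsPath Q) :
    F.Coherent P Q ↔ ¬ F.Crosses P Q ∧ ¬ F.Crosses Q P := by
  have key : ∀ {P Q : List D}, H.IsPath P → H.IsPath Q → F.Crosses P Q →
      ∃ v p p' q q', H.SplitsAt v P p p' ∧ H.SplitsAt v Q q q' ∧
        F.InPathLt p q ∧ F.OutPathLt q' p' := by
    rintro P Q hP hQ ⟨c, p, p', q, q', e, f, g, h, v, w, h1, h2, h3, h4⟩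
    exact ⟨v, _, _, _, _, splitsAt_of_isPath hP h1 h3.choose,
      splitsAt_of_isPath hQ h2 h3.choose_spec.choose,
      ⟨v, [], p, q, e, f, rfl, rfl, h3⟩, ⟨w, c, q', p', h, g, rfl, rfl, h4⟩⟩
  have key' : ∀ {P Q p p' q q' : List D} {v : V}, H.SplitsAt v P p p' → H.SplitsAt v Q q q' →
      F.InPathLt p q → F.OutPathLt q' p' → F.Crosses P Q := by
    rintro P Q p p' q q' v ⟨-, rfl, -⟩ ⟨-, rfl, -⟩ ⟨w, c, r, r', e, f, rfl, rfl, h1⟩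
      ⟨u, d, s, s', h, g, rfl, rfl, h2⟩
    exact ⟨c ++ d, r, s', r', s, e, f, g, h, w, u, by simp, by simp, h1, h2⟩
  constructor
  · intro hcoh
    constructor
    · intro hcr
      obtain ⟨v, p, p', q, q', h1, h2, h3, h4⟩ := key hP hQ hcr
      exact hcoh v ⟨p, p', q, q', h1, h2, .inl ⟨h3, h4⟩⟩
    · intro hcr
      obtain ⟨v, p, p', q, q', h1, h2, h3, h4⟩ := key hQ hP hcr
      exact hcoh v ⟨q, q', p, p', h2, h1, .inr ⟨h3, h4⟩⟩
  · rintro ⟨h1, h2⟩ v ⟨p, p', q, q', h3, h4, ⟨h5, h6⟩ | ⟨h5, h6⟩⟩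
    · exact h1 (key' h3 h4 h5 h6)
    · exact h2 (key' h4 h3 h5 h6)

variable [Finite D]

lemma InLt.inRank_lt {F : H.Framing} {v : V} {e f : D} (h : F.InLt v e f) :
    F.inRank e < F.inRank f := by
  refine Set.ncard_lt_ncard ⟨?_, fun hsub => ?_⟩ (Set.toFinite _)
  · rintro d ⟨w, hw⟩
    have : w = v := by
      obtain ⟨-, h1, -⟩ := hw
      obtain ⟨h2, -, -⟩ := h
      exact Option.some_injective _ (h1.symm.trans h2)
    subst this
    exact ⟨w, hw.trans h⟩
  · obtain ⟨w, hw⟩ := hsub ⟨v, h⟩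
    exact F.not_inLt_self w e hw

lemma OutLt.outRank_lt {F : H.Framing} {v : V} {e f : D} (h : F.OutLt v e f) :
    F.outRank e < F.outRank f := by
  refine Set.ncard_lt_ncard ⟨?_, fun hsub => ?_⟩ (Set.toFinite _)
  · rintro d ⟨w, hw⟩
    have : w = v := by
      obtain ⟨-, h1, -⟩ := hw
      obtain ⟨h2, -, -⟩ := h
      exact Option.some_injective _ (h1.symm.trans h2)
    subst this
    exact ⟨w, hw.trans h⟩
  · obtain ⟨w, hw⟩ := hsub ⟨v, h⟩
    exact F.not_outLt_self w e hw

lemma inRank_lt_iff {v : V} {e f : D} (he : H.head e = some v) (hf : H.head f = some v) :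
    F.inRank e < F.inRank f ↔ F.InLt v e f := by
  refine ⟨fun h => ?_, InLt.inRank_lt⟩
  rcases F.inLt_trichotomy he hf with h' | rfl | h'
  · exact h'
  · exact absurd h (lt_irrefl _)
  · exact absurd h h'.inRank_lt.asymm

lemma outRank_lt_iff {v : V} {e f : D} (he : H.tail e = some v) (hf : H.tail f = some v) :
    F.outRank e < F.outRank f ↔ F.OutLt v e f := by
  refine ⟨fun h => ?_, OutLt.outRank_lt⟩
  rcases F.outLt_trichotomy he hf with h' | rfl | h'
  · exact h'
  · exact absurd h (lt_irrefl _)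
  · exact absurd h h'.outRank_lt.asymm

end HalfEdgeGraph.Framing

/-! ### The ranked network of an augmented graph -/

namespace HatEdge

/-- Edges of an augmented graph are edges, inflow half-edges or the outflow half-edge. -/
def equivSum (E X : Type*) : E ⊕ X ⊕ Unit ≃ HatEdge E X where
  toFun
    | .inl e => .edge e
    | .inr (.inl x) => .inflow x
    | .inr (.inr _) => .outflow
  invFun
    | .edge e => .inl e
    | .inflow x => .inr (.inl x)
    | .outflow => .inr (.inr ())
  left_inv := by rintro (e | x | _) <;> rfl
  right_inv := by rintro (e | x | _) <;> rfl

instance {E X : Type*} [Fintype E] [Fintype X] : Fintype (HatEdge E X) :=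
  Fintype.ofEquiv _ (equivSum E X)

lemma sum_eq {E X A : Type*} [Fintype E] [Fintype X] [AddCommMonoid A] (f : HatEdge E X → A) :
    ∑ d, f d = ∑ e, f (.edge e) + (∑ x, f (.inflow x) + f .outflow) := by
  rw [← (equivSum E X).sum_comp f]
  simp [equivSum]

end HatEdge

namespace AugmentedGraph

variable {n : ℕ} {E : Type*} {G : FlowGraph n E} {a : Fin (n + 1) → ℤ} {X : Type*} [Fintype X]
  {Ghat : AugmentedGraph G a X} [Fintype E] (Fhat : Ghat.toHalf.Framing)

/-- The ranked network of a framed augmented graph. -/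
noncomputable def net : RankedNet (HatEdge E X) X where
  -- Vertex `v` gets the number `v + 1`, leaving 0 for missing tails and `n + 2` for missing heads.
  tl e := (Ghat.toHalf.tail e).elim 0 fun v => v + 1
  hd e := (Ghat.toHalf.head e).elim (n + 2) fun v => v + 1
  inRank := Fhat.inRank
  outRank := Fhat.outRank
  top := n + 2
  src := .inflow
  tl_lt_hd
    | .edge e => by simpa [toHalf] using G.tail_lt_head e
    | .inflow x => by simp [toHalf]
    | .outflow => by simp [toHalf]
  hd_le_top
    | .edge e => by simp [toHalf]
    | .inflow x => by simp [toHalf]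
    | .outflow => by simp [toHalf]
  tl_src x := rfl
  src_injective x y h := by simpa using h
  exists_src
    | .edge e => by simp [toHalf]
    | .inflow x => by simp
    | .outflow => by simp [toHalf]
  inRank_inj e f h h' := by
    cases he : Ghat.toHalf.head e with
    | none =>
      cases hf : Ghat.toHalf.head f with
      | none => cases e <;> cases f <;> simp_all [toHalf]
      | some w => simp [he, hf] at h; omega
    | some v =>
      cases hf : Ghat.toHalf.head f with
      | none => simp [he, hf] at h; omega
      | some w =>
        have hvw : v = w := by simp [he, hf] at h; omega
        subst hvw
        rcases Fhat.inLt_trichotomy he hf with h1 | h1 | h1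
        · exact absurd h' h1.inRank_lt.ne
        · exact h1
        · exact absurd h' h1.inRank_lt.ne'
  outRank_inj e f h h0 h' := by
    cases he : Ghat.toHalf.tail e with
    | none => simp [he] at h0
    | some v =>
      cases hf : Ghat.toHalf.tail f with
      | none => simp [he, hf] at h
      | some w =>
        have hvw : v = w := by simp [he, hf] at h; omega
        subst hvw
        rcases Fhat.outLt_trichotomy he hf with h1 | h1 | h1
        · exact absurd h' h1.outRank_lt.ne
        · exact h1
        · exact absurd h' h1.outRank_lt.ne'

@[simp] lemma net_top : (net Fhat).top = n + 2 := rfl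
@[simp] lemma net_src (x : X) : (net Fhat).src x = .inflow x := rfl
@[simp] lemma net_tl_edge (e : E) : (net Fhat).tl (.edge e) = G.tail e + 1 := rfl
@[simp] lemma net_tl_inflow (x : X) : (net Fhat).tl (.inflow x) = 0 := rfl
@[simp] lemma net_tl_outflow : (net Fhat).tl .outflow = n + 1 := rfl
@[simp] lemma net_hd_edge (e : E) : (net Fhat).hd (.edge e) = G.head e + 1 := rfl
@[simp] lemma net_hd_inflow (x : X) : (net Fhat).hd (.inflow x) = Ghat.foot x + 1 := rfl
@[simp] lemma net_hd_outflow : (net Fhat).hd .outflow = n + 2 := rfl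

lemma net_tl_eq_add_one_iff {e : HatEdge E X} {v : Fin (n + 1)} :
    (net Fhat).tl e = v + 1 ↔ Ghat.toHalf.tail e = some v := by
  cases e with
  | edge e => simp [toHalf, Fin.ext_iff]
  | inflow x => simp [toHalf]
  | outflow =>
    simp only [net_tl_outflow, toHalf, Option.some.injEq, Fin.ext_iff, Fin.val_last]
    omega

lemma net_hd_eq_add_one_iff {e : HatEdge E X} {v : Fin (n + 1)} :
    (net Fhat).hd e = v + 1 ↔ Ghat.toHalf.head e = some v := by
  cases e with
  | edge e => simp [toHalf, Fin.ext_iff]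
  | inflow x => simp [toHalf, Fin.ext_iff]
  | outflow =>
    simp only [net_hd_outflow, toHalf, reduceCtorEq, iff_false]
    omega

lemma net_hd_eq_top_iff {e : HatEdge E X} : (net Fhat).hd e = n + 2 ↔ e = .outflow := by
  cases e <;> simp <;> omega

lemma net_adj_iff {e f : HatEdge E X} : (net Fhat).hd e = (net Fhat).tl f ↔
    ∃ v, Ghat.toHalf.head e = some v ∧ Ghat.toHalf.tail f = some v := by
  simp only [← net_tl_eq_add_one_iff Fhat, ← net_hd_eq_add_one_iff Fhat]
  constructor
  · intro h
    have h1 := (net Fhat).tl_lt_hd e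
    have h2 := (net Fhat).tl_lt_hd f
    have h3 := (net Fhat).hd_le_top f
    rw [net_top] at h3
    exact ⟨⟨(net Fhat).hd e - 1, by omega⟩, by simp; omega, by simp; omega⟩
  · rintro ⟨v, h1, h2⟩
    omega

lemma net_inRank_lt_iff {e f : HatEdge E X} : (net Fhat).hd e = (net Fhat).hd f ∧
    (net Fhat).inRank e < (net Fhat).inRank f ↔ ∃ v, Fhat.InLt v e f := by
  constructor
  · rintro ⟨h1, h2⟩
    have hne : (net Fhat).hd e ≠ n + 2 := by
      intro h
      have he := (net_hd_eq_top_iff Fhat).1 h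
      have hf := (net_hd_eq_top_iff Fhat).1 (h1 ▸ h)
      rw [he, hf] at h2
      exact lt_irrefl _ h2
    have h3 := (net Fhat).tl_lt_hd e
    have h4 := (net Fhat).hd_le_top e
    rw [net_top] at h4
    obtain ⟨v, hv⟩ : ∃ v : Fin (n + 1), (net Fhat).hd e = v + 1 :=
      ⟨⟨(net Fhat).hd e - 1, by omega⟩, by simp; omega⟩
    exact ⟨v, (Fhat.inRank_lt_iff ((net_hd_eq_add_one_iff Fhat).1 hv)
      ((net_hd_eq_add_one_iff Fhat).1 (h1 ▸ hv))).1 h2⟩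
  · rintro ⟨v, h⟩
    refine ⟨?_, h.inRank_lt⟩
    obtain ⟨he, hf, -⟩ := h
    rw [(net_hd_eq_add_one_iff Fhat).2 he, (net_hd_eq_add_one_iff Fhat).2 hf]

lemma net_outRank_lt_iff {e f : HatEdge E X} : (net Fhat).tl e = (net Fhat).tl f ∧
    (net Fhat).outRank e < (net Fhat).outRank f ↔ ∃ v, Fhat.OutLt v e f := by
  constructor
  · rintro ⟨h1, h2⟩
    rcases Nat.eq_zero_or_pos ((net Fhat).tl f) with h0 | h0
    -- Half-edges without tail have out-rank 0, so nothing is strictly below them.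
    · exfalso
      have : (net Fhat).outRank f = 0 := by
        have : {d | ∃ v, Fhat.OutLt v d f} = ∅ := by
          ext d
          simp only [Set.mem_ofPred_eq, Set.mem_empty_iff_false, iff_false, not_exists]
          rintro v ⟨-, hf, -⟩
          rw [← net_tl_eq_add_one_iff Fhat] at hf
          omega
        change Set.ncard _ = 0
        rw [this, Set.ncard_empty]
      omega
    · have h3 := (net Fhat).tl_lt_hd f
      have h4 := (net Fhat).hd_le_top f
      rw [net_top] at h4
      obtain ⟨v, hv⟩ : ∃ v : Fin (n + 1), (net Fhat).tl f = v + 1 :=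
        ⟨⟨(net Fhat).tl f - 1, by omega⟩, by simp; omega⟩
      exact ⟨v, (Fhat.outRank_lt_iff ((net_tl_eq_add_one_iff Fhat).1 (h1.trans hv))
        ((net_tl_eq_add_one_iff Fhat).1 hv)).1 h2⟩
  · rintro ⟨v, h⟩
    refine ⟨?_, h.outRank_lt⟩
    obtain ⟨he, hf, -⟩ := h
    rw [(net_tl_eq_add_one_iff Fhat).2 he, (net_tl_eq_add_one_iff Fhat).2 hf]

lemma net_crossing_iff {P Q : List (HatEdge E X)} :
    (net Fhat).Crossing P Q ↔ Fhat.Crosses P Q := by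
  constructor
  · rintro ⟨c, p, p', q, q', e, f, g, h, h1, h2, h3, h4, h5, h6⟩
    obtain ⟨v, hv⟩ := (net_inRank_lt_iff Fhat).1 ⟨h3, h4⟩
    obtain ⟨w, hw⟩ := (net_outRank_lt_iff Fhat).1 ⟨h5.symm, h6⟩
    exact ⟨c, p, p', q, q', e, f, g, h, v, w, h1, h2, hv, hw⟩
  · rintro ⟨c, p, p', q, q', e, f, g, h, v, w, h1, h2, hv, hw⟩
    obtain ⟨h3, h4⟩ := (net_inRank_lt_iff Fhat).2 ⟨v, hv⟩
    obtain ⟨h5, h6⟩ := (net_outRank_lt_iff Fhat).2 ⟨w, hw⟩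
    exact ⟨c, p, p', q, q', e, f, g, h, h1, h2, h3, h4, h5.symm, h6⟩

lemma net_below_iff {P Q : List (HatEdge E X)} :
    (net Fhat).Below P Q ↔ Fhat.OutPathLt P Q := by
  constructor
  · rintro ⟨c, p, q, e, f, h1, h2, h3, h4⟩
    obtain ⟨v, hv⟩ := (net_outRank_lt_iff Fhat).1 ⟨h3, h4⟩
    exact ⟨v, c, p, q, e, f, h1, h2, hv⟩
  · rintro ⟨v, c, p, q, e, f, h1, h2, hv⟩
    obtain ⟨h3, h4⟩ := (net_outRank_lt_iff Fhat).2 ⟨v, hv⟩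
    exact ⟨c, p, q, e, f, h1, h2, h3, h4⟩

lemma isPath_iff_isWalk {P : List (HatEdge E X)} :
    Ghat.toHalf.IsPath P ↔ P ≠ [] ∧ (net Fhat).IsWalk P := by
  unfold HalfEdgeGraph.IsPath RankedNet.IsWalk
  simp only [net_adj_iff]

lemma net_isRoute_iff {x : X} {P : List (HatEdge E X)} : (net Fhat).IsRoute x P ↔
    Ghat.toHalf.IsPath P ∧ P.head? = some (.inflow x) ∧ P.getLast? = some .outflow := by
  rw [isPath_iff_isWalk Fhat]
  constructor
  · rintro ⟨h1, h2, p, e, rfl, he⟩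
    have : e = .outflow := (net_hd_eq_top_iff Fhat).1 he
    exact ⟨⟨by simp, h2⟩, h1, by simp [this]⟩
  · rintro ⟨⟨h1, h2⟩, h3, h4⟩
    refine ⟨h3, h2, P.dropLast, .outflow, ?_, rfl⟩
    obtain ⟨p, rfl⟩ := List.getLast?_eq_some_iff.1 h4
    simp

end AugmentedGraph

end FlowTri

namespace FlowTri

/-! ### Comparison of routes from one source, and conservation along a route -/

namespace RankedNet

variable {D X : Type*} {N : RankedNet D X} {P Q : List D} {x : X}

/-- Being below is compatible with the lexicographic order of the lists of out-ranks, a linear order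
from which irreflexivity and transitivity can be borrowed. -/
lemma Below.map_lt (h : N.Below P Q) : P.map N.outRank < Q.map N.outRank := by
  obtain ⟨c, p, q, e, f, rfl, rfl, -, h⟩ := h
  induction c with
  | nil => exact List.Lex.rel h
  | cons a c ih => exact List.Lex.cons ih

lemma not_below_self (P : List D) : ¬ N.Below P P := fun h => lt_irrefl _ h.map_lt

/-- Nothing leaves the top, so neither route is a proper initial segment of the other; where they
diverge, past the common source edge, the out-ranks differ. -/
lemma IsRoute.eq_or_below (hP : N.IsRoute x P) (hQ : N.IsRoute x Q) :
    P = Q ∨ N.Below P Q ∨ N.Below Q P := by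
  have top_ne : ∀ e, N.tl e ≠ N.top := fun e h => by
    have := N.tl_lt_hd e; have := N.hd_le_top e; omega
  have key : ∀ {P Q : List D} (a : D), N.IsWalk (a :: P) → N.IsWalk (a :: Q) →
      (∃ p e, a :: P = p ++ [e] ∧ N.hd e = N.top) → (∃ q e, a :: Q = q ++ [e] ∧ N.hd e = N.top) →
      P = Q ∨ N.Below P Q ∨ N.Below Q P := by
    intro P
    induction P with
    | nil =>
      rintro Q a hP hQ ⟨p, e, hp, he⟩ -
      have : a = e := by
        cases p with
        | nil => simpa using hp
        | cons b p => simp at hp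
      subst this
      cases Q with
      | nil => exact .inl rfl
      | cons b Q => exact absurd ((List.isChain_cons_cons.1 hQ).1.symm.trans he) (top_ne b)
    | cons b P ih =>
      rintro Q a hP hQ ⟨p, e, hp, he⟩ ⟨q, f, hq, hf⟩
      cases Q with
      | nil =>
        have : a = f := by
          cases q with
          | nil => simpa using hq
          | cons b q => simp at hq
        subst this
        exact absurd ((List.isChain_cons_cons.1 hP).1.symm.trans hf) (top_ne b)
      | cons b' Q =>
        have h1 := List.isChain_cons_cons.1 hP
        have h2 := List.isChain_cons_cons.1 hQ
        by_cases hbb : b = b'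
        · subst hbb
          have tl_last : ∀ {R r : List D} {a e : D}, a :: b :: R = r ++ [e] → N.hd e = N.top →
              ∃ r e, b :: R = r ++ [e] ∧ N.hd e = N.top := by
            intro R r a e hr he
            cases r with
            | nil => simp at hr
            | cons c r => exact ⟨r, e, by simpa using (List.cons.inj hr).2, he⟩
          rcases ih b h1.2 h2.2 (tl_last hp he) (tl_last hq hf) with
            rfl | ⟨c, p', q', g, h, rfl, rfl, h3⟩ | ⟨c, p', q', g, h, rfl, rfl, h3⟩
          · exact .inl rfl
          · exact .inr (.inl ⟨b :: c, p', q', g, h, rfl, rfl, h3⟩)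
          · exact .inr (.inr ⟨b :: c, p', q', g, h, rfl, rfl, h3⟩)
        · have h3 : N.tl b = N.tl b' := h1.1.symm.trans h2.1
          rcases lt_trichotomy (N.outRank b) (N.outRank b') with h4 | h4 | h4
          · exact .inr (.inl ⟨[], P, Q, b, b', rfl, rfl, h3, h4⟩)
          · refine absurd (N.outRank_inj b b' h3 ?_ h4) hbb
            rw [← h1.1]
            exact (Nat.zero_le _).trans_lt (N.tl_lt_hd a)
          · exact .inr (.inr ⟨[], Q, P, b', b, rfl, rfl, h3.symm, h4⟩)
  obtain ⟨p, rfl⟩ := hP.exists_eq_cons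
  obtain ⟨q, rfl⟩ := hQ.exists_eq_cons
  rcases key _ hP.walk hQ.walk hP.last hQ.last with
    rfl | ⟨c, p', q', g, h, rfl, rfl, h3⟩ | ⟨c, p', q', g, h, rfl, rfl, h3⟩
  · exact .inl rfl
  · exact .inr (.inl ⟨_ :: c, p', q', g, h, rfl, rfl, h3⟩)
  · exact .inr (.inr ⟨_ :: c, p', q', g, h, rfl, rfl, h3⟩)

/-- Each edge ends where the next begins. Comparing the two lists shows that a route enters every
inner vertex as often as it leaves it. -/
lemma IsRoute.map_hd (hP : N.IsRoute x P) : P.map N.hd = (P.map N.tl).tail ++ [N.top] := by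
  have key : ∀ {P : List D} (a : D), N.IsWalk (a :: P) →
      (∃ p e, a :: P = p ++ [e] ∧ N.hd e = N.top) → (a :: P).map N.hd = P.map N.tl ++ [N.top] := by
    intro P
    induction P with
    | nil =>
      rintro a - ⟨p, e, hp, he⟩
      have : a = e := by
        cases p with
        | nil => simpa using hp
        | cons b p => simp at hp
      simp [this, he]
    | cons b P ih =>
      rintro a hP ⟨p, e, hp, he⟩
      have h1 := List.isChain_cons_cons.1 hP
      rw [List.map_cons, ih b h1.2, h1.1]
      · simp
      · cases p with
        | nil => simp at hp
        | cons c p => exact ⟨p, e, by simpa using (List.cons.inj hp).2, he⟩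
  obtain ⟨p, rfl⟩ := hP.exists_eq_cons
  simpa using key _ hP.walk hP.last

open Classical in
/-- The indicator function of a route is conserved. -/
lemma IsRoute.conserved [Fintype D] (hP : N.IsRoute x P) :
    N.Conserved fun e => if e ∈ P then 1 else 0 := by
  intro v hv0 hvtop
  have key : ∀ f : D → ℕ, ∑ e with f e = v, (if e ∈ P then 1 else 0) = (P.map f).count v := by
    intro f
    rw [← Finset.sum_filter, Finset.filter_filter, Finset.sum_const, smul_eq_mul, mul_one,
      List.count, List.countP_map, List.countP_eq_length_filter,
      ← List.toFinset_card_of_nodup (hP.walk.nodup.filter _)]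
    congr 1
    ext e
    simp [and_comm]
  rw [key, key, hP.map_hd]
  obtain ⟨p, hp⟩ := hP.exists_eq_cons
  rw [hp]
  simp only [List.map_cons, List.tail_cons, List.count_append, List.count_cons, List.count_nil,
    N.tl_src, beq_iff_eq]
  rw [if_neg (by omega), if_neg (by omega)]

end RankedNet

/-! ### Cliques of route matchings as ordered families of routes -/

namespace AugmentedGraph

variable {n : ℕ} {E : Type*} {G : FlowGraph n E} {a : Fin (n + 1) → ℤ} {X : Type*} [Fintype X]
  {Ghat : AugmentedGraph G a X} {Fhat : Ghat.toHalf.Framing}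

namespace RouteMatching

lemma ext_route {P Q : RouteMatching Fhat} (h : P.route = Q.route) : P = Q := by
  cases P; cases Q; cases h; rfl

open Classical in
/-- The number of routes of a route matching through an edge. -/
noncomputable def count (P : RouteMatching Fhat) (e : E) : ℕ :=
  ∑ x, if HatEdge.edge e ∈ P.route x then 1 else 0

lemma flow_eq_count (P : RouteMatching Fhat) : P.flow = fun e => (P.count e : ℝ) := by
  classical
  funext e
  simp [flow, count, edgeIndicator, Set.indicator_apply, Finset.sum_apply]

open Classical in
lemma card_mem_edge {k : ℕ} (L : Fin k → RouteMatching Fhat) (e : E) :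
    (Finset.univ.filter fun t : X × Fin k => HatEdge.edge e ∈ (L t.2).route t.1).card =
      ∑ i, (L i).count e := by
  rw [Finset.card_filter, Fintype.sum_prod_type_right]
  rfl

variable [Fintype E]

lemma isRoute (P : RouteMatching Fhat) (x : X) : (net Fhat).IsRoute x (P.route x) :=
  (net_isRoute_iff Fhat).2 ⟨P.isPath x, P.head_route x, P.last_route x⟩

/-- Routes repeat no edge, and a finite set carries only finitely many lists without repetition. -/
instance : Finite (RouteMatching Fhat) := by
  classical
  let f : RouteMatching Fhat → X → {l : List (HatEdge E X) // l.Nodup} :=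
    fun P x => ⟨P.route x, (P.isRoute x).walk.nodup⟩
  refine Finite.of_injective f fun P Q h => ext_route (funext fun x => ?_)
  exact congrArg Subtype.val (congrFun h x)

noncomputable instance : Fintype (RouteMatching Fhat) := Fintype.ofFinite _

lemma routeLt_iff_below {P Q : RouteMatching Fhat} {x : X} :
    P.RouteLt Q x ↔ (net Fhat).Below (P.route x) (Q.route x) := by
  unfold RouteLt
  rw [← net_below_iff]
  obtain ⟨p, hp⟩ := (P.isRoute x).exists_eq_cons
  obtain ⟨q, hq⟩ := (Q.isRoute x).exists_eq_cons
  rw [hp, hq]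
  simp only [List.tail_cons]
  constructor
  · rintro ⟨c, p', q', e, f, rfl, rfl, h⟩
    exact ⟨_ :: c, p', q', e, f, rfl, rfl, h⟩
  · rintro ⟨c, p', q', e, f, h1, h2, h⟩
    cases c with
    | nil =>
      simp only [List.nil_append, List.cons.injEq] at h1 h2
      rw [← h1.1, ← h2.1] at h
      exact absurd h.2 (lt_irrefl _)
    | cons b c =>
      simp only [List.cons_append, List.cons.injEq] at h1 h2
      exact ⟨c, p', q', e, f, h1.2, h2.2, h⟩

lemma locallyCoherent_iff {P Q : RouteMatching Fhat} : P.LocallyCoherent Q ↔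
    ∀ x y, ¬ (net Fhat).Crossing (P.route x) (Q.route y) ∧
      ¬ (net Fhat).Crossing (Q.route y) (P.route x) := by
  simp only [net_crossing_iff]
  constructor
  · intro h x y
    exact (Fhat.coherent_iff_not_crosses (P.isPath x) (Q.isPath y)).1
      (h _ (.inl ⟨x, rfl⟩) _ (.inr ⟨y, rfl⟩))
  · intro h
    have h1 : ∀ x y, Fhat.Coherent (P.route x) (Q.route y) := fun x y =>
      (Fhat.coherent_iff_not_crosses (P.isPath x) (Q.isPath y)).2 (h x y)
    have h2 : ∀ x y, Fhat.Coherent (Q.route x) (P.route y) := fun x y =>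
      (Fhat.coherent_iff_not_crosses (Q.isPath x) (P.isPath y)).2 (h y x).symm
    rintro _ (⟨x, rfl⟩ | ⟨x, rfl⟩) _ (⟨y, rfl⟩ | ⟨y, rfl⟩)
    · exact P.coherent _ ⟨x, rfl⟩ _ ⟨y, rfl⟩
    · exact h1 x y
    · exact h2 x y
    · exact Q.coherent _ ⟨x, rfl⟩ _ ⟨y, rfl⟩

lemma coherent_refl (P : RouteMatching Fhat) : P.Coherent P := by
  refine ⟨?_, ?_⟩
  · unfold LocallyCoherent
    rw [Set.union_self]
    exact P.coherent
  · rintro x x' ⟨-, h, -⟩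
    exact RankedNet.not_below_self _ (routeLt_iff_below.1 h)

open Classical in
/-- A potential that increases along every clique. -/
noncomputable def potential (P : RouteMatching Fhat) : ℕ :=
  ∑ x, (Finset.univ.filter fun Q : RouteMatching Fhat =>
    (Q.route x).map (net Fhat).outRank < (P.route x).map (net Fhat).outRank).card

/-- If `Q` were below `P` at `x`, the absence of global conflicts would put `Q` weakly below `P` at
every source. Then no summand of the potential grows from `P` to `Q`, and the one at `x` drops
because `Q` itself is counted for `P` only. -/
lemma not_routeLt_of_potential_le {P Q : RouteMatching Fhat} (h : P.Coherent Q)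
    (hPQ : P.potential ≤ Q.potential) (x : X) : ¬ Q.RouteLt P x := by
  classical
  intro hx
  have hstrict : ∀ {y}, Q.RouteLt P y →
      (Q.route y).map (net Fhat).outRank < (P.route y).map (net Fhat).outRank :=
    fun h => (routeLt_iff_below.1 h).map_lt
  have hle : ∀ y, (Q.route y).map (net Fhat).outRank ≤ (P.route y).map (net Fhat).outRank := by
    intro y
    by_cases hyx : y = x
    · exact hyx ▸ (hstrict hx).le
    · rcases (P.isRoute y).eq_or_below (Q.isRoute y) with h1 | h1 | h1
      · rw [h1]
      · exact absurd ⟨hyx, routeLt_iff_below.2 h1, hx⟩ (h.2 y x)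
      · exact h1.map_lt.le
  apply absurd hPQ
  rw [not_le]
  refine Finset.sum_lt_sum (fun y _ => Finset.card_le_card ?_) ⟨x, Finset.mem_univ x,
    Finset.card_lt_card ?_⟩
  · intro R hR
    simp only [Finset.mem_filter, Finset.mem_univ, true_and] at hR ⊢
    exact hR.trans_le (hle y)
  · rw [Finset.ssubset_iff_of_subset]
    · exact ⟨Q, by simpa using hstrict hx, by simp⟩
    · intro R hR
      simp only [Finset.mem_filter, Finset.mem_univ, true_and] at hR ⊢
      exact hR.trans_le (hle x)

/-- A sequence of route matchings in which the routes from each source increase. -/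
structure IsOrdered {k : ℕ} (L : Fin k → RouteMatching Fhat) : Prop where
  coherent : ∀ i j, (L i).Coherent (L j)
  not_routeLt : ∀ i j, i < j → ∀ x, ¬ (L j).RouteLt (L i) x

-- The clique is listed with multiplicities and sorted by the potential; ties do no harm, as a weak
-- inequality of potentials already excludes inversions.
open Classical in
lemma exists_isOrdered {c : RouteMatching Fhat → ℕ}
    (hc : PairwiseCoherent Coherent (Function.support c)) :
    ∃ L : Fin (∑ P, c P) → RouteMatching Fhat, IsOrdered L ∧
      ∀ P, (Finset.univ.filter fun i => L i = P).card = c P := by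
  let T := Σ P : RouteMatching Fhat, Fin (c P)
  have hT : Fintype.card T = ∑ P, c P := by simp [T]
  let e : Fin (∑ P, c P) ≃ T := (Fintype.equivFinOfCardEq hT).symm
  let σ := Tuple.sort fun i => (e i).1.potential
  have hσ : Monotone fun i => (e (σ i)).1.potential :=
    Tuple.monotone_sort fun i => (e i).1.potential
  have hmem : ∀ t : T, t.1 ∈ Function.support c := fun t h => by
    have := t.2.2
    omega
  refine ⟨fun i => (e (σ i)).1, ⟨fun i j => hc _ (hmem _) _ (hmem _), fun i j hij x =>
    not_routeLt_of_potential_le (hc _ (hmem _) _ (hmem _)) (hσ hij.le) x⟩, fun P => ?_⟩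
  have h1 : (Finset.univ.filter fun i => (e (σ i)).1 = P).card =
      (Finset.univ.filter fun t : T => t.1 = P).card := by
    refine Finset.card_equiv (σ.trans e) fun i => ?_
    simp
  rw [h1, ← Fintype.card_subtype]
  rw [Fintype.card_congr (Equiv.sigmaSubtype (β := fun P => Fin (c P)) P), Fintype.card_fin]

lemma IsOrdered.isOrderedFamily {k : ℕ} {L : Fin k → RouteMatching Fhat} (hL : IsOrdered L) :
    (net Fhat).IsOrderedFamily fun x i => (L i).route x where
  route x i := (L i).isRoute x
  not_crossing x i y j := (locallyCoherent_iff.1 (hL.coherent i j).1 x y).1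
  not_below x i j hij h := hL.not_routeLt i j hij x (routeLt_iff_below.2 h)

/-- The i-th routes of all sources form the i-th matching. A global conflict needs opposite strict
orders at two sources, but for `i < j` no route of the j-th matching is below the corresponding one
of the i-th. -/
lemma exists_isOrdered_of_isOrderedFamily {k : ℕ} {R : X → Fin k → List (HatEdge E X)}
    (hR : (net Fhat).IsOrderedFamily R) :
    ∃ L : Fin k → RouteMatching Fhat, IsOrdered L ∧ ∀ x i, (L i).route x = R x i := by
  have hpath := fun x i => (net_isRoute_iff Fhat).1 (hR.route x i)
  let L : Fin k → RouteMatching Fhat := fun i =>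
    { route := fun x => R x i
      isPath := fun x => (hpath x i).1
      head_route := fun x => (hpath x i).2.1
      last_route := fun x => (hpath x i).2.2
      coherent := by
        rintro _ ⟨x, rfl⟩ _ ⟨y, rfl⟩
        rw [Fhat.coherent_iff_not_crosses (hpath x i).1 (hpath y i).1, ← net_crossing_iff,
          ← net_crossing_iff]
        exact ⟨hR.not_crossing x i y i, hR.not_crossing y i x i⟩ }
  have hlt : ∀ i j, i < j → ∀ x, ¬ (L j).RouteLt (L i) x := fun i j hij x h =>
    hR.not_below x i j hij (routeLt_iff_below.1 h)
  refine ⟨L, ⟨fun i j => ⟨locallyCoherent_iff.2 fun x y =>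
    ⟨hR.not_crossing x i y j, hR.not_crossing y j x i⟩, ?_⟩, hlt⟩, fun _ _ => rfl⟩
  rintro x x' ⟨-, h1, h2⟩
  rcases lt_trichotomy i j with h | h | h
  · exact hlt i j h x' h2
  · subst h
    exact (coherent_refl (L i)).2 x x' ⟨by
      rintro rfl
      exact RankedNet.not_below_self _ (routeLt_iff_below.1 h1), h1, h2⟩
  · exact hlt j i h x h1

open Classical in
lemma sum_mul_count {k : ℕ} (L : Fin k → RouteMatching Fhat) (e : E) :
    ∑ P, (Finset.univ.filter fun i => L i = P).card * P.count e = ∑ i, (L i).count e := by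
  rw [← Finset.sum_fiberwise Finset.univ L fun i => (L i).count e]
  refine Finset.sum_congr rfl fun P _ => ?_
  rw [← smul_eq_mul, ← Finset.sum_const]
  refine Finset.sum_congr rfl fun i hi => ?_
  rw [(Finset.mem_filter.1 hi).2]

/-- The multiplicities of the elements of a clique are determined by the total flow. -/
lemma multiplicities_unique (c d : RouteMatching Fhat → ℕ)
    (hc : PairwiseCoherent Coherent (Function.support c))
    (hd : PairwiseCoherent Coherent (Function.support d)) (hcd : ∑ P, c P = ∑ P, d P)
    (hflow : ∀ e, ∑ P, c P * P.count e = ∑ P, d P * P.count e) : c = d := by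
  classical
  obtain ⟨L, hL, hLc⟩ := exists_isOrdered hc
  obtain ⟨L', hL', hLd⟩ := exists_isOrdered hd
  -- The two sequences have to be indexed by the same type before they can be compared.
  generalize hk : ∑ P, c P = k at L hcd
  subst hcd
  have : L = L' := by
    have hR := hL.isOrderedFamily.unique hL'.isOrderedFamily fun e => by
      cases e with
      | edge e =>
        rw [card_mem_edge, card_mem_edge, ← sum_mul_count, ← sum_mul_count]
        simp only [hLc, hLd]
        exact hflow e
      -- The counts on half-edges agree automatically: an inflow half-edge lies on exactly the
      -- routes of its own source, and the outflow half-edge on all routes.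
      | inflow x' =>
        congr 1
        ext ⟨x, i⟩
        have key : ∀ P : RouteMatching Fhat, HatEdge.inflow x' ∈ P.route x ↔ x = x' := by
          intro P
          constructor
          · intro h
            have := (P.isRoute x).eq_src h rfl
            simpa using this.symm
          · rintro rfl
            obtain ⟨q, hq⟩ := (P.isRoute x).exists_eq_cons
            rw [hq]; simp
        simp [key]
      | outflow =>
        congr 1
        ext ⟨x, i⟩
        have key : ∀ P : RouteMatching Fhat, HatEdge.outflow ∈ P.route x := fun P =>
          List.mem_of_getLast? (P.last_route x)
        simp [key]
    funext i
    exact ext_route (funext fun x => congrFun (congrFun hR x) i)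
  funext P
  rw [← hLc, ← hLd, this]

end RouteMatching

end AugmentedGraph

end FlowTri

namespace FlowTri

/-! ### The flow polytope -/

namespace FlowGraph

variable {n : ℕ} {E : Type*} (G : FlowGraph n E)

/-- The incidence matrix: heads count positively and tails negatively. -/
def incidence (v : Fin (n + 1)) (e : E) : ℤ :=
  (if G.head e = v then 1 else 0) - if G.tail e = v then 1 else 0

lemma flowPolytope_eq [Fintype E] (a : Fin (n + 1) → ℤ) : G.flowPolytope a =
    {φ | (∀ e, 0 ≤ φ e) ∧ ∀ v, (a v : ℝ) + ∑ e, (G.incidence v e : ℝ) * φ e = 0} := by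
  ext φ
  refine and_congr Iff.rfl (forall_congr' fun v => ?_)
  have : ∑ e, (G.incidence v e : ℝ) * φ e =
      ∑ e with G.head e = v, φ e - ∑ e with G.tail e = v, φ e := by
    rw [Finset.sum_filter, Finset.sum_filter, ← Finset.sum_sub_distrib]
    refine Finset.sum_congr rfl fun e _ => ?_
    unfold incidence
    push_cast
    split_ifs <;> simp
  rw [this, ← add_sub_assoc, sub_eq_zero]

/-- There is a unit flow from every vertex to the sink. -/
lemma exists_unit_flow [Fintype E] (v : Fin (n + 1)) : ∃ φ : E → ℕ, ∀ u,
    (if v = u then 1 else 0) + ∑ e, G.incidence u e * (φ e : ℤ) =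
      if Fin.last n = u then 1 else 0 := by
  classical
  -- Descending from the sink, the unit is sent along one outgoing edge and then along the flow
  -- already found from its head.
  induction v using WellFoundedGT.induction with
  | _ v ih =>
    by_cases hv : v = Fin.last n
    · exact ⟨0, fun u => by simp [hv]⟩
    · obtain ⟨e, rfl⟩ := G.exists_out v hv
      obtain ⟨φ, hφ⟩ := ih (G.head e) (G.tail_lt_head e)
      refine ⟨φ + Pi.single e 1, fun u => ?_⟩
      rw [← hφ u]
      simp only [Pi.add_apply, Nat.cast_add, mul_add, Finset.sum_add_distrib]
      rw [Finset.sum_eq_single (f := fun i => G.incidence u i * ((Pi.single e 1 : E → ℕ) i : ℤ)) e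
        (fun b _ hb => by simp [hb]) (by simp)]
      simp only [Pi.single_eq_same, incidence]
      split_ifs <;> push_cast <;> ring

end FlowGraph

namespace AugmentedGraph

variable {n : ℕ} {E : Type*} {G : FlowGraph n E} {a : Fin (n + 1) → ℤ} {X : Type*} [Fintype X]
  {Ghat : AugmentedGraph G a X}

lemma netflow_last_nonpos (ha_balanced : ∑ v, a v = 0)
    (ha_nonneg : ∀ v, v ≠ Fin.last n → 0 ≤ a v) : a (Fin.last n) ≤ 0 := by
  classical
  rw [← Finset.add_sum_erase _ _ (Finset.mem_univ (Fin.last n))] at ha_balanced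
  have := Finset.sum_nonneg fun v (hv : v ∈ Finset.univ.erase (Fin.last n)) =>
    ha_nonneg v (Finset.ne_of_mem_erase hv)
  linarith

/-- A count: the vertices below `n` already account for the sum of their netflows, which is `|a n|`,
the number of all inflow half-edges. -/
lemma foot_ne_last (Ghat : AugmentedGraph G a X) (ha_balanced : ∑ v, a v = 0)
    (ha_nonneg : ∀ v, v ≠ Fin.last n → 0 ≤ a v) (x : X) : Ghat.foot x ≠ Fin.last n := by
  classical
  have h1 := Finset.sum_card_fiberwise_eq_card_filter (Finset.univ : Finset X) Finset.univ Ghat.foot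
  simp only [Finset.mem_univ, Finset.filter_true, Finset.card_univ] at h1
  have h2 : ∀ v, v ≠ Fin.last n → ((Finset.univ.filter fun x => Ghat.foot x = v).card : ℤ) = a v := by
    intro v hv
    rw [← Ghat.card_foot v hv, Nat.card_eq_fintype_card, Fintype.card_subtype]
  have h3 := Ghat.card_inflow
  rw [abs_of_nonpos (netflow_last_nonpos ha_balanced ha_nonneg), ← h1] at h3
  push_cast at h3
  rw [← Finset.add_sum_erase _ _ (Finset.mem_univ (Fin.last n))] at h3 ha_balanced
  rw [Finset.sum_congr rfl fun v hv => h2 v (Finset.ne_of_mem_erase hv)] at h3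
  intro hx
  have h4 : (Finset.univ.filter fun x => Ghat.foot x = Fin.last n).card = 0 := by
    have : ((Finset.univ.filter fun x => Ghat.foot x = Fin.last n).card : ℤ) = 0 := by linarith
    exact_mod_cast this
  rw [Finset.card_eq_zero] at h4
  have : x ∈ Finset.univ.filter fun x => Ghat.foot x = Fin.last n := by simp [hx]
  rw [h4] at this
  simp at this

lemma netflow_eq (Ghat : AugmentedGraph G a X) (ha_balanced : ∑ v, a v = 0)
    (ha_nonneg : ∀ v, v ≠ Fin.last n → 0 ≤ a v) (v : Fin (n + 1)) :
    a v = ∑ x, (if Ghat.foot x = v then 1 else 0) -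
      if Fin.last n = v then (Fintype.card X : ℤ) else 0 := by
  classical
  by_cases hv : Fin.last n = v
  · subst hv
    rw [Finset.sum_eq_zero fun x _ => if_neg (Ghat.foot_ne_last ha_balanced ha_nonneg x),
      if_pos rfl, Ghat.card_inflow, abs_of_nonpos (netflow_last_nonpos ha_balanced ha_nonneg)]
    ring
  · rw [if_neg hv, sub_zero, ← Ghat.card_foot v (Ne.symm hv), Nat.card_eq_fintype_card,
      Fintype.card_subtype, Finset.card_filter]
    push_cast
    rfl

variable [Fintype E] {Fhat : Ghat.toHalf.Framing}

/-- Conservation in the augmented graph means that the underlying flow has the given netflow. -/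
lemma conserved_iff (ha_balanced : ∑ v, a v = 0) (ha_nonneg : ∀ v, v ≠ Fin.last n → 0 ≤ a v)
    {k : ℕ} {ψ : HatEdge E X → ℕ} (hin : ∀ x, ψ (.inflow x) = k)
    (hout : ψ .outflow = k * Fintype.card X) :
    (net Fhat).Conserved ψ ↔
      ∀ v, k * a v + ∑ e, G.incidence v e * (ψ (.edge e) : ℤ) = 0 := by
  have key : ∀ v : Fin (n + 1), (∑ e with (net Fhat).hd e = v + 1, ψ e =
      ∑ e with (net Fhat).tl e = v + 1, ψ e) ↔
      k * a v + ∑ e, G.incidence v e * (ψ (.edge e) : ℤ) = 0 := by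
    intro v
    rw [Finset.sum_filter, Finset.sum_filter, HatEdge.sum_eq, HatEdge.sum_eq]
    simp only [net_hd_edge, net_hd_inflow, net_hd_outflow, net_tl_edge, net_tl_inflow,
      net_tl_outflow, hin, hout, add_left_inj, Fin.val_inj]
    rw [if_neg (show ¬ n + 2 = (v : ℕ) + 1 by omega), Finset.sum_eq_zero (s := (Finset.univ : Finset X))
      (f := fun x => if 0 = (v : ℕ) + 1 then k else 0) (fun x _ => if_neg (by omega)),
      netflow_eq Ghat ha_balanced ha_nonneg v, ← Nat.cast_inj (R := ℤ)]
    have h1 : (if n = (v : ℕ) then k * Fintype.card X else 0) =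
        if Fin.last n = v then k * Fintype.card X else 0 := by
      simp only [Fin.ext_iff, Fin.val_last]
    have h2 : ∑ e, G.incidence v e * (ψ (.edge e) : ℤ) =
        ∑ e, (if G.head e = v then (ψ (.edge e) : ℤ) else 0) -
          ∑ e, if G.tail e = v then (ψ (.edge e) : ℤ) else 0 := by
      rw [← Finset.sum_sub_distrib]
      refine Finset.sum_congr rfl fun e _ => ?_
      unfold FlowGraph.incidence
      split_ifs <;> simp
    rw [h1, h2, mul_sub, Finset.mul_sum]
    push_cast
    have h3 : ∀ x, (k : ℤ) * (if Ghat.foot x = v then 1 else 0) =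
        if Ghat.foot x = v then (k : ℤ) else 0 := fun x => by split_ifs <;> simp
    have h4 : (k : ℤ) * (if Fin.last n = v then (Fintype.card X : ℤ) else 0) =
        if Fin.last n = v then (k : ℤ) * Fintype.card X else 0 := by split_ifs <;> simp
    simp only [h3, h4]
    constructor <;> intro h <;> linarith
  constructor
  · intro h v
    exact (key v).1 (h (v + 1) (by omega) (by rw [net_top]; omega))
  · intro h v hv0 hvtop
    rw [net_top] at hvtop
    have := (key ⟨v - 1, by omega⟩).2 (h _)
    simp only [show v - 1 + 1 = v by omega] at this
    exact this

namespace RouteMatching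

/-- Conservation along single routes adds up. Each inflow half-edge is used once and the outflow
half-edge by every route, so `conserved_iff` applies with `k = 1`. -/
lemma count_netflow (ha_balanced : ∑ v, a v = 0) (ha_nonneg : ∀ v, v ≠ Fin.last n → 0 ≤ a v)
    (P : RouteMatching Fhat) (v : Fin (n + 1)) :
    a v + ∑ e, G.incidence v e * (P.count e : ℤ) = 0 := by
  classical
  have hcons : (net Fhat).Conserved fun e => ∑ x, if e ∈ P.route x then 1 else 0 := by
    intro v hv0 hvtop
    rw [Finset.sum_comm, Finset.sum_comm (s := Finset.univ.filter fun e => (net Fhat).tl e = v)]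
    exact Finset.sum_congr rfl fun x _ => (P.isRoute x).conserved v hv0 hvtop
  have := (conserved_iff ha_balanced ha_nonneg (k := 1) (fun x => by
      rw [Finset.sum_eq_single x]
      · obtain ⟨q, hq⟩ := (P.isRoute x).exists_eq_cons
        rw [hq, if_pos (by simp)]
      · intro y _ hyx
        refine if_neg fun h => hyx ?_
        have := (P.isRoute y).eq_src h rfl
        simpa using this.symm
      · simp)
    (by
      rw [Finset.sum_congr rfl fun x _ => if_pos (List.mem_of_getLast? (P.last_route x))]
      simp)).1 hcons v
  simpa [count] using this

/-- Every integral flow is the total flow of an ordered sequence of route matchings. -/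
lemma exists_isOrdered_of_flow (ha_balanced : ∑ v, a v = 0)
    (ha_nonneg : ∀ v, v ≠ Fin.last n → 0 ≤ a v) {k : ℕ} {ψ : E → ℕ}
    (hψ : ∀ v, k * a v + ∑ e, G.incidence v e * (ψ e : ℤ) = 0) :
    ∃ L : Fin k → RouteMatching Fhat, IsOrdered L ∧ ∀ e, ∑ i, (L i).count e = ψ e := by
  classical
  -- On the half-edges the values are forced: k units enter at every source, and all of them leave
  -- at the sink.
  let χ : HatEdge E X → ℕ
    | .edge e => ψ e
    | .inflow _ => k
    | .outflow => k * Fintype.card X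
  obtain ⟨R, hR, hcount⟩ := RankedNet.exists_orderedFamily (N := net Fhat) (ψ := χ)
    ((conserved_iff ha_balanced ha_nonneg (fun _ => rfl) rfl).2 hψ) (fun _ => rfl)
  obtain ⟨L, hL, hLR⟩ := exists_isOrdered_of_isOrderedFamily hR
  refine ⟨L, hL, fun e => ?_⟩
  rw [← card_mem_edge]
  simp only [hLR]
  convert hcount (.edge e)

/-- The multiplicity of a matching is the number of its occurrences in the ordered sequence that
decomposes the flow. -/
lemma exists_multiplicities (ha_balanced : ∑ v, a v = 0)
    (ha_nonneg : ∀ v, v ≠ Fin.last n → 0 ≤ a v) (k : ℕ) (ψ : E → ℕ)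
    (hψ : ∀ v, k * a v + ∑ e, G.incidence v e * (ψ e : ℤ) = 0) :
    ∃ c : RouteMatching Fhat → ℕ, PairwiseCoherent Coherent (Function.support c) ∧
      ∑ P, c P = k ∧ ∀ e, ∑ P, c P * P.count e = ψ e := by
  classical
  obtain ⟨L, hL, hLψ⟩ := exists_isOrdered_of_flow (Fhat := Fhat) ha_balanced ha_nonneg hψ
  refine ⟨fun P => (Finset.univ.filter fun i => L i = P).card, ?_, ?_, fun e => ?_⟩
  · have hmem : ∀ P ∈ Function.support fun P => (Finset.univ.filter fun i => L i = P).card,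
        ∃ i, L i = P := by
      intro P hP
      obtain ⟨i, hi⟩ := Finset.card_ne_zero.1 hP
      exact ⟨i, (Finset.mem_filter.1 hi).2⟩
    intro P hP Q hQ
    obtain ⟨i, rfl⟩ := hmem P hP
    obtain ⟨j, rfl⟩ := hmem Q hQ
    exact hL.coherent i j
  · rw [← Finset.card_eq_sum_card_fiberwise fun i _ => Finset.mem_coe.2 (Finset.mem_univ (L i))]
    simp
  · rw [← hLψ, ← sum_mul_count]

/-- Adding unit flows from the feet of all inflow half-edges to the sink gives an integral flow with
netflow `a`; its decomposition for `k = 1` is a route matching. -/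
lemma nonempty (ha_balanced : ∑ v, a v = 0) (ha_nonneg : ∀ v, v ≠ Fin.last n → 0 ≤ a v) :
    Nonempty (RouteMatching Fhat) := by
  choose φ hφ using G.exists_unit_flow
  obtain ⟨L, -⟩ := exists_isOrdered_of_flow (Fhat := Fhat) ha_balanced ha_nonneg (k := 1)
    (ψ := fun e => ∑ x, φ (Ghat.foot x) e) fun v => by
      have h1 : ∑ e, G.incidence v e * ((∑ x, φ (Ghat.foot x) e : ℕ) : ℤ) =
          ∑ x, ((if Fin.last n = v then 1 else 0) - if Ghat.foot x = v then 1 else 0) := by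
        push_cast
        simp only [Finset.mul_sum]
        rw [Finset.sum_comm]
        refine Finset.sum_congr rfl fun x _ => ?_
        rw [← hφ (Ghat.foot x) v]
        ring
      rw [h1, netflow_eq Ghat ha_balanced ha_nonneg v, Finset.sum_sub_distrib, Finset.sum_const,
        Finset.card_univ]
      split_ifs <;> simp
  exact ⟨L 0⟩

/-- The points of the flow polytope have unique coordinates with respect to the cliques. -/
theorem cliqueCoordinates (Fhat : Ghat.toHalf.Framing) (ha_balanced : ∑ v, a v = 0)
    (ha_nonneg : ∀ v, v ≠ Fin.last n → 0 ≤ a v) :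
    CliqueCoordinates (flow (Fhat := Fhat)) Coherent (G.flowPolytope a) := by
  have := nonempty (Fhat := Fhat) ha_balanced ha_nonneg
  have h := CliqueCoordinates.of_integral (Coh := Coherent (Fhat := Fhat)) (w := count)
    G.incidence a coherent_refl (count_netflow ha_balanced ha_nonneg)
    (exists_multiplicities ha_balanced ha_nonneg) multiplicities_unique
  rw [← G.flowPolytope_eq] at h
  rwa [show (flow (Fhat := Fhat)) = fun P e => (P.count e : ℝ) from funext flow_eq_count]

end RouteMatching

end AugmentedGraph

end FlowTri

namespace FlowTri

/-! ### The case of a single source and a single sink -/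

lemma FlowGraph.isPath_iff {n : ℕ} {E : Type*} {G : FlowGraph n E} {P : List E} :
    G.toHalf.IsPath P ↔ P ≠ [] ∧ P.IsChain fun e f => G.head e = G.tail f := by
  simp [HalfEdgeGraph.IsPath, toHalf, eq_comm]

/-- The edges following `e` and `f` leave the same vertex, hence are at the same place of the walk,
which forces `e = f`. This makes a single route a coherent set. -/
lemma RankedNet.IsWalk.not_crossing_self {D X : Type*} {N : RankedNet D X} {P : List D}
    (hP : N.IsWalk P) : ¬ N.Crossing P P := by
  rintro ⟨c, p, p', q, q', e, f, g, h, h1, h2, h3, h4, -⟩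
  have hcons : ∀ (g : D) (p' : List D), ∃ b r, c ++ g :: p' = b :: r := fun g p' => by
    cases c with
    | nil => exact ⟨g, p', rfl⟩
    | cons b c => exact ⟨b, _, rfl⟩
  obtain ⟨b, r, hb⟩ := hcons g p'
  obtain ⟨b', r', hb'⟩ := hcons h q'
  rw [hb] at h1
  rw [hb'] at h2
  have heq := (hP.eq_of_tl_eq (p := p ++ [e]) (p' := q ++ [f]) (by simpa using h1)
    (by simpa using h2) (by rw [← hP.adj h1, ← hP.adj h2, h3])).1
  have : e = f := by simpa using (List.append_inj' heq rfl).2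
  subst this
  exact lt_irrefl _ h4

namespace AugmentedGraph

section Augment

variable {E X : Type*}

/-- The path in the augmented graph that starts with `x`, continues along `P`, and ends with the
outflow half-edge. -/
def augment (x : X) (P : List E) : List (HatEdge E X) :=
  .inflow x :: (P.map .edge ++ [.outflow])

lemma edge_injective : Function.Injective (HatEdge.edge : E → HatEdge E X) :=
  fun _ _ h => by simpa using h

lemma augment_injective (x : X) : Function.Injective (augment (E := E) x) := by
  intro P Q h
  simp only [augment, List.cons.injEq, true_and] at h
  exact (List.map_injective_iff.2 edge_injective) (List.append_cancel_right h)

lemma edge_mem_augment {x : X} {P : List E} {e : E} : HatEdge.edge e ∈ augment x P ↔ e ∈ P := by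
  simp [augment]

end Augment

variable {n : ℕ} {E : Type*} {G : FlowGraph n E} {a : Fin (n + 1) → ℤ} {X : Type*} [Fintype X]
  {Ghat : AugmentedGraph G a X}

lemma isPath_augment_iff {x : X} {P : List E} (hP : P ≠ []) : Ghat.toHalf.IsPath (augment x P) ↔
    G.toHalf.IsPath P ∧ (∀ e ∈ P.head?, Ghat.foot x = G.tail e) ∧
      ∀ e ∈ P.getLast?, G.head e = Fin.last n := by
  rw [FlowGraph.isPath_iff]
  unfold HalfEdgeGraph.IsPath augment
  rw [List.isChain_cons, List.isChain_append, List.isChain_map]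
  obtain ⟨b, P, rfl⟩ := List.exists_cons_of_ne_nil hP
  have h1 : ∃ l, (b :: P).getLast? = some l := ⟨_, List.getLast?_eq_some_getLast hP⟩
  obtain ⟨l, hl⟩ := h1
  simp only [ne_eq, reduceCtorEq, not_false_eq_true, true_and, List.getLast?_map, hl]
  simp [toHalf, eq_comm]
  tauto

/-- Every vertex other than 0 has an incoming edge and every vertex other than `n` an outgoing one,
while nothing enters 0 or leaves `n`; so the inextensible paths are those from 0 to `n`. -/
lemma isRoute_iff (h0 : ∀ v, v ≠ 0 → ∃ e, G.head e = v) {P : List E} : G.IsRoute P ↔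
    G.toHalf.IsPath P ∧ (∀ e ∈ P.head?, 0 = G.tail e) ∧ ∀ e ∈ P.getLast?, G.head e = Fin.last n := by
  unfold FlowGraph.IsRoute
  refine and_congr_right fun hP => ?_
  obtain ⟨hne, hchain⟩ := FlowGraph.isPath_iff.1 hP
  refine and_congr ?_ ?_
  · constructor
    · intro h e he
      by_contra hne0
      obtain ⟨d, hd⟩ := h0 _ (Ne.symm hne0)
      refine h d (FlowGraph.isPath_iff.2 ⟨by simp, List.isChain_cons.2 ⟨fun f hf => ?_, hchain⟩⟩)
      rw [Option.mem_unique hf he, hd]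
    · intro h d hd
      have hd := (List.isChain_cons.1 (FlowGraph.isPath_iff.1 hd).2).1
      obtain ⟨b, P, rfl⟩ := List.exists_cons_of_ne_nil hne
      have h1 := hd b (by simp)
      have h2 := h b (by simp)
      have := G.tail_lt_head d
      rw [h1, ← h2] at this
      exact absurd this (Fin.not_lt_zero _)
  · constructor
    · intro h e he
      by_contra hne0
      obtain ⟨d, hd⟩ := G.exists_out _ hne0
      refine h d (FlowGraph.isPath_iff.2 ⟨by simp, List.isChain_append.2
        ⟨hchain, by simp, fun f hf g hg => ?_⟩⟩)
      obtain rfl : d = g := by simpa using hg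
      rw [Option.mem_unique hf he, hd]
    · intro h d hd
      have hd := (List.isChain_append.1 (FlowGraph.isPath_iff.1 hd).2).2.2
      have h1 := hd _ (List.getLast?_eq_some_getLast hne) d (by simp)
      have h2 := h _ (List.getLast?_eq_some_getLast hne)
      have := G.tail_lt_head d
      rw [← h1, h2] at this
      exact absurd this (Fin.le_last _).not_gt

/-- Tails increase strictly along a route, so an inflow half-edge can only come first and the
outflow half-edge only last. -/
lemma exists_eq_augment [Fintype E] (Fhat : Ghat.toHalf.Framing) {x : X} {L : List (HatEdge E X)}
    (hL : (net Fhat).IsRoute x L) : ∃ P, L = augment x P := by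
  obtain ⟨l, rfl⟩ := hL.exists_eq_cons
  obtain ⟨p, e, hp, he⟩ := hL.last
  obtain rfl : e = .outflow := (net_hd_eq_top_iff Fhat).1 he
  cases p with
  | nil => simp at hp
  | cons b p =>
    simp only [List.cons_append, List.cons.injEq] at hp
    obtain ⟨rfl, rfl⟩ := hp
    have hpw := hL.walk.pairwise_tl
    simp only [List.pairwise_cons, List.pairwise_append, List.mem_append, List.mem_singleton] at hpw
    have : ∀ d ∈ p, d ∈ Set.range (HatEdge.edge : E → HatEdge E X) := by
      intro d hd
      cases d with
      | edge e => exact ⟨e, rfl⟩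
      | inflow y => exact absurd (hpw.1 _ (.inl hd)) (by simp)
      | outflow => exact absurd (hpw.2.2.2 _ hd _ rfl) (lt_irrefl _)
    rw [← Set.mem_ofPred_eq (p := fun l => ∀ d ∈ l, d ∈ Set.range (HatEdge.edge : E → HatEdge E X)),
      ← Set.range_list_map] at this
    obtain ⟨P, rfl⟩ := this
    exact ⟨P, rfl⟩

variable {Fhat : Ghat.toHalf.Framing} {F : G.toHalf.Framing}

/-- The only edge into 0 is the inflow half-edge and the only edge out of `n` is the outflow
half-edge, so neither takes part in a strict comparison. All four edges of a crossing are then edges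
of `G`, where the framings agree. -/
lemma crosses_augment_iff (hF : ConsistentWith Fhat F) [Subsingleton X]
    {x y : X} (hx : Ghat.foot x = 0) {P Q : List E} :
    Fhat.Crosses (augment x P) (augment y Q) ↔ F.Crosses P Q := by
  obtain rfl := Subsingleton.elim x y
  constructor
  · rintro ⟨c, p, p', q, q', e, f, g, h, v, w, hP, hQ, hef, hhg⟩
    have key : ∀ {v e f}, Fhat.InLt v e f → ∃ e' f', e = .edge e' ∧ f = .edge f' := by
      rintro v e f h
      have hne : e ≠ f := by rintro rfl; exact Fhat.not_inLt_self _ _ h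
      obtain ⟨he, hf, -⟩ := h
      cases e with
      | outflow => simp [toHalf] at he
      | edge e =>
        cases f with
        | outflow => simp [toHalf] at hf
        | edge f => exact ⟨e, f, rfl, rfl⟩
        | inflow z =>
          exfalso
          simp only [toHalf, Option.some.injEq] at he hf
          rw [Subsingleton.elim z x, hx] at hf
          have := G.tail_lt_head e
          rw [he, ← hf] at this
          exact Fin.not_lt_zero _ this
      | inflow z =>
        cases f with
        | outflow => simp [toHalf] at hf
        | inflow z' => exact absurd (by rw [Subsingleton.elim z z']) hne
        | edge f =>
          exfalso
          simp only [toHalf, Option.some.injEq] at he hf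
          rw [Subsingleton.elim z x, hx] at he
          have := G.tail_lt_head f
          rw [hf, ← he] at this
          exact Fin.not_lt_zero _ this
    have key' : ∀ {v e f}, Fhat.OutLt v e f → ∃ e' f', e = .edge e' ∧ f = .edge f' := by
      rintro v e f h
      have hne : e ≠ f := by rintro rfl; exact Fhat.not_outLt_self _ _ h
      obtain ⟨he, hf, -⟩ := h
      cases e with
      | inflow => simp [toHalf] at he
      | edge e =>
        cases f with
        | inflow => simp [toHalf] at hf
        | edge f => exact ⟨e, f, rfl, rfl⟩
        | outflow =>
          exfalso
          simp only [toHalf, Option.some.injEq] at he hf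
          have := G.tail_lt_head e
          rw [he, ← hf] at this
          exact (Fin.le_last _).not_gt this
      | outflow =>
        cases f with
        | inflow => simp [toHalf] at hf
        | outflow => exact absurd rfl hne
        | edge f =>
          exfalso
          simp only [toHalf, Option.some.injEq] at he hf
          have := G.tail_lt_head f
          rw [hf, ← he] at this
          exact (Fin.le_last _).not_gt this
    obtain ⟨e, f, rfl, rfl⟩ := key hef
    obtain ⟨h, g, rfl, rfl⟩ := key' hhg
    have split : ∀ {P : List E} {p p' : List (HatEdge E X)} {e g : E},
        augment x P = p ++ .edge e :: (c ++ .edge g :: p') →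
        ∃ p₀ c₀ p₁, P = p₀ ++ e :: (c₀ ++ g :: p₁) ∧ c = c₀.map .edge := by
      intro P p p' e g hP
      unfold augment at hP
      cases p with
      | nil => simp at hP
      | cons b p =>
        simp only [List.cons_append, List.cons.injEq] at hP
        obtain ⟨-, hP⟩ := hP
        induction p' using List.reverseRecOn with
        | nil =>
          have : P.map HatEdge.edge ++ [HatEdge.outflow] =
            (p ++ .edge e :: c) ++ [.edge g] := by rw [hP]; simp
          have := (List.append_inj' this rfl).2
          simp at this
        | append_singleton p' b _ =>
          have : P.map HatEdge.edge ++ [HatEdge.outflow] =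
            (p ++ .edge e :: (c ++ .edge g :: p')) ++ [b] := by rw [hP]; simp
          have := (List.append_inj' this rfl).1
          obtain ⟨p₀, r, rfl, -, hr⟩ := List.map_eq_append_iff.1 this
          obtain ⟨e', r, rfl, he, hr⟩ := List.map_eq_cons_iff.1 hr
          obtain ⟨c₀, r, rfl, hc, hr⟩ := List.map_eq_append_iff.1 hr
          obtain ⟨g', p₁, rfl, hg, -⟩ := List.map_eq_cons_iff.1 hr
          rw [edge_injective he, edge_injective hg]
          exact ⟨p₀, c₀, p₁, rfl, hc.symm⟩
    obtain ⟨p₀, c₀, p₁, rfl, hc⟩ := split hP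
    obtain ⟨q₀, c₁, q₁, rfl, hc'⟩ := split hQ
    obtain rfl : c₀ = c₁ := (List.map_injective_iff.2 edge_injective) (hc.symm.trans hc')
    exact ⟨c₀, p₀, p₁, q₀, q₁, e, f, g, h, v, w, rfl, rfl, (hF v e f).1.1 hef, (hF w h g).2.1 hhg⟩
  · rintro ⟨c, p, p', q, q', e, f, g, h, v, w, rfl, rfl, hef, hhg⟩
    exact ⟨c.map .edge, .inflow x :: p.map .edge, p'.map .edge ++ [.outflow],
      .inflow x :: q.map .edge, q'.map .edge ++ [.outflow], .edge e, .edge f, .edge g, .edge h,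
      v, w, by simp [augment], by simp [augment], (hF v e f).1.2 hef, (hF w h g).2.2 hhg⟩

/-- With a single inflow half-edge at the single source, route matchings are routes. -/
theorem image_simplex_eq_DKK [Fintype E] (hF : ConsistentWith Fhat F) (hn : 0 < n)
    (h0 : ∀ v, v ≠ 0 → ∃ e, G.head e = v) (x : X) [Subsingleton X] (hx : Ghat.foot x = 0) :
    simplex '' satCliques Fhat = G.DKK F := by
  classical
  have hlast : (0 : Fin (n + 1)) ≠ Fin.last n := by
    rw [Ne, Fin.ext_iff]
    simpa using hn.ne
  have hex : ∀ M : RouteMatching Fhat, ∃ P, M.route x = augment x P := fun M =>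
    exists_eq_augment Fhat (M.isRoute x)
  choose ρ hρ using hex
  have hroute : ∀ M, G.IsRoute (ρ M) := by
    intro M
    have hM := M.isPath x
    rw [hρ] at hM
    -- An inflow half-edge followed directly by the outflow half-edge would need `0 = n`.
    have hne : ρ M ≠ [] := by
      intro h
      rw [h] at hM
      have := (List.isChain_cons_cons.1 hM.2).1
      simp only [toHalf, Option.some.injEq, hx] at this
      obtain ⟨v, rfl, h⟩ := this
      exact hlast h.symm
    rw [isPath_augment_iff hne, hx] at hM
    exact (isRoute_iff h0).2 hM
  have hcoh : ∀ M M', M.Coherent M' ↔ F.Coherent (ρ M) (ρ M') := by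
    intro M M'
    rw [F.coherent_iff_not_crosses (hroute M).1 (hroute M').1]
    have h1 : M.Coherent M' ↔ M.LocallyCoherent M' :=
      ⟨And.left, fun h => ⟨h, fun y y' hg => hg.1 (Subsingleton.elim _ _)⟩⟩
    rw [h1, RouteMatching.locallyCoherent_iff]
    simp only [net_crossing_iff]
    rw [← crosses_augment_iff hF hx (x := x) (y := x), ← crosses_augment_iff hF hx (x := x) (y := x),
      ← hρ, ← hρ]
    exact ⟨fun h => h x x, fun h y y' => by
      rw [Subsingleton.elim y x, Subsingleton.elim y' x]; exact h⟩
  have hinj : Function.Injective ρ := by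
    intro M M' h
    refine RouteMatching.ext_route (funext fun y => ?_)
    rw [Subsingleton.elim y x, hρ, hρ, h]
  have hsurj : ∀ P, G.IsRoute P → ∃ M, ρ M = P := by
    intro P hP
    have hP' := (isRoute_iff h0).1 hP
    rw [← hx, ← isPath_augment_iff hP.1.1] at hP'
    let M : RouteMatching Fhat :=
      { route := fun _ => augment x P
        isPath := fun _ => hP'
        head_route := fun y => by rw [Subsingleton.elim y x]; rfl
        last_route := fun _ => by
          rw [augment, ← List.cons_append, List.getLast?_append]; rfl
        coherent := by
          rintro _ ⟨_, rfl⟩ _ ⟨_, rfl⟩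
          rw [Fhat.coherent_iff_not_crosses hP' hP', ← net_crossing_iff, and_self]
          exact ((isPath_iff_isWalk Fhat).1 hP').2.not_crossing_self }
    exact ⟨M, augment_injective x (hρ M).symm⟩
  have hclique : ∀ C : Set (RouteMatching Fhat), IsClique Fhat C ↔ G.IsRouteClique F (ρ '' C) := by
    intro C
    simp only [IsClique, FlowGraph.IsRouteClique, HalfEdgeGraph.Framing.CoherentSet,
      Set.forall_mem_image, hcoh]
    exact ⟨fun h => ⟨fun M _ => hroute M, h⟩, And.right⟩
  have hsimplex : ∀ C : Set (RouteMatching Fhat), simplex C = FlowGraph.routeSimplex (ρ '' C) := by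
    intro C
    unfold simplex FlowGraph.routeSimplex
    rw [Set.image_image]
    congr 2
    funext M
    unfold RouteMatching.flow
    have : Unique X := ⟨⟨x⟩, fun y => Subsingleton.elim _ _⟩
    rw [Fintype.sum_subsingleton _ x, hρ]
    simp only [edge_mem_augment]
  have himage : ∀ D, G.IsRouteClique F D → ∃ C, ρ '' C = D := by
    intro D hD
    exact ⟨ρ ⁻¹' D, Set.image_preimage_eq_of_subset fun P hP => hsurj P (hD.1 P hP)⟩
  ext T
  constructor
  · rintro ⟨C, hC, rfl⟩
    refine ⟨ρ '' C, ⟨(hclique C).1 hC.prop, ?_⟩, (hsimplex C).symm⟩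
    intro D hD hCD
    obtain ⟨C', rfl⟩ := himage D hD
    exact Set.image_mono (hC.2 ((hclique C').2 hD) ((Set.image_subset_image_iff hinj).1 hCD))
  · rintro ⟨D, hD, rfl⟩
    obtain ⟨C, rfl⟩ := himage D hD.prop
    refine ⟨C, ⟨(hclique C).2 hD.prop, ?_⟩, hsimplex C⟩
    intro C' hC' hCC'
    exact (Set.image_subset_image_iff hinj).1 (hD.2 ((hclique C').1 hC') (Set.image_mono hCC'))

end AugmentedGraph

end FlowTri

/-! ### The augmented graph for the netflow `e_0 - e_n` -/

namespace FlowTri.AugmentedGraph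

variable {n : ℕ} {E X : Type*} {G : FlowGraph n E} [Fintype X]

lemma card_eq_one_of_unit_netflow (hn : 0 < n)
    (Ghat : AugmentedGraph G (Pi.single 0 1 - Pi.single (Fin.last n) 1) X) :
    Fintype.card X = 1 := by
  have h := Ghat.card_inflow
  have h0 : Fin.last n ≠ 0 := by
    rw [Ne, Fin.ext_iff]
    simpa using hn.ne'
  simp only [Pi.sub_apply, Pi.single_eq_same, Pi.single_eq_of_ne h0] at h
  norm_num at h
  exact_mod_cast h

lemma foot_eq_zero_of_unit_netflow
    (Ghat : AugmentedGraph G (Pi.single 0 1 - Pi.single (Fin.last n) 1) X) {x : X}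
    (hx : Ghat.foot x ≠ Fin.last n) : Ghat.foot x = 0 := by
  by_contra h0
  have h := Ghat.card_foot _ hx
  simp only [Pi.sub_apply, Pi.single_eq_of_ne h0, Pi.single_eq_of_ne hx, sub_zero,
    Nat.cast_eq_zero] at h
  have : Nonempty {y // Ghat.foot y = Ghat.foot x} := ⟨⟨x, rfl⟩⟩
  exact Nat.card_pos.ne' h

end FlowTri.AugmentedGraph

theorem theorem1p1 {n : ℕ} {E X : Type*} [Fintype E] [Fintype X]
    (G : FlowTri.FlowGraph n E) (F : G.toHalf.Framing)
    (a : Fin (n + 1) → ℤ) (ha_balanced : ∑ v, a v = 0)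
    (ha_nonneg : ∀ v, v ≠ Fin.last n → 0 ≤ a v)
    (Ghat : FlowTri.AugmentedGraph G a X) (Fhat : Ghat.toHalf.Framing)
    (hF : FlowTri.AugmentedGraph.ConsistentWith Fhat F) :
    -- the simplices of the saturated cliques form a unimodular triangulation
    FlowTri.IsUnimodularTriangulation (G.flowPolytope a)
      (FlowTri.AugmentedGraph.simplex '' FlowTri.AugmentedGraph.satCliques Fhat) ∧
    -- each of them is a simplex whose vertices are indexed by the route matchings of the clique
    (∀ C ∈ FlowTri.AugmentedGraph.satCliques Fhat,
      AffineIndependent ℝ (fun P : C => P.1.flow)) ∧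
    -- distinct saturated cliques have distinct simplices
    Set.InjOn FlowTri.AugmentedGraph.simplex (FlowTri.AugmentedGraph.satCliques Fhat) ∧
    -- for netflow `e_0 - e_n` this is the Danilov–Karzanov–Koshevoy triangulation
    (0 < n → (∀ v, v ≠ 0 → ∃ e, G.head e = v) →
      a = Pi.single 0 1 - Pi.single (Fin.last n) 1 →
      FlowTri.AugmentedGraph.simplex '' FlowTri.AugmentedGraph.satCliques Fhat = G.DKK F) := by
  have h := FlowTri.AugmentedGraph.RouteMatching.cliqueCoordinates Fhat ha_balanced ha_nonneg
  refine ⟨h.isUnimodularTriangulation, fun C hC => h.affineIndependent hC.prop,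
    h.injOn.mono fun C hC => hC.prop, ?_⟩
  rintro hn h0 rfl
  obtain ⟨x, hx⟩ := Fintype.card_eq_one_iff.1 (Ghat.card_eq_one_of_unit_netflow hn)
  have : Subsingleton X := ⟨fun y z => (hx y).trans (hx z).symm⟩
  exact FlowTri.AugmentedGraph.image_simplex_eq_DKK hF hn h0 x
    (Ghat.foot_eq_zero_of_unit_netflow (Ghat.foot_ne_last ha_balanced ha_nonneg x))
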